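/- Notation. Let $n\ge 1$. For $k\in\mathbb N_0$, $m\in\mathbb Z^n$ let $Q_{k,m}=\prod_{i=1}^n[2^{-k}m_i,2^{-k}(m_i+1)]$. All formulas below are understood with the usual essential-supremum / supremum modification when an exponent is $\infty$. Weights. Let $p,q,\sigma_1,\sigma_2\in(0,\infty]$, $\alpha_1,\alpha_2\in\mathbb R$, $\alpha_3\ge0$. Let $\{t_k\}_{k\ge0}$ belong to $\mathcal X^{\alpha_3}_{\alpha,\sigma,p}$, $\alpha=(\alpha_1,\alpha_2)$, $\sigma=(\sigma_1,\sigma_2)$. This means: each $t_k$ is measurable on $\mathbb R^n$, positive almost everywhere and in $L_p^{\rm loc}$; there are $C_1,C_2>0$ such that for all $0\le k\le j$ and $m\in\mathbb Z^n$ $$\Bigl(2^{kn}\!\int_{Q_{k,m}}t_k^p\Bigr)^{\frac1p}\Bigl(2^{kn}\!\int_{Q_{k,m}}t_j^{-\sigma_1}\Bigr)^{\frac1{\sigma_1}}\le C_12^{\alpha_1(k-j)},\qquad \Bigl(2^{kn}\!\int_{Q_{k,m}}t_k^p\Bigr)^{-\frac1p}\Bigl(2^{kn}\!\int_{Q_{k,m}}t_j^{\sigma_2}\Bigr)^{\frac1{\sigma_2}}\le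 C_22^{\alpha_2(j-k)};$$ and the numbers $t_{k,m}=\|t_k|L_p(Q_{k,m})\|$ satisfy $0<t_{k,m}\le2^{\alpha_3}t_{k,\widetilde m}$ whenever $|m_i-\widetilde m_i|\le1$ for all $i$. Domain. Let $M\ge1$, let $\varpi:\mathbb R^{n-1}\to\mathbb R$ be Lipschitz with constant $M$, let $G=\{x=(x',x_n)\in\mathbb R^n:x_n>\varpi(x')\}$ (a special Lipschitz domain) and $K=\{x:x_n>M|x'|\}$. Distributions. $S_e$ is the space of all $\theta\in C^\infty(\mathbb R^n)$ with $p_N(\theta)=\sup_x e^{N|x|}\sum_{|\beta|\le N}|D^\beta\theta(x)|<\infty$ for all $N\in\mathbb N_0$, topologized by the seminorms $p_N$, and $S_e'$ is its dual. $S_e'(G)$ is the set of all $f\in D'(G)$ for which there are $C,N$ with $|\langle f,\theta\rangle|\le C\sup_{x\in G,\,|\beta|\le N}|D^\beta\theta(x)|e^{N|x|}$ for all $\theta\in D(G)$. Kernels and quasi-norms. Let $\varphi_0$ be a smooth function with compact support contained in $-K$ and $\int\varphi_0\,dx=1$. Put $\varphi(x)=\varphi_0(x)-2^{-n}\varphi_0(x/2)$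 and $\varphi_j(x)=2^{jn}\varphi(2^jx)$ for $j\ge1$. Let $L_\varphi$ be the supremum of the integers $L\ge-1$ such that $\int x^\beta\varphi(x)\,dx=0$ for all multi-indices $|\beta|\le L$. For $g\in S_e'$ put $$\|g|B^{\varphi_0}_{p,q}(\{t_k\})\|=\Bigl(\sum_{k=0}^\infty\|t_k(\varphi_k*g)|L_p(\mathbb R^n)\|^q\Bigr)^{1/q}\in[0,\infty],$$ and for $f\in D'(G)$ let $$\|f|B^{\varphi_0}_{p,q}(G,\{t_k\})\|=\inf\bigl\{\|g|B^{\varphi_0}_{p,q}(\{t_k\})\|:\ g\in S_e',\ g|_G=f\text{ in }D'(G)\bigr\}\qquad(\inf\emptyset=\infty).$$ Theorem. Assume $\sigma_2\ge p$ and $L_\varphi+1>\alpha_2$. Then there is a constant $C>0$ such that for all $f\in S_e'(G)$ $$\frac1C\,\|f|B^{\varphi_0}_{p,q}(G,\{t_k\})\|\le\Bigl(\sum_{j=0}^\infty\Bigl(\int_Gt_j^p(x)\,|\varphi_j*f(x)|^p\,dx\Bigr)^{\frac qp}\Bigr)^{\frac1q}\le C\,\|f|B^{\varphi_0}_{p,q}(G,\{t_k\})\|$$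 as an inequality in $[0,\infty]$; in particular one side is finite if and only if the other is. Here $\varphi_j*f(x)=\langle f,\varphi_j(x-\cdot)\rangle$ for $x\in G$, which is defined because $\varphi_j(x-\cdot)\in D(G)$. -/

import Mathlib

open MeasureTheory TopologicalSpace
open scoped ENNReal NNReal ContDiff Distributions

namespace VarBesov

noncomputable section

/-! ### Sequence spaces, dyadic cubes, weight sequences -/

/-- The (extended) `ℓ_q` quasi-norm of a sequence in `[0, ∞]`, for `0 < q ≤ ∞`. -/
def lqNorm (q : ℝ≥0∞) (a : ℕ → ℝ≥0∞) : ℝ≥0∞ :=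
  if q = (⊤ : ℝ≥0∞) then ⨆ k, a k else (∑' k, a k ^ q.toReal) ^ (1 / q.toReal)

/-- The closed dyadic cube `Q_{k,m} = ∏ [m_i / 2^k, (m_i + 1) / 2^k]` of rank `k`. -/
def dyadicCube {n : ℕ} (k : ℕ) (m : Fin n → ℤ) : Set (EuclideanSpace ℝ (Fin n)) :=
  {x | ∀ i, (m i : ℝ) / 2 ^ k ≤ x i ∧ x i ≤ ((m i : ℝ) + 1) / 2 ^ k}

/-- The normalised quasi-norm `(2^{kn} ∫_{Q_{k,m}} |g|^r)^{1/r}`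
(the essential supremum of `|g|` over `Q_{k,m}` if `r = ∞`). -/
def cubeMean {n : ℕ} (r : ℝ≥0∞) (k : ℕ) (m : Fin n → ℤ)
    (g : EuclideanSpace ℝ (Fin n) → ℝ) : ℝ≥0∞ :=
  eLpNorm g r ((2 : ℝ≥0∞) ^ (k * n) • volume.restrict (dyadicCube k m))

/-- The numbers `t_{k,m} = ‖t_k | L_p(Q_{k,m})‖`. -/
def cubeNorm {n : ℕ} (p : ℝ≥0∞) (t : ℕ → EuclideanSpace ℝ (Fin n) → ℝ)
    (k : ℕ) (m : Fin n → ℤ) : ℝ≥0∞ :=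
  eLpNorm (t k) p (volume.restrict (dyadicCube k m))

/-- `p`-admissible weight sequences: measurable, positive almost everywhere, locally in `L_p`. -/
structure IsAdmissible {n : ℕ} (p : ℝ≥0∞) (t : ℕ → EuclideanSpace ℝ (Fin n) → ℝ) : Prop where
  aemeasurable : ∀ k, AEMeasurable (t k) volume
  pos : ∀ k, ∀ᵐ x ∂volume, 0 < t k x
  memLp : ∀ k, ∀ K : Set (EuclideanSpace ℝ (Fin n)), IsCompact K →
    MemLp (t k) p (volume.restrict K)

/-- The class of weight sequences `X^{α₃}_{α,σ,p}`, `α = (α₁, α₂)`, `σ = (σ₁, σ₂)`. -/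
structure WeightClass {n : ℕ} (p σ₁ σ₂ : ℝ≥0∞) (α₁ α₂ α₃ : ℝ)
    (t : ℕ → EuclideanSpace ℝ (Fin n) → ℝ) : Prop where
  admissible : IsAdmissible p t
  lower : ∃ C₁ : ℝ, 0 < C₁ ∧ ∀ k j : ℕ, k ≤ j → ∀ m : Fin n → ℤ,
    cubeMean p k m (t k) * cubeMean σ₁ k m (fun x => (t j x)⁻¹) ≤
      ENNReal.ofReal (C₁ * 2 ^ (α₁ * ((k : ℝ) - j)))
  upper : ∃ C₂ : ℝ, 0 < C₂ ∧ ∀ k j : ℕ, k ≤ j → ∀ m : Fin n → ℤ,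
    (cubeMean p k m (t k))⁻¹ * cubeMean σ₂ k m (t j) ≤
      ENNReal.ofReal (C₂ * 2 ^ (α₂ * ((j : ℝ) - k)))
  neighbour : ∀ k : ℕ, ∀ m m' : Fin n → ℤ, (∀ i, |m i - m' i| ≤ 1) →
    0 < cubeNorm p t k m ∧ cubeNorm p t k m ≤ ENNReal.ofReal (2 ^ α₃) * cubeNorm p t k m'

/-! ### The test space `S_e` and its dual -/

section Se

variable (𝕜 : Type*) [RCLike 𝕜] (n : ℕ)

/-- `exp(N|x|) ∑_{i ≤ N} |D^i θ(x)|`, with `|D^i θ(x)|` the norm of the `i`-th Fréchet derivative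
(equivalently, up to constants, the sum over all partial derivatives of order at most `N`). -/
def expWeight {𝕜 : Type*} [RCLike 𝕜] {n : ℕ} (N : ℕ) (θ : EuclideanSpace ℝ (Fin n) → 𝕜)
    (x : EuclideanSpace ℝ (Fin n)) : ℝ :=
  Real.exp (N * ‖x‖) * ∑ i ∈ Finset.range (N + 1), ‖iteratedFDeriv ℝ i θ x‖

variable {𝕜 n} in
lemma expWeight_nonneg (N : ℕ) (θ : EuclideanSpace ℝ (Fin n) → 𝕜)
    (x : EuclideanSpace ℝ (Fin n)) : 0 ≤ expWeight N θ x := by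
  unfold expWeight; positivity

variable {𝕜 n} in
lemma expWeight_add_le (N : ℕ) {θ η : EuclideanSpace ℝ (Fin n) → 𝕜}
    (hθ : ContDiff ℝ ∞ θ) (hη : ContDiff ℝ ∞ η) (x : EuclideanSpace ℝ (Fin n)) :
    expWeight N (θ + η) x ≤ expWeight N θ x + expWeight N η x := by
  unfold expWeight
  rw [← mul_add, ← Finset.sum_add_distrib]
  gcongr with i hi
  rw [iteratedFDeriv_add_apply ((hθ.of_le (by exact_mod_cast le_top)).contDiffAt)
    ((hη.of_le (by exact_mod_cast le_top)).contDiffAt)]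
  exact norm_add_le _ _

variable {𝕜 n} in
lemma expWeight_smul (N : ℕ) (c : 𝕜) {θ : EuclideanSpace ℝ (Fin n) → 𝕜}
    (hθ : ContDiff ℝ ∞ θ) (x : EuclideanSpace ℝ (Fin n)) :
    expWeight N (c • θ) x = ‖c‖ * expWeight N θ x := by
  unfold expWeight
  rw [mul_left_comm]
  congr 1
  rw [Finset.mul_sum]
  refine Finset.sum_congr rfl fun i _ => ?_
  have h : ContDiffAt ℝ i θ x := (hθ.of_le (by exact_mod_cast le_top)).contDiffAt
  rw [iteratedFDeriv_const_smul_apply h, norm_smul]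

/-- The vector space of smooth functions all of whose derivatives decay faster than any
exponential `exp(-N|x|)`. -/
def seSubmodule : Submodule 𝕜 (EuclideanSpace ℝ (Fin n) → 𝕜) where
  carrier := {θ | ContDiff ℝ ∞ θ ∧ ∀ N : ℕ, BddAbove (Set.range (expWeight N θ))}
  zero_mem' := by
    refine ⟨contDiff_const, fun N => ⟨0, ?_⟩⟩
    rintro _ ⟨x, rfl⟩
    have := expWeight_smul N (0 : 𝕜) (θ := (0 : EuclideanSpace ℝ (Fin n) → 𝕜)) contDiff_const x
    simp only [smul_zero, norm_zero, zero_mul] at this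
    exact this.le
  add_mem' := by
    rintro θ η ⟨hθ, hθ'⟩ ⟨hη, hη'⟩
    refine ⟨hθ.add hη, fun N => ?_⟩
    obtain ⟨A, hA⟩ := hθ' N
    obtain ⟨B, hB⟩ := hη' N
    refine ⟨A + B, ?_⟩
    rintro _ ⟨x, rfl⟩
    exact (expWeight_add_le N hθ hη x).trans (add_le_add (hA ⟨x, rfl⟩) (hB ⟨x, rfl⟩))
  smul_mem' := by
    rintro c θ ⟨hθ, hθ'⟩
    refine ⟨hθ.const_smul c, fun N => ?_⟩
    obtain ⟨A, hA⟩ := hθ' N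
    refine ⟨‖c‖ * A, ?_⟩
    rintro _ ⟨x, rfl⟩
    rw [expWeight_smul N c hθ x]
    exact mul_le_mul_of_nonneg_left (hA ⟨x, rfl⟩) (norm_nonneg c)

/-- The space `S_e` (a type of its own, so that it does not inherit the topology of pointwise
convergence). -/
def Se : Type _ := seSubmodule 𝕜 n

instance instAddCommGroupSe : AddCommGroup (Se 𝕜 n) :=
  inferInstanceAs (AddCommGroup (seSubmodule 𝕜 n))

instance instModuleSe : Module 𝕜 (Se 𝕜 n) :=
  inferInstanceAs (Module 𝕜 (seSubmodule 𝕜 n))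

/-- The seminorms `p_N(θ) = sup_x exp(N|x|) ∑_{i ≤ N} |D^i θ(x)|` on `S_e`. -/
def seSeminorm (N : ℕ) : Seminorm 𝕜 (Se 𝕜 n) :=
  Seminorm.ofSMulLE (fun θ => ⨆ x, expWeight N θ.1 x)
    (by
      have h : ∀ x, expWeight N (0 : EuclideanSpace ℝ (Fin n) → 𝕜) x = 0 := fun x => by
        have := expWeight_smul N (0 : 𝕜) (θ := (0 : EuclideanSpace ℝ (Fin n) → 𝕜))
          contDiff_const x
        simpa only [smul_zero, norm_zero, zero_mul] using this
      change ⨆ x, expWeight N (0 : EuclideanSpace ℝ (Fin n) → 𝕜) x = 0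
      simp [h])
    (fun θ η => ciSup_le fun x => (expWeight_add_le N θ.2.1 η.2.1 x).trans
      (add_le_add (le_ciSup (θ.2.2 N) x) (le_ciSup (η.2.2 N) x)))
    (fun c θ => ciSup_le fun x => (expWeight_smul N c θ.2.1 x).le.trans
      (mul_le_mul_of_nonneg_left (le_ciSup (θ.2.2 N) x) (norm_nonneg c)))

/-- The locally convex topology of `S_e` defined by the seminorms `p_N`. -/
instance instTopologicalSpaceSe : TopologicalSpace (Se 𝕜 n) :=
  (SeminormFamily.moduleFilterBasis (seSeminorm 𝕜 n)).topology'

/-- `S_e'`: the continuous linear forms on `S_e`. -/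
abbrev SeDual := Se 𝕜 n →L[𝕜] 𝕜

end Se

/-! ### Distributions on open sets -/

section Distributions

variable {𝕜 : Type*} [RCLike 𝕜] {n : ℕ}

/-- `θ` is a test function on `Ω`, that is `θ ∈ D(Ω)`. -/
structure IsTestOn (Ω : Set (EuclideanSpace ℝ (Fin n)))
    (θ : EuclideanSpace ℝ (Fin n) → 𝕜) : Prop where
  contDiff : ContDiff ℝ ∞ θ
  hasCompactSupport : HasCompactSupport θ
  tsupport_subset : tsupport θ ⊆ Ω

lemma testFunction_mem_se {G : Opens (EuclideanSpace ℝ (Fin n))} (θ : 𝓓(G, 𝕜)) :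
    (θ : EuclideanSpace ℝ (Fin n) → 𝕜) ∈ seSubmodule 𝕜 n := by
  have hsm : ContDiff ℝ ∞ (θ : EuclideanSpace ℝ (Fin n) → 𝕜) := θ.contDiff
  refine ⟨hsm, fun N => ?_⟩
  have hc : ∀ i : ℕ, Continuous fun x =>
      ‖iteratedFDeriv ℝ i (θ : EuclideanSpace ℝ (Fin n) → 𝕜) x‖ := fun i =>
    (hsm.continuous_iteratedFDeriv (by exact_mod_cast le_top)).norm
  have hcont : Continuous (expWeight N (θ : EuclideanSpace ℝ (Fin n) → 𝕜)) := by
    unfold expWeight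
    exact (Real.continuous_exp.comp (continuous_const.mul continuous_norm)).mul
      (continuous_finsetSum _ fun i _ => hc i)
  have hsupp : HasCompactSupport (expWeight N (θ : EuclideanSpace ℝ (Fin n) → 𝕜)) := by
    refine HasCompactSupport.intro' θ.hasCompactSupport (isClosed_tsupport _) fun x hx => ?_
    unfold expWeight
    rw [Finset.sum_eq_zero, mul_zero]
    intro i _
    rw [norm_eq_zero]
    by_contra h
    exact hx (support_iteratedFDeriv_subset (𝕜 := ℝ) i h)
  exact hcont.bddAbove_range_of_hasCompactSupport hsupp

/-- The restriction of `g ∈ S_e'` to the test functions on `G`. -/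
def restrictTo (G : Opens (EuclideanSpace ℝ (Fin n))) (g : SeDual 𝕜 n) : 𝓓(G, 𝕜) → 𝕜 :=
  fun θ => g (⟨θ, testFunction_mem_se θ⟩ : seSubmodule 𝕜 n)

/-- `f ∈ S_e'(G)`: the distribution `f ∈ D'(G)` has finite order and at most exponential growth,
`|⟨f, θ⟩| ≤ C sup_{x ∈ G, i ≤ N} |D^i θ(x)| exp(N|x|)` for all `θ ∈ D(G)`. -/
def IsExpGrowth (G : Opens (EuclideanSpace ℝ (Fin n))) (f : 𝓓(G, 𝕜) →L[𝕜] 𝕜) : Prop :=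
  ∃ (C : ℝ≥0) (N : ℕ), ∀ θ : 𝓓(G, 𝕜),
    ‖f θ‖ₑ ≤ C * ⨆ x ∈ G, ⨆ i ∈ Finset.range (N + 1),
      ENNReal.ofReal (‖iteratedFDeriv ℝ i θ x‖ * Real.exp (N * ‖x‖))

open Classical in
/-- The convolution `(ψ ∗ f)(x) = ⟨f, ψ(x - ·)⟩` of `f ∈ D'(G)` with a function `ψ`, at the points
`x` for which `ψ(x - ·) ∈ D(G)` (the value `0` at other points is a convention; no point `x ∈ G` is
of this kind if `ψ ∈ D(-K)` and `G` is a special Lipschitz domain with cone `K`, or if `ψ` is a test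
function and `G` is the whole space). -/
def conv {G : Opens (EuclideanSpace ℝ (Fin n))} (f : 𝓓(G, 𝕜) → 𝕜)
    (ψ : EuclideanSpace ℝ (Fin n) → 𝕜) (x : EuclideanSpace ℝ (Fin n)) : 𝕜 :=
  if h : IsTestOn (G : Set (EuclideanSpace ℝ (Fin n))) (fun y => ψ (x - y)) then
    f ⟨fun y => ψ (x - y), h.contDiff, h.hasCompactSupport, h.tsupport_subset⟩
  else 0

/-! ### The kernels `φ_k` and the Besov quasi-norms -/

/-- `φ(x) = φ₀(x) - 2^{-n} φ₀(x / 2)`. -/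
def differenceKernel (φ₀ : EuclideanSpace ℝ (Fin n) → 𝕜) : EuclideanSpace ℝ (Fin n) → 𝕜 :=
  fun x => φ₀ x - ((2 : 𝕜) ^ n)⁻¹ * φ₀ ((2 : ℝ)⁻¹ • x)

/-- The kernels: `φ₀` for `k = 0`, and `φ_k(x) = 2^{kn} φ(2^k x)` for `k ≥ 1`. -/
def kernel (φ₀ : EuclideanSpace ℝ (Fin n) → 𝕜) (k : ℕ) : EuclideanSpace ℝ (Fin n) → 𝕜 :=
  if k = 0 then φ₀ else fun x => (2 : 𝕜) ^ (k * n) * differenceKernel φ₀ ((2 : ℝ) ^ k • x)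

/-- `L_ψ`: the supremum of the integers `L ≥ -1` such that `∫ x^β ψ(x) dx = 0` for all
multi-indices `β` with `|β| ≤ L`. It equals `-1` if `∫ ψ ≠ 0`. -/
def momentOrder (ψ : EuclideanSpace ℝ (Fin n) → 𝕜) : EReal :=
  ⨆ (L : ℤ) (_ : -1 ≤ L ∧ ∀ β : Fin n → ℕ, ((∑ i, β i : ℕ) : ℤ) ≤ L →
    ∫ x, ((∏ i, x i ^ β i : ℝ) : 𝕜) * ψ x = 0), ((L : ℝ) : EReal)

/-- The quasi-norm `‖g | B^{φ₀}_{p,q}({t_k})‖` of `g ∈ S_e'` (with value `∞` if `g` is not in the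
space). -/
def besovNorm (p q : ℝ≥0∞) (t : ℕ → EuclideanSpace ℝ (Fin n) → ℝ)
    (φ₀ : EuclideanSpace ℝ (Fin n) → 𝕜) (g : SeDual 𝕜 n) : ℝ≥0∞ :=
  lqNorm q fun k => eLpNorm (fun x => t k x • conv (restrictTo ⊤ g) (kernel φ₀ k) x) p volume

/-- The trace quasi-norm `‖f | B^{φ₀}_{p,q}(G, {t_k})‖`: the infimum of `‖g | B^{φ₀}_{p,q}({t_k})‖`
over all `g ∈ S_e'` with `g|_G = f` in `D'(G)` (and `∞` if there is no such `g`). -/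
def traceNorm (p q : ℝ≥0∞) (t : ℕ → EuclideanSpace ℝ (Fin n) → ℝ)
    (φ₀ : EuclideanSpace ℝ (Fin n) → 𝕜) (G : Opens (EuclideanSpace ℝ (Fin n)))
    (f : 𝓓(G, 𝕜) →L[𝕜] 𝕜) : ℝ≥0∞ :=
  ⨅ (g : SeDual 𝕜 n) (_ : restrictTo G g = f), besovNorm p q t φ₀ g

/-- `(∑_j (∫_G t_j^p |φ_j ∗ f|^p dx)^{q/p})^{1/q}`, with the usual modifications if `p = ∞` or
`q = ∞`. -/
def intrinsicNorm (p q : ℝ≥0∞) (t : ℕ → EuclideanSpace ℝ (Fin n) → ℝ)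
    (φ₀ : EuclideanSpace ℝ (Fin n) → 𝕜) (G : Opens (EuclideanSpace ℝ (Fin n)))
    (f : 𝓓(G, 𝕜) →L[𝕜] 𝕜) : ℝ≥0∞ :=
  lqNorm q fun j => eLpNorm (fun x => t j x • conv f (kernel φ₀ j) x) p
    (volume.restrict (G : Set (EuclideanSpace ℝ (Fin n))))

end Distributions

/-! ### Special Lipschitz domains in `ℝ^{d+1}` -/

/-- `x' = (x_1, …, x_{n-1})` for `x = (x', x_n)`, where `n = d + 1`. -/
def firstCoords {d : ℕ} (x : EuclideanSpace ℝ (Fin (d + 1))) : EuclideanSpace ℝ (Fin d) :=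
  WithLp.toLp 2 fun i => x i.castSucc

/-- The set `{x : x_n > ϖ(x')}` above the graph of `ϖ`. -/
def epigraph {d : ℕ} (ϖ : EuclideanSpace ℝ (Fin d) → ℝ) : Set (EuclideanSpace ℝ (Fin (d + 1))) :=
  {x | ϖ (firstCoords x) < x (Fin.last d)}

/-- The cone `K = {x : x_n > M |x'|}`. -/
def cone (d : ℕ) (M : ℝ) : Set (EuclideanSpace ℝ (Fin (d + 1))) :=
  {x | M * ‖firstCoords x‖ < x (Fin.last d)}

end

end VarBesov

/-! One inequality is soft. The support of `φ₀` lies in `-K` and `G + K ⊆ G`, so `φ_j(x - ·)` is a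
test function on `G` for every `x ∈ G`. Every extension `g` of `f` therefore satisfies `φ_j * g =
φ_j * f` on `G`, and restricting the domain of integration lowers the norm.

The other inequality rests on an extension operator of Rychkov type. Let `A_j` be the transpose of
convolution with `2^{jn} φ₀(2^j ·)`, let `B_j = 1 - A_j` and `P_j = (1 - B_j^N)^2`. Each factor
`B_j` gains `2^{-j}` at the price of one derivative, hence `P_j → 1`. Algebra in the commutative
algebra generated by the `A_j` gives `P_0 = D_0 Q_0` and `P_{j+1} - P_j = D_{j+1} Q_{j+1}`, where
`D_j` is the transpose of convolution with `φ_j` (`UnitKernel.P_succ_sub`). Telescoping yields `f =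
∑ Q_j^*(φ_j * f)`. All these operators preserve `D(G)`, so on `D(G)` only the values of `φ_j * f` on
`G` matter, and `Ef = ∑ Q_j^*(1_G (φ_j * f))` extends `f` (`GrowthOn.extend_eq`).

In `φ_k * Ef` the term of index `j ≥ k` is small because `Q_j` trades derivatives of `φ_k` for
powers of `2^{-(j-k)}`. The term of index `j < k` is small because `Q_j` contains `A_j` or
`A_{j-1}`, whose smooth kernel is tested against the vanishing moments of `φ_k`; this gains
`2^{-(k-j)m}` with `m > α₂`. The square in `P_j` is there to supply this smoothing factor.

Exponents below one are treated by powers `|·|^r` with small `r`. The reproducing formula started at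
level `j` bounds `φ_j * f` by means of the finer `φ_{j+i} * f`, and the Strömberg-Torchinsky
argument turns this into `|φ_j * f|^r ≤ C ∑ 2^{-iN} (means of |φ_{j+i} * f|^r)` on `G`
(`rpow_le_expSum`). Weighted norms of such means are estimated cube by cube: Hölder's inequality
with `1/p + 1/σ₁`, the bound `p ≤ σ₂`, comparability of neighbouring cubes, and Schur's test on the
lattice (`WeightClass.exists_eLpNorm_expDecay_le`). The loss from `α₁` is absorbed by the free
parameters `N`, `R`, the loss from `α₂` by the moments, and Minkowski's inequality in `L_{p/r}` and
`ℓ_{q/r}` sums the shifts.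

The order of the extension operator must not depend on `f`. For this reason the growth rate of `φ_j
* f` on `G` is derived from the finiteness of the intrinsic norm (`WeightClass.exists_growthOn`),
not from the order of `f`. Membership in `S_e'(G)` serves qualitatively: it represents `f`, by
Hahn-Banach, as a bounded functional of weighted jets, and it makes the maximal functions finite for
large parameters. -/

namespace VarBesov

noncomputable section

/-! ### Averaging operators -/

section Average

variable {𝕜 : Type*} [RCLike 𝕜] {n : ℕ}

/-- The average `y ↦ ∫ φ(z) θ(y + s z) dz`. -/
def avg (φ : EuclideanSpace ℝ (Fin n) → 𝕜) (s : ℝ) (θ : EuclideanSpace ℝ (Fin n) → 𝕜)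
    (y : EuclideanSpace ℝ (Fin n)) : 𝕜 :=
  ∫ z, φ z * θ (y + s • z)

variable {φ : EuclideanSpace ℝ (Fin n) → 𝕜} {s : ℝ} {θ : EuclideanSpace ℝ (Fin n) → 𝕜}

lemma avg_integrable (hφ : Continuous φ) (hφc : HasCompactSupport φ) (hθ : Continuous θ)
    (y : EuclideanSpace ℝ (Fin n)) : Integrable fun z => φ z * θ (y + s • z) :=
  (hφ.mul (hθ.comp (by fun_prop))).integrable_of_hasCompactSupport hφc.mul_right

lemma hasFDerivAt_avg (hφ : Continuous φ) (hφc : HasCompactSupport φ) (hθ : ContDiff ℝ 1 θ)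
    (y : EuclideanSpace ℝ (Fin n)) :
    HasFDerivAt (avg φ s θ) (∫ z, φ z • fderiv ℝ θ (y + s • z)) y := by
  have hd : Continuous (fderiv ℝ θ) := hθ.continuous_fderiv one_ne_zero
  obtain ⟨R, hR⟩ := hφc.isCompact.isBounded.exists_norm_le
  have hcpt : IsCompact (Metric.closedBall y (1 + |s| * R)) := isCompact_closedBall _ _
  obtain ⟨C, hC⟩ := hcpt.exists_bound_of_continuousOn hd.continuousOn
  refine hasFDerivAt_integral_of_dominated_of_fderiv_le (𝕜 := ℝ)
    (F := fun y z => φ z * θ (y + s • z)) (F' := fun y z => φ z • fderiv ℝ θ (y + s • z))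
    (bound := fun z => ‖φ z‖ * C) (Metric.ball_mem_nhds y one_pos) ?_ ?_ ?_ ?_ ?_ ?_
  · exact Filter.Eventually.of_forall fun x =>
      (avg_integrable hφ hφc hθ.continuous x).aestronglyMeasurable
  · exact avg_integrable hφ hφc hθ.continuous y
  · exact (hφ.smul (hd.comp (by fun_prop))).aestronglyMeasurable
  · refine Filter.Eventually.of_forall fun z x hx => ?_
    rw [norm_smul]
    by_cases hz : φ z = 0
    · simp [hz]
    · refine mul_le_mul_of_nonneg_left (hC _ ?_) (norm_nonneg _)
      have hz' : ‖z‖ ≤ R := hR z (subset_tsupport _ hz)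
      rw [Metric.mem_ball, dist_eq_norm] at hx
      rw [Metric.mem_closedBall, dist_eq_norm,
        show x + s • z - y = (x - y) + s • z by abel]
      refine (norm_add_le _ _).trans (add_le_add hx.le ?_)
      rw [norm_smul, Real.norm_eq_abs]
      exact mul_le_mul_of_nonneg_left hz' (abs_nonneg _)
  · exact ((hφ.norm).integrable_of_hasCompactSupport hφc.norm).mul_const C
  · refine Filter.Eventually.of_forall fun z x _ => ?_
    have h1 : HasFDerivAt θ (fderiv ℝ θ (x + s • z)) (x + s • z) :=
      (hθ.differentiable one_ne_zero _).hasFDerivAt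
    have h2 : HasFDerivAt (fun x => θ (x + s • z)) (fderiv ℝ θ (x + s • z)) x := by
      exact (hasFDerivAt_comp_add_right (s • z)).2 h1
    simpa using h2.const_mul (φ z)

lemma fderiv_avg_apply (hφ : Continuous φ) (hφc : HasCompactSupport φ) (hθ : ContDiff ℝ 1 θ)
    (y v : EuclideanSpace ℝ (Fin n)) :
    fderiv ℝ (avg φ s θ) y v = avg φ s (fun x => fderiv ℝ θ x v) y := by
  have hd : Continuous (fderiv ℝ θ) := hθ.continuous_fderiv one_ne_zero
  rw [(hasFDerivAt_avg hφ hφc hθ y).fderiv, ContinuousLinearMap.integral_apply]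
  · rfl
  · have h1 : Continuous fun z => φ z • fderiv ℝ θ (y + s • z) :=
      hφ.smul (hd.comp (by fun_prop))
    refine h1.integrable_of_hasCompactSupport (hφc.mono fun z hz => ?_)
    rw [Function.mem_support] at hz ⊢
    exact fun h => hz (by rw [h]; exact zero_smul 𝕜 (fderiv ℝ θ (y + s • z)))

/-- Differentiation falls on `θ`, the kernel being merely continuous. One order is given away so
that the base case can read continuity off differentiability, which is harmless for smooth `θ`. -/
lemma contDiff_avg_nat (hφ : Continuous φ) (hφc : HasCompactSupport φ) (k : ℕ) :
    ∀ {θ : EuclideanSpace ℝ (Fin n) → 𝕜}, ContDiff ℝ (k + 1) θ → ContDiff ℝ k (avg φ s θ) := by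
  induction k with
  | zero =>
    intro θ hθ
    refine contDiff_zero.2 (Differentiable.continuous (𝕜 := ℝ) fun y => ?_)
    exact (hasFDerivAt_avg hφ hφc (by simpa using hθ) y).differentiableAt
  | succ k ih =>
    intro θ hθ
    have h1 : ContDiff ℝ 1 θ := hθ.of_le (by simp)
    push_cast
    refine contDiff_succ_iff_fderiv_apply.2
      ⟨fun y => (hasFDerivAt_avg hφ hφc h1 y).differentiableAt, fun h => by simp at h, fun v => ?_⟩
    simp_rw [fderiv_avg_apply hφ hφc h1]
    exact ih ((contDiff_succ_iff_fderiv_apply.1 (by exact_mod_cast hθ)).2.2 v)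

lemma contDiff_avg (hφ : Continuous φ) (hφc : HasCompactSupport φ) (hθ : ContDiff ℝ ∞ θ) :
    ContDiff ℝ ∞ (avg φ s θ) :=
  contDiff_infty.2 fun k => contDiff_avg_nat hφ hφc k (hθ.of_le (by exact_mod_cast le_top))

lemma contDiff_iteratedFDeriv_apply (hθ : ContDiff ℝ ∞ θ) (i : ℕ)
    (m : Fin i → EuclideanSpace ℝ (Fin n)) : ContDiff ℝ ∞ fun x => iteratedFDeriv ℝ i θ x m := by
  have h : ContDiff ℝ ∞ (iteratedFDeriv ℝ i θ) := by
    refine hθ.iteratedFDeriv_right (i := i) ?_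
    exact_mod_cast le_top
  exact (ContinuousMultilinearMap.apply ℝ _ 𝕜 m).contDiff.comp h

lemma iteratedFDeriv_avg_apply (hφ : Continuous φ) (hφc : HasCompactSupport φ)
    (hθ : ContDiff ℝ ∞ θ) (i : ℕ) (m : Fin i → EuclideanSpace ℝ (Fin n))
    (y : EuclideanSpace ℝ (Fin n)) :
    iteratedFDeriv ℝ i (avg φ s θ) y m = avg φ s (fun x => iteratedFDeriv ℝ i θ x m) y := by
  induction i generalizing y with
  | zero => simp [iteratedFDeriv_zero_apply]
  | succ i ih =>
    have hdiff : ∀ {η : EuclideanSpace ℝ (Fin n) → 𝕜}, ContDiff ℝ ∞ η → ∀ x,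
        DifferentiableAt ℝ (iteratedFDeriv ℝ i η) x := fun hη x =>
      (hη.differentiable_iteratedFDeriv (by exact_mod_cast ENat.natCast_lt_top i)) x
    rw [(hdiff (contDiff_avg hφ hφc hθ) y).iteratedFDeriv_succ_apply_left']
    simp_rw [ih]
    rw [show (fun x => avg φ s (fun x => iteratedFDeriv ℝ i θ x (Fin.tail m)) x)
      = avg φ s (fun x => iteratedFDeriv ℝ i θ x (Fin.tail m)) from rfl, fderiv_avg_apply hφ hφc
      ((contDiff_iteratedFDeriv_apply hθ i _).of_le (by exact_mod_cast le_top))]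
    simp_rw [(hdiff hθ _).iteratedFDeriv_succ_apply_left']

/-- A weight which changes at most by the factor `c` under shifts of length at most `ρ`. -/
structure SlowlyVarying (W : EuclideanSpace ℝ (Fin n) → ℝ) (ρ c : ℝ) : Prop where
  nonneg : ∀ y, 0 ≤ W y
  shift : ∀ y z, ‖z‖ ≤ ρ → W (y + z) ≤ c * W y

/-- `|D^i θ| ≤ K W`. -/
def DerivBound (i : ℕ) (K : ℝ) (W : EuclideanSpace ℝ (Fin n) → ℝ)
    (θ : EuclideanSpace ℝ (Fin n) → 𝕜) : Prop :=
  ∀ y, ‖iteratedFDeriv ℝ i θ y‖ ≤ K * W y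

variable {R ρ c K : ℝ} {W : EuclideanSpace ℝ (Fin n) → ℝ} {i : ℕ}

lemma DerivBound.avg (hφ : Continuous φ) (hφc : HasCompactSupport φ)
    (hR : ∀ z, φ z ≠ 0 → ‖z‖ ≤ R) (hs : 0 ≤ s) (hρ : s * R ≤ ρ) (hK : 0 ≤ K)
    (hc : 0 ≤ c) (hW : SlowlyVarying W ρ c) (hθ : ContDiff ℝ ∞ θ) (h : DerivBound i K W θ) :
    DerivBound i ((∫ z, ‖φ z‖) * c * K) W (avg φ s θ) := by
  intro y
  have hI : 0 ≤ ∫ z, ‖φ z‖ := integral_nonneg fun z => norm_nonneg _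
  have hWy := hW.nonneg y
  refine ContinuousMultilinearMap.opNorm_le_bound (by positivity) fun m => ?_
  rw [iteratedFDeriv_avg_apply hφ hφc hθ]
  have : ∫ z, ‖φ z‖ * (c * K * W y * ∏ j, ‖m j‖) = (∫ z, ‖φ z‖) * c * K * W y * ∏ j, ‖m j‖ := by
    rw [integral_mul_const]; ring
  rw [← this]
  refine norm_integral_le_of_norm_le
    (((hφ.norm).integrable_of_hasCompactSupport hφc.norm).mul_const _)
    (Filter.Eventually.of_forall fun z => ?_)
  rw [norm_mul]
  by_cases hz : φ z = 0
  · simp [hz]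
  refine mul_le_mul_of_nonneg_left ?_ (norm_nonneg _)
  refine (ContinuousMultilinearMap.le_opNorm _ _).trans ?_
  refine mul_le_mul_of_nonneg_right ((h _).trans ?_) (Finset.prod_nonneg fun _ _ => norm_nonneg _)
  have := hW.shift y (s • z) (by
    rw [norm_smul, Real.norm_of_nonneg hs]
    exact (mul_le_mul_of_nonneg_left (hR z hz) hs).trans hρ)
  nlinarith

/-- As `∫ φ = 1`, the difference is an average of increments over distance at most `s R`, and the
mean value inequality applies. This exchange of one derivative for a factor `s` is the source of the
gain of the operators `Q_j` and of the convergence `P_j → 1`. -/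
lemma DerivBound.sub_avg (hφ : Continuous φ) (hφc : HasCompactSupport φ)
    (hR : ∀ z, φ z ≠ 0 → ‖z‖ ≤ R) (hR0 : 0 ≤ R) (hs : 0 ≤ s) (hρ : s * R ≤ ρ) (hK : 0 ≤ K)
    (hc : 0 ≤ c) (h1 : ∫ z, φ z = 1)
    (hW : SlowlyVarying W ρ c) (hθ : ContDiff ℝ ∞ θ) (h : DerivBound (i + 1) K W θ) :
    DerivBound i ((∫ z, ‖φ z‖) * c * (s * R) * K) W (θ - VarBesov.avg φ s θ) := by
  intro y
  have hI : 0 ≤ ∫ z, ‖φ z‖ := integral_nonneg fun z => norm_nonneg _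
  have hWy := hW.nonneg y
  refine ContinuousMultilinearMap.opNorm_le_bound (by positivity) fun m => ?_
  have hA := contDiff_avg (s := s) hφ hφc hθ
  rw [iteratedFDeriv_sub_apply (hθ.of_le (by exact_mod_cast le_top)).contDiffAt
    (hA.of_le (by exact_mod_cast le_top)).contDiffAt, _root_.sub_apply,
    iteratedFDeriv_avg_apply hφ hφc hθ]
  have hcont := (contDiff_iteratedFDeriv_apply hθ i m).continuous
  have e1 : iteratedFDeriv ℝ i θ y m = ∫ z, φ z * iteratedFDeriv ℝ i θ y m := by
    rw [integral_mul_const, h1, one_mul]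
  have e0 : iteratedFDeriv ℝ i θ y m - VarBesov.avg φ s (fun x => iteratedFDeriv ℝ i θ x m) y
      = ∫ z, φ z * (iteratedFDeriv ℝ i θ y m - iteratedFDeriv ℝ i θ (y + s • z) m) := by
    rw [VarBesov.avg]
    conv_lhs => rw [e1]
    rw [← integral_sub ((hφ.integrable_of_hasCompactSupport hφc).mul_const _)
      (avg_integrable hφ hφc hcont y)]
    simp_rw [mul_sub]
  rw [e0]
  have : ∫ z, ‖φ z‖ * (c * (s * R) * K * W y * ∏ j, ‖m j‖)
      = (∫ z, ‖φ z‖) * c * (s * R) * K * W y * ∏ j, ‖m j‖ := by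
    rw [integral_mul_const]; ring
  rw [← this]
  refine norm_integral_le_of_norm_le
    (((hφ.norm).integrable_of_hasCompactSupport hφc.norm).mul_const _)
    (Filter.Eventually.of_forall fun z => ?_)
  rw [norm_mul]
  by_cases hz : φ z = 0
  · simp [hz]
  refine mul_le_mul_of_nonneg_left ?_ (norm_nonneg _)
  rw [← _root_.sub_apply]
  refine (ContinuousMultilinearMap.le_opNorm _ _).trans ?_
  refine mul_le_mul_of_nonneg_right ?_ (Finset.prod_nonneg fun _ _ => norm_nonneg _)
  have hsz : ‖s • z‖ ≤ s * R := by
    rw [norm_smul, Real.norm_of_nonneg hs]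
    exact mul_le_mul_of_nonneg_left (hR z hz) hs
  -- The mean value inequality is applied on a ball around `y` on which `W` is still at most `c * W
  -- y`.
  have hmv := Convex.norm_image_sub_le_of_norm_fderiv_le (𝕜 := ℝ) (f := iteratedFDeriv ℝ i θ)
    (C := K * (c * W y)) (s := Metric.closedBall y (s * R)) (x := y + s • z) (y := y)
    (fun x _ => hθ.differentiable_iteratedFDeriv (by exact_mod_cast ENat.natCast_lt_top i) x)
    (fun x hx => by
      rw [norm_fderiv_iteratedFDeriv]
      refine (h x).trans (mul_le_mul_of_nonneg_left ?_ hK)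
      have := hW.shift y (x - y) (by
        rw [← dist_eq_norm]; exact (Metric.mem_closedBall.1 hx).trans hρ)
      simpa using this)
    (convex_closedBall _ _) (by simpa [Metric.mem_closedBall, dist_eq_norm] using hsz)
    (Metric.mem_closedBall_self (by positivity))
  refine hmv.trans ?_
  rw [show y - (y + s • z) = -(s • z) by abel, norm_neg]
  calc K * (c * W y) * ‖s • z‖ ≤ K * (c * W y) * (s * R) := by gcongr
    _ = _ := by ring

end Average

/-! ### The averaging operators on `S_e` -/

section Operators

variable {𝕜 : Type*} [RCLike 𝕜] {n : ℕ}

lemma SlowlyVarying.mono {W : EuclideanSpace ℝ (Fin n) → ℝ} {ρ ρ' c c' : ℝ}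
    (h : SlowlyVarying W ρ c) (hρ : ρ' ≤ ρ) (hc : c ≤ c') : SlowlyVarying W ρ' c' :=
  ⟨h.nonneg, fun y z hz => (h.shift y z (hz.trans hρ)).trans
    (mul_le_mul_of_nonneg_right hc (h.nonneg y))⟩

lemma slowlyVarying_exp {a : ℝ} (ha : 0 ≤ a) (x : EuclideanSpace ℝ (Fin n)) (ρ : ℝ) :
    SlowlyVarying (fun y => Real.exp (-(a * ‖x - y‖))) ρ (Real.exp (a * ρ)) := by
  refine ⟨fun y => (Real.exp_pos _).le, fun y z hz => ?_⟩
  rw [← Real.exp_add, Real.exp_le_exp]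
  have : ‖x - y‖ ≤ ‖x - (y + z)‖ + ‖z‖ := by
    calc ‖x - y‖ = ‖(x - (y + z)) + z‖ := by congr 1; abel
      _ ≤ _ := norm_add_le _ _
  nlinarith

lemma mem_seSubmodule_iff {θ : EuclideanSpace ℝ (Fin n) → 𝕜} :
    θ ∈ seSubmodule 𝕜 n ↔ ContDiff ℝ ∞ θ ∧ ∀ N i : ℕ, i ≤ N → ∃ K : ℝ, 0 ≤ K ∧
      DerivBound i K (fun y => Real.exp (-(N * ‖0 - y‖))) θ := by
  constructor
  · rintro ⟨h1, h2⟩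
    refine ⟨h1, fun N i hi => ?_⟩
    obtain ⟨K, hK⟩ := h2 N
    have hK' : ∀ x, expWeight N θ x ≤ K := fun x => hK ⟨x, rfl⟩
    refine ⟨K, (expWeight_nonneg N θ 0).trans (hK' 0), fun y => ?_⟩
    simp only [zero_sub, norm_neg]
    rw [Real.exp_neg, ← div_eq_mul_inv, le_div_iff₀ (Real.exp_pos _), mul_comm]
    refine le_trans ?_ (hK' y)
    unfold expWeight
    gcongr
    exact Finset.single_le_sum (f := fun i => ‖iteratedFDeriv ℝ i θ y‖)
      (fun _ _ => norm_nonneg _) (Finset.mem_range.2 (Nat.lt_succ_of_le hi))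
  · rintro ⟨h1, h2⟩
    refine ⟨h1, fun N => ?_⟩
    choose K hK0 hK using h2 N
    refine ⟨∑ i ∈ (Finset.range (N + 1)).attach,
      K i.1 (Nat.lt_succ_iff.1 (Finset.mem_range.1 i.2)), ?_⟩
    rintro _ ⟨y, rfl⟩
    unfold expWeight
    rw [Finset.mul_sum, ← Finset.sum_attach]
    refine Finset.sum_le_sum fun i _ => ?_
    have := hK i.1 (Nat.lt_succ_iff.1 (Finset.mem_range.1 i.2)) y
    simp only [zero_sub, norm_neg] at this
    rw [Real.exp_neg, ← div_eq_mul_inv, le_div_iff₀ (Real.exp_pos _), mul_comm] at this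
    exact this

variable (𝕜 n) in
/-- A smooth function with compact support and integral `1`. -/
structure UnitKernel where
  /-- the function -/
  toFun : EuclideanSpace ℝ (Fin n) → 𝕜
  contDiff : ContDiff ℝ ∞ toFun
  hasCompactSupport : HasCompactSupport toFun
  integral_eq_one : ∫ x, toFun x = 1
  /-- the radius of a ball containing the support -/
  radius : ℝ
  radius_nonneg : 0 ≤ radius
  norm_le : ∀ z, toFun z ≠ 0 → ‖z‖ ≤ radius

namespace UnitKernel

variable (κ : UnitKernel 𝕜 n)

lemma continuous : Continuous κ.toFun := κ.contDiff.continuous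

/-- The `L₁` norm. -/
def mass : ℝ := ∫ z, ‖κ.toFun z‖

lemma mass_nonneg : 0 ≤ κ.mass := integral_nonneg fun _ => norm_nonneg _

lemma avg_mem {s : ℝ} (hs : 0 ≤ s) {θ : EuclideanSpace ℝ (Fin n) → 𝕜}
    (hθ : θ ∈ seSubmodule 𝕜 n) : avg κ.toFun s θ ∈ seSubmodule 𝕜 n := by
  rw [mem_seSubmodule_iff] at hθ ⊢
  refine ⟨contDiff_avg κ.continuous κ.hasCompactSupport hθ.1, fun N i hi => ?_⟩
  obtain ⟨K, hK0, hK⟩ := hθ.2 N i hi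
  have hm := κ.mass_nonneg
  exact ⟨_, by unfold mass at hm; positivity,
    hK.avg κ.continuous κ.hasCompactSupport κ.norm_le hs le_rfl hK0
    (Real.exp_pos _).le (slowlyVarying_exp (Nat.cast_nonneg N) 0 (s * κ.radius)) hθ.1⟩

/-- The averaging operators `A_j` on `S_e`. -/
def A (j : ℕ) : Module.End 𝕜 (Se 𝕜 n) where
  toFun θ := ⟨avg κ.toFun ((2 : ℝ) ^ j)⁻¹ θ.1, κ.avg_mem (by positivity) θ.2⟩
  map_add' θ η := by
    refine Subtype.ext (funext fun y => ?_)
    change avg κ.toFun _ (θ.1 + η.1) y = avg κ.toFun _ θ.1 y + avg κ.toFun _ η.1 y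
    unfold avg
    rw [← integral_add (avg_integrable κ.continuous κ.hasCompactSupport θ.2.1.continuous y)
      (avg_integrable κ.continuous κ.hasCompactSupport η.2.1.continuous y)]
    simp [mul_add]
  map_smul' c θ := by
    refine Subtype.ext (funext fun y => ?_)
    change avg κ.toFun _ (c • θ.1) y = c * avg κ.toFun _ θ.1 y
    unfold avg
    rw [← integral_const_mul]
    simp [mul_left_comm]

lemma A_apply (j : ℕ) (θ : Se 𝕜 n) (y : EuclideanSpace ℝ (Fin n)) :
    (κ.A j θ).1 y = ∫ z, κ.toFun z * θ.1 (y + ((2 : ℝ) ^ j)⁻¹ • z) := rfl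

/-- Fubini. All operators below are polynomials in the `A_j`, so they commute and the algebra is
that of a commutative ring. -/
lemma commute_A (i j : ℕ) : Commute (κ.A i) (κ.A j) := by
  refine LinearMap.ext fun θ => Subtype.ext (funext fun y => ?_)
  change (κ.A i (κ.A j θ)).1 y = (κ.A j (κ.A i θ)).1 y
  simp_rw [A_apply, ← integral_const_mul]
  have hθ := θ.2.1.continuous
  rw [integral_integral_swap_of_hasCompactSupport
    (f := fun z w => κ.toFun z * (κ.toFun w * θ.1 (y + ((2 : ℝ) ^ i)⁻¹ • z + ((2 : ℝ) ^ j)⁻¹ • w)))]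
  · congr 1; ext z; congr 1; ext w
    rw [mul_left_comm, add_right_comm]
  · have := κ.continuous
    unfold Function.uncurry
    fun_prop
  · refine HasCompactSupport.intro (K := tsupport κ.toFun ×ˢ tsupport κ.toFun)
      (κ.hasCompactSupport.isCompact.prod κ.hasCompactSupport.isCompact) fun x hx => ?_
    simp only [Function.uncurry]
    rw [Set.mem_prod, not_and_or] at hx
    rcases hx with hx | hx
    · rw [image_eq_zero_of_notMem_tsupport hx, zero_mul]
    · rw [image_eq_zero_of_notMem_tsupport hx, zero_mul, mul_zero]

/-- The operators `B_j = 1 - A_j`. -/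
def B (j : ℕ) : Module.End 𝕜 (Se 𝕜 n) := 1 - κ.A j

/-- The operators `∑_{i < N} B_j^i`. -/
def geom (N j : ℕ) : Module.End 𝕜 (Se 𝕜 n) := ∑ i ∈ Finset.range N, κ.B j ^ i

/-- The operators `A_0` (for `j = 0`) and `A_j - A_{j-1}`. -/
def D : ℕ → Module.End 𝕜 (Se 𝕜 n)
  | 0 => κ.A 0
  | j + 1 => κ.A (j + 1) - κ.A j

/-- The operators `P_j = (1 - B_j^N)^2`. -/
def P (N j : ℕ) : Module.End 𝕜 (Se 𝕜 n) := (1 - κ.B j ^ N) ^ 2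

/-- The sum `∑_{i < N} B_j^i B_{j+1}^{N-1-i}`. -/
def mixed (N j : ℕ) : Module.End 𝕜 (Se 𝕜 n) :=
  ∑ i ∈ Finset.range N, κ.B j ^ i * κ.B (j + 1) ^ (N - 1 - i)

/-- The operators `Q_j` with `P_0 = D_0 Q_0` and `P_{j+1} - P_j = D_{j+1} Q_{j+1}`. -/
def Q (N : ℕ) : ℕ → Module.End 𝕜 (Se 𝕜 n)
  | 0 => κ.geom N 0 * κ.geom N 0 * κ.A 0
  | j + 1 => κ.mixed N j * (κ.geom N (j + 1) * κ.A (j + 1) + κ.geom N j * κ.A j)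

lemma commute_AB (i j : ℕ) : Commute (κ.A i) (κ.B j) :=
  (Commute.one_right _).sub_right (κ.commute_A i j)

lemma commute_BB (i j : ℕ) : Commute (κ.B i) (κ.B j) :=
  (Commute.one_left _).sub_left (κ.commute_AB i j)

lemma commute_A_geom (i N j : ℕ) : Commute (κ.A i) (κ.geom N j) :=
  Commute.sum_right _ _ _ fun k _ => (κ.commute_AB i j).pow_right k

/-- The geometric sum in `B_j = 1 - A_j`: the high order approximation `1 - B_j^N` of the identity
still contains `A_j` as a factor. -/
lemma A_mul_geom (N j : ℕ) : κ.A j * κ.geom N j = 1 - κ.B j ^ N := by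
  have h := mul_neg_geom_sum (κ.B j) N
  rw [← h]
  congr 1
  simp [B]

lemma P_zero (N : ℕ) : κ.P N 0 = κ.D 0 * κ.Q N 0 := by
  have h := (κ.commute_A_geom 0 N 0).eq
  rw [P, ← A_mul_geom, pow_two, D, Q]
  simp only [mul_assoc]
  rw [h]

lemma P_eq (N j : ℕ) : κ.P N j = κ.A j * (κ.geom N j * κ.geom N j * κ.A j) := by
  have h := (κ.commute_A_geom j N j).eq
  rw [P, ← A_mul_geom, pow_two]
  simp only [mul_assoc]
  rw [h]

/-- A difference of squares. The factor `B_j^N - B_{j+1}^N` splits off `B_j - B_{j+1} = D_{j+1}` and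
leaves `mixed`, which carries the gain of `N - 1` derivatives. The sum of the two bases is `A_{j+1}
geom_{j+1} + A_j geom_j`, which carries the smoothing. Without the square the latter factor would be
missing. -/
lemma P_succ_sub (N j : ℕ) : κ.P N (j + 1) - κ.P N j = κ.D (j + 1) * κ.Q N (j + 1) := by
  have h1 : κ.D (j + 1) * κ.mixed N j = κ.B j ^ N - κ.B (j + 1) ^ N := by
    rw [mixed, ← (κ.commute_BB j (j + 1)).mul_geom_sum₂ N]
    congr 1
    simp [D, B]
  rw [Q, ← mul_assoc, h1, ← (κ.commute_A_geom (j + 1) N (j + 1)).eq,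
    ← (κ.commute_A_geom j N j).eq, A_mul_geom, A_mul_geom, P, P]
  have h2 := ((κ.commute_BB j (j + 1)).pow_pow N N).eq
  simp only [pow_two, mul_sub, sub_mul, mul_add, one_mul, mul_one]
  rw [h2]
  abel

lemma P_eq_add_sum (N j m : ℕ) :
    κ.P N (j + m) = κ.P N j + ∑ i ∈ Finset.range m, κ.D (j + i + 1) * κ.Q N (j + i + 1) := by
  induction m with
  | zero => simp
  | succ m ih =>
    rw [Finset.sum_range_succ, ← add_assoc (κ.P N j), ← ih, ← P_succ_sub, ← add_assoc]
    abel

lemma P_eq_sum (N m : ℕ) : κ.P N m = ∑ i ∈ Finset.range (m + 1), κ.D i * κ.Q N i := by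
  have := κ.P_eq_add_sum N 0 m
  rw [zero_add] at this
  rw [this, Finset.sum_range_succ', P_zero, add_comm]
  simp

/-! ### Bounds -/

/-- `T` maps functions with `|D^{i+m} θ| ≤ K W` to functions with `|D^i (T θ)| ≤ C K W`, for all
slowly varying weights `W`. -/
def OpBound (ρ c C : ℝ) (m : ℕ) (T : Module.End 𝕜 (Se 𝕜 n)) : Prop :=
  0 ≤ C ∧ ∀ W, SlowlyVarying W ρ c → ∀ (i : ℕ) (K : ℝ) (θ : Se 𝕜 n), 0 ≤ K →
    DerivBound (i + m) K W θ.1 → DerivBound i (C * K) W (T θ).1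

variable {κ} {ρ c C C' : ℝ} {m m' : ℕ} {T T' : Module.End 𝕜 (Se 𝕜 n)}

lemma OpBound.mul (h : OpBound ρ c C m T) (h' : OpBound ρ c C' m' T') :
    OpBound ρ c (C * C') (m + m') (T * T') := by
  refine ⟨mul_nonneg h.1 h'.1, fun W hW i K θ hK hθ => ?_⟩
  rw [mul_assoc]
  exact h.2 W hW i _ _ (mul_nonneg h'.1 hK) (h'.2 W hW (i + m) K θ hK (by rwa [add_assoc]))

lemma DerivBound.add {W : EuclideanSpace ℝ (Fin n) → ℝ} {i : ℕ} {K K' : ℝ}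
    {θ η : Se 𝕜 n} (h : DerivBound i K W θ.1)
    (h' : DerivBound i K' W η.1) : DerivBound i (K + K') W (θ + η).1 := by
  intro y
  change ‖iteratedFDeriv ℝ i (θ.1 + η.1) y‖ ≤ _
  rw [iteratedFDeriv_add_apply (θ.2.1.of_le (by exact_mod_cast le_top)).contDiffAt
    (η.2.1.of_le (by exact_mod_cast le_top)).contDiffAt, add_mul]
  exact (norm_add_le _ _).trans (add_le_add (h y) (h' y))

lemma OpBound.add (h : OpBound ρ c C m T) (h' : OpBound ρ c C' m T') :
    OpBound ρ c (C + C') m (T + T') := by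
  refine ⟨add_nonneg h.1 h'.1, fun W hW i K θ hK hθ => ?_⟩
  rw [add_mul]
  exact DerivBound.add (h.2 W hW i K θ hK hθ) (h'.2 W hW i K θ hK hθ)

lemma OpBound.neg (h : OpBound ρ c C m T) : OpBound ρ c C m (-T) := by
  refine ⟨h.1, fun W hW i K θ hK hθ y => ?_⟩
  change ‖iteratedFDeriv ℝ i (-(T θ).1) y‖ ≤ _
  rw [iteratedFDeriv_neg, Pi.neg_apply, norm_neg]
  exact h.2 W hW i K θ hK hθ y

lemma OpBound.sub (h : OpBound ρ c C m T) (h' : OpBound ρ c C' m T') :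
    OpBound ρ c (C + C') m (T - T') := by
  rw [sub_eq_add_neg]; exact h.add h'.neg

lemma OpBound.mono (h : OpBound ρ c C m T) (hC : C ≤ C') : OpBound ρ c C' m T :=
  ⟨h.1.trans hC, fun W hW i K θ hK hθ y => (h.2 W hW i K θ hK hθ y).trans
    (mul_le_mul_of_nonneg_right (mul_le_mul_of_nonneg_right hC hK) (hW.nonneg y))⟩

lemma OpBound.one : OpBound ρ c 1 0 (1 : Module.End 𝕜 (Se 𝕜 n)) :=
  ⟨zero_le_one, fun W _ i K θ _ hθ => by simpa using hθ⟩

lemma OpBound.zero : OpBound ρ c 0 m (0 : Module.End 𝕜 (Se 𝕜 n)) := by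
  refine ⟨le_rfl, fun W hW i K θ _ hθ y => ?_⟩
  change ‖iteratedFDeriv ℝ i (0 : EuclideanSpace ℝ (Fin n) → 𝕜) y‖ ≤ _
  have : (0 : EuclideanSpace ℝ (Fin n) → 𝕜) = fun _ => 0 := rfl
  rw [this, iteratedFDeriv_fun_zero]
  simp

lemma OpBound.pow (h : OpBound ρ c C m T) (k : ℕ) : OpBound ρ c (C ^ k) (k * m) (T ^ k) := by
  induction k with
  | zero => simpa using OpBound.one
  | succ k ih =>
    rw [pow_succ, pow_succ, Nat.succ_mul]
    exact ih.mul h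

lemma OpBound.sum {f : ℕ → Module.End 𝕜 (Se 𝕜 n)} {k : ℕ}
    (h : ∀ i < k, OpBound ρ c C m (f i)) : OpBound ρ c (k * C) m (∑ i ∈ Finset.range k, f i) := by
  induction k with
  | zero => simpa using OpBound.zero
  | succ k ih =>
    rw [Finset.sum_range_succ]
    have := (ih fun i hi => h i (hi.trans k.lt_succ_self)).add (h k k.lt_succ_self)
    convert this using 1
    push_cast; ring

variable (κ)

lemma opBound_A {j : ℕ} (hc : 0 ≤ c) (hρ : ((2 : ℝ) ^ j)⁻¹ * κ.radius ≤ ρ) :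
    OpBound ρ c (κ.mass * c) 0 (κ.A j) :=
  ⟨mul_nonneg κ.mass_nonneg hc, fun _ hW _ _ θ hK hθ =>
    DerivBound.avg κ.continuous κ.hasCompactSupport κ.norm_le (by positivity) hρ hK hc hW θ.2.1 hθ⟩

lemma opBound_B {j : ℕ} (hc : 0 ≤ c) (hρ : ((2 : ℝ) ^ j)⁻¹ * κ.radius ≤ ρ) :
    OpBound ρ c (1 + κ.mass * c) 0 (κ.B j) :=
  OpBound.one.sub (κ.opBound_A hc hρ)

lemma opBound_B_one {j : ℕ} (hc : 0 ≤ c) (hρ : ((2 : ℝ) ^ j)⁻¹ * κ.radius ≤ ρ) :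
    OpBound ρ c (κ.mass * c * (((2 : ℝ) ^ j)⁻¹ * κ.radius)) 1 (κ.B j) := by
  have h1 := κ.mass_nonneg
  have h2 := κ.radius_nonneg
  exact ⟨by positivity, fun _ hW _ _ θ hK hθ =>
    DerivBound.sub_avg κ.continuous κ.hasCompactSupport κ.norm_le κ.radius_nonneg (by positivity)
      hρ hK hc κ.integral_eq_one hW θ.2.1 hθ⟩

lemma opBound_geom {j : ℕ} (N : ℕ) (hc : 0 ≤ c) (hρ : ((2 : ℝ) ^ j)⁻¹ * κ.radius ≤ ρ) :
    OpBound ρ c (N * (1 + κ.mass * c) ^ N) 0 (κ.geom N j) := by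
  refine OpBound.sum fun i hi => ((κ.opBound_B hc hρ).pow i).mono ?_
  have := mul_nonneg κ.mass_nonneg hc
  exact pow_le_pow_right₀ (by linarith) hi.le

lemma half_le {j : ℕ} (hρ : ((2 : ℝ) ^ j)⁻¹ * κ.radius ≤ ρ) :
    ((2 : ℝ) ^ (j + 1))⁻¹ * κ.radius ≤ ρ := by
  refine le_trans (mul_le_mul_of_nonneg_right ?_ κ.radius_nonneg) hρ
  gcongr <;> norm_num

lemma opBound_mixed_zero {j : ℕ} (N : ℕ) (hc : 0 ≤ c) (hρ : ((2 : ℝ) ^ j)⁻¹ * κ.radius ≤ ρ) :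
    OpBound ρ c (N * (1 + κ.mass * c) ^ (N - 1)) 0 (κ.mixed N j) := by
  refine OpBound.sum fun i hi => ?_
  have := ((κ.opBound_B hc hρ).pow i).mul ((κ.opBound_B hc (κ.half_le hρ)).pow (N - 1 - i))
  rw [← pow_add, show i + (N - 1 - i) = N - 1 by omega] at this
  simpa using this

/-- Every summand is a product of exactly `N - 1` factors `B_j` or `B_{j+1}`, and each of them
trades one derivative for a factor of order `2^{-j}`. -/
lemma opBound_mixed {j : ℕ} (N : ℕ) (hc : 0 ≤ c) (hρ : ((2 : ℝ) ^ j)⁻¹ * κ.radius ≤ ρ) :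
    OpBound ρ c (N * (κ.mass * c * (((2 : ℝ) ^ j)⁻¹ * κ.radius)) ^ (N - 1)) (N - 1)
      (κ.mixed N j) := by
  have h1 := κ.mass_nonneg
  have h2 := κ.radius_nonneg
  refine OpBound.sum fun i hi => ?_
  have hB := (κ.opBound_B_one hc (κ.half_le hρ)).mono
    (C' := κ.mass * c * (((2 : ℝ) ^ j)⁻¹ * κ.radius)) (by gcongr <;> norm_num)
  have := ((κ.opBound_B_one hc hρ).pow i).mul (hB.pow (N - 1 - i))
  rw [← pow_add, mul_one, mul_one, show i + (N - 1 - i) = N - 1 by omega] at this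
  exact this

/-- The gain of `N - 1` derivatives in `Q_j`. -/
lemma Q_bound (N : ℕ) (hc : 0 ≤ c) : ∃ C, 0 ≤ C ∧ ∀ (j : ℕ) (ρ K : ℝ),
    2 * ((2 : ℝ) ^ j)⁻¹ * κ.radius ≤ ρ → 0 ≤ K → ∀ W, SlowlyVarying W ρ c →
    ∀ θ : Se 𝕜 n, DerivBound 0 K W θ.1 → DerivBound (N - 1) K W θ.1 →
      DerivBound 0 (C * (((2 : ℝ) ^ j)⁻¹ ^ (N - 1) * K)) W (κ.Q N j θ).1 := by
  have h1 := κ.mass_nonneg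
  have h2 := κ.radius_nonneg
  set b : ℝ := N * (1 + κ.mass * c) ^ N
  have hb : 0 ≤ b := by positivity
  -- The doubled radius accounts for `Q_{j+1}` using `mixed N j`, whose step is `2^{-j} = 2 *
  -- 2^{-(j+1)}`.
  set e : ℝ := N * (κ.mass * c * (2 * κ.radius)) ^ (N - 1) * (b * (κ.mass * c) + b * (κ.mass * c))
  have he : 0 ≤ e := by positivity
  refine ⟨b * b * (κ.mass * c) + e, by positivity, fun j ρ K hρ hK W hW θ h0 hN => ?_⟩
  cases j with
  | zero =>
    have hr : ((2 : ℝ) ^ 0)⁻¹ * κ.radius ≤ ρ := by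
      simp only [pow_zero, inv_one, one_mul, mul_one] at hρ ⊢; linarith
    have := (((κ.opBound_geom N hc hr).mul (κ.opBound_geom N hc hr)).mul (κ.opBound_A hc hr)).2
      W hW 0 K θ hK h0
    intro y
    refine (this y).trans (mul_le_mul_of_nonneg_right ?_ (hW.nonneg y))
    simp only [pow_zero, inv_one, one_pow, one_mul]
    gcongr
    linarith
  | succ j =>
    have hr : ((2 : ℝ) ^ j)⁻¹ * κ.radius ≤ ρ := by
      refine le_trans (le_of_eq ?_) hρ
      rw [pow_succ]; field_simp
    have := ((κ.opBound_mixed N hc hr).mul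
      (((κ.opBound_geom N hc (κ.half_le hr)).mul (κ.opBound_A hc (κ.half_le hr))).add
        ((κ.opBound_geom N hc hr).mul (κ.opBound_A hc hr)))).2 W hW 0 K θ hK (by simpa using hN)
    intro y
    refine (this y).trans (mul_le_mul_of_nonneg_right ?_ (hW.nonneg y))
    rw [show ((2 : ℝ) ^ j)⁻¹ = ((2 : ℝ) ^ (j + 1))⁻¹ * 2 by rw [pow_succ]; field_simp]
    have : N * (κ.mass * c * (((2 : ℝ) ^ (j + 1))⁻¹ * 2 * κ.radius)) ^ (N - 1)
        * (b * (κ.mass * c) + b * (κ.mass * c)) * K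
        = e * (((2 : ℝ) ^ (j + 1))⁻¹ ^ (N - 1) * K) := by
      simp only [e, mul_pow]; ring
    rw [this]
    gcongr
    have : 0 ≤ b * b * (κ.mass * c) := by positivity
    linarith

/-- Bounds for `Q_j θ` in terms of the averages of `θ`. -/
lemma Q_bound_avg (N : ℕ) (hc : 0 ≤ c) : ∃ C, 0 ≤ C ∧ ∀ (j : ℕ) (ρ K : ℝ),
    2 * ((2 : ℝ) ^ j)⁻¹ * κ.radius ≤ ρ → 0 ≤ K → ∀ W, SlowlyVarying W ρ c →
    ∀ θ : Se 𝕜 n, DerivBound 0 K W (κ.A j θ).1 → DerivBound 0 K W (κ.A (j - 1) θ).1 →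
      DerivBound 0 (C * K) W (κ.Q N j θ).1 := by
  have h1 := κ.mass_nonneg
  have h2 := κ.radius_nonneg
  set b : ℝ := N * (1 + κ.mass * c) ^ N
  have hb : 0 ≤ b := by positivity
  set e : ℝ := N * (1 + κ.mass * c) ^ (N - 1) * b
  have he : 0 ≤ e := by positivity
  refine ⟨b * b + (e + e), by positivity, fun j ρ K hρ hK W hW θ h0 hN => ?_⟩
  cases j with
  | zero =>
    have hr : ((2 : ℝ) ^ 0)⁻¹ * κ.radius ≤ ρ := by
      simp only [pow_zero, inv_one, one_mul, mul_one] at hρ ⊢; linarith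
    have := ((κ.opBound_geom N hc hr).mul (κ.opBound_geom N hc hr)).2 W hW 0 K _ hK h0
    intro y
    refine (this y).trans (mul_le_mul_of_nonneg_right ?_ (hW.nonneg y))
    gcongr
    linarith
  | succ j =>
    have hr : ((2 : ℝ) ^ j)⁻¹ * κ.radius ≤ ρ := by
      refine le_trans (le_of_eq ?_) hρ
      rw [pow_succ]; field_simp
    have e1 := ((κ.opBound_mixed_zero N hc hr).mul (κ.opBound_geom N hc (κ.half_le hr))).2
      W hW 0 K _ hK h0
    have e2 := ((κ.opBound_mixed_zero N hc hr).mul (κ.opBound_geom N hc hr)).2 W hW 0 K _ hK hN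
    -- The averages act first; what remains is bounded without loss of derivatives, uniformly in the
    -- scale.
    have e3 : κ.Q N (j + 1) θ = (κ.mixed N j * κ.geom N (j + 1)) (κ.A (j + 1) θ)
        + (κ.mixed N j * κ.geom N j) (κ.A j θ) := by
      simp [Q]
    rw [e3]
    intro y
    refine (DerivBound.add e1 e2 y).trans (mul_le_mul_of_nonneg_right ?_ (hW.nonneg y))
    rw [← add_mul]
    refine mul_le_mul_of_nonneg_right ?_ hK
    exact le_add_of_nonneg_left (mul_nonneg hb hb)

/-- With `X = B_j^N` one has `1 - (1 - X)^2 = 2X - X^2`. One factor `B_j` is split off and pays the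
`2^{-j}`; the others are merely bounded. -/
lemma one_sub_P_bound {N : ℕ} (hN : 1 ≤ N) (hc : 0 ≤ c) : ∃ C, 0 ≤ C ∧ ∀ (j : ℕ),
    OpBound κ.radius c (C * ((2 : ℝ) ^ j)⁻¹) 1 (1 - κ.P N j) := by
  have h1 := κ.mass_nonneg
  have h2 := κ.radius_nonneg
  set b : ℝ := 1 + κ.mass * c
  have hb : 0 ≤ b := by positivity
  refine ⟨κ.mass * c * κ.radius * (b ^ (N - 1) + b ^ (N - 1) + b ^ (N - 1) * b ^ N),
    by positivity, fun j => ?_⟩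
  have hr : ((2 : ℝ) ^ j)⁻¹ * κ.radius ≤ κ.radius := by
    refine mul_le_of_le_one_left h2 (inv_le_one_of_one_le₀ (one_le_pow₀ (by norm_num)))
  have e1 : 1 - κ.P N j = κ.B j * (κ.B j ^ (N - 1) + κ.B j ^ (N - 1)
      - κ.B j ^ (N - 1) * κ.B j ^ N) := by
    rw [P, mul_sub, mul_add, ← mul_assoc, ← pow_succ', Nat.sub_add_cancel hN]
    simp only [pow_two, mul_sub, sub_mul, one_mul, mul_one]
    abel
  rw [e1]
  have hB := κ.opBound_B hc hr
  have h3 := (hB.pow (N - 1)).mul (hB.pow N)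
  have h4 := (κ.opBound_B_one hc hr).mul
    (((hB.pow (N - 1)).add (hB.pow (N - 1))).sub (by simpa using h3))
  simp only [mul_zero, add_zero] at h4
  refine h4.mono (le_of_eq ?_)
  ring

lemma A_geom_bound (N : ℕ) (hc : 0 ≤ c) : ∃ C, 0 ≤ C ∧ ∀ (j : ℕ) (ρ : ℝ),
    2 * ((2 : ℝ) ^ j)⁻¹ * κ.radius ≤ ρ →
    OpBound ρ c C 0 (κ.geom N j * κ.geom N j * κ.A j) := by
  have h1 := κ.mass_nonneg
  refine ⟨N * (1 + κ.mass * c) ^ N * (N * (1 + κ.mass * c) ^ N) * (κ.mass * c), by positivity,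
    fun j ρ hρ => ?_⟩
  · have hr : ((2 : ℝ) ^ j)⁻¹ * κ.radius ≤ ρ := by
      refine le_trans ?_ hρ
      rw [mul_assoc]
      have : 0 ≤ ((2 : ℝ) ^ j)⁻¹ * κ.radius := mul_nonneg (by positivity) κ.radius_nonneg
      linarith
    exact ((κ.opBound_geom N hc hr).mul (κ.opBound_geom N hc hr)).mul (κ.opBound_A hc hr)

/-! ### Supports -/

/-- `T` maps `D(G)` to itself. -/
def TestInvariant (G : Set (EuclideanSpace ℝ (Fin n)))
    (T : Module.End 𝕜 (Se 𝕜 n)) : Prop :=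
  ∀ θ : Se 𝕜 n, IsTestOn G θ.1 → IsTestOn G (T θ).1

/-- `G` is invariant under shifts in the directions of `- supp φ`. -/
def Absorbs (G : Set (EuclideanSpace ℝ (Fin n))) : Prop :=
  ∀ x ∈ G, ∀ z ∈ tsupport κ.toFun, ∀ s : ℝ, 0 < s → x - s • z ∈ G

variable {G : Set (EuclideanSpace ℝ (Fin n))}

lemma _root_.VarBesov.IsTestOn.add {θ η : EuclideanSpace ℝ (Fin n) → 𝕜} (h : IsTestOn G θ)
    (h' : IsTestOn G η) : IsTestOn G (θ + η) :=
  ⟨h.contDiff.add h'.contDiff, h.hasCompactSupport.add h'.hasCompactSupport,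
    (tsupport_add θ η).trans (Set.union_subset h.tsupport_subset h'.tsupport_subset)⟩

lemma _root_.VarBesov.IsTestOn.neg {θ : EuclideanSpace ℝ (Fin n) → 𝕜} (h : IsTestOn G θ) :
    IsTestOn G (-θ) :=
  ⟨h.contDiff.neg, h.hasCompactSupport.neg, tsupport_neg θ ▸ h.tsupport_subset⟩

lemma TestInvariant.add (h : TestInvariant G T) (h' : TestInvariant G T') :
    TestInvariant G (T + T') := fun θ hθ => (h θ hθ).add (h' θ hθ)

lemma TestInvariant.neg (h : TestInvariant G T) : TestInvariant G (-T) :=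
  fun θ hθ => (h θ hθ).neg

lemma TestInvariant.sub (h : TestInvariant G T) (h' : TestInvariant G T') :
    TestInvariant G (T - T') := by
  rw [sub_eq_add_neg]; exact h.add h'.neg

lemma TestInvariant.mul (h : TestInvariant G T) (h' : TestInvariant G T') :
    TestInvariant G (T * T') := fun θ hθ => h _ (h' θ hθ)

lemma TestInvariant.one : TestInvariant G (1 : Module.End 𝕜 (Se 𝕜 n)) :=
  fun _ hθ => hθ

lemma TestInvariant.pow (h : TestInvariant G T) (k : ℕ) : TestInvariant G (T ^ k) := by
  induction k with
  | zero => simpa using TestInvariant.one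
  | succ k ih => rw [pow_succ]; exact ih.mul h

lemma TestInvariant.sum {f : ℕ → Module.End 𝕜 (Se 𝕜 n)} (k : ℕ)
    (h : ∀ i, TestInvariant G (f i)) : TestInvariant G (∑ i ∈ Finset.range k, f i) := by
  induction k with
  | zero =>
    intro θ _
    refine ⟨contDiff_const, HasCompactSupport.zero, ?_⟩
    change tsupport (0 : EuclideanSpace ℝ (Fin n) → 𝕜) ⊆ G
    simp
  | succ k ih => rw [Finset.sum_range_succ]; exact ih.add (h k)

variable {κ}

/-- The support of `A_j θ` lies in `supp θ - 2^{-j} supp φ₀`, a compact set which is contained in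
`G` by the absorption property. -/
lemma Absorbs.A (hG : κ.Absorbs G) (j : ℕ) : TestInvariant G (κ.A j) := by
  intro θ hθ
  set s : ℝ := ((2 : ℝ) ^ j)⁻¹
  have hs : 0 < s := by positivity
  have hcpt : IsCompact ((fun x : EuclideanSpace ℝ (Fin n) × EuclideanSpace ℝ (Fin n) =>
      x.1 - s • x.2) '' (tsupport θ.1 ×ˢ tsupport κ.toFun)) :=
    (hθ.hasCompactSupport.isCompact.prod κ.hasCompactSupport.isCompact).image (by fun_prop)
  have hz : ∀ y, y ∉ ((fun x : EuclideanSpace ℝ (Fin n) × EuclideanSpace ℝ (Fin n) =>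
      x.1 - s • x.2) '' (tsupport θ.1 ×ˢ tsupport κ.toFun)) → (κ.A j θ).1 y = 0 := by
    intro y hy
    rw [A_apply]
    refine integral_eq_zero_of_ae (Filter.Eventually.of_forall fun z => ?_)
    by_contra h
    have h1 : κ.toFun z ≠ 0 := fun h0 => h (by simp [h0])
    have h2 : θ.1 (y + s • z) ≠ 0 := fun h0 => h (by simp [s, h0])
    exact hy ⟨(y + s • z, z), ⟨subset_tsupport _ h2, subset_tsupport _ h1⟩, by simp⟩
  refine ⟨(κ.A j θ).2.1, HasCompactSupport.intro hcpt hz, ?_⟩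
  refine (closure_minimal (fun y hy => ?_) hcpt.isClosed).trans ?_
  · by_contra h
    exact hy (hz y h)
  · rintro _ ⟨⟨x, z⟩, ⟨hx, hz⟩, rfl⟩
    exact hG x (hθ.tsupport_subset hx) z hz s hs

lemma Absorbs.B (hG : κ.Absorbs G) (j : ℕ) : TestInvariant G (κ.B j) :=
  TestInvariant.one.sub (hG.A j)

lemma Absorbs.geom (hG : κ.Absorbs G) (N j : ℕ) : TestInvariant G (κ.geom N j) :=
  TestInvariant.sum N fun i => (hG.B j).pow i

lemma Absorbs.Q (hG : κ.Absorbs G) (N j : ℕ) : TestInvariant G (κ.Q N j) := by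
  cases j with
  | zero => exact ((hG.geom N 0).mul (hG.geom N 0)).mul (hG.A 0)
  | succ j =>
    exact (TestInvariant.sum N fun i => ((hG.B j).pow i).mul ((hG.B (j + 1)).pow _)).mul
      (((hG.geom N (j + 1)).mul (hG.A (j + 1))).add ((hG.geom N j).mul (hG.A j)))

end UnitKernel

end Operators

/-! ### Functionals of finite order -/

section Jets

open scoped BoundedContinuousFunction

variable {𝕜 : Type*} [RCLike 𝕜] {n : ℕ}

variable (n) in
/-- The index set of the components of weighted jets: a base point and a family of directions. -/
structure JetIndex (N : ℕ) : Type where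
  /-- the order of the derivative -/
  order : Fin (N + 1)
  /-- the base point -/
  point : EuclideanSpace ℝ (Fin n)
  /-- the directions -/
  dir : Fin order → EuclideanSpace ℝ (Fin n)

/-- The discrete topology makes every bounded family of components an element of the jet space, so
that this is simply an `ℓ_∞` space and no regularity in the base point has to be checked. -/
instance (N : ℕ) : TopologicalSpace (JetIndex n N) := ⊥

instance (N : ℕ) : DiscreteTopology (JetIndex n N) := ⟨rfl⟩

variable (𝕜 n) in
/-- The space of weighted jets of order `N`, with the supremum norm. -/
abbrev JetSpace (N : ℕ) : Type _ := JetIndex n N →ᵇ 𝕜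

lemma Se.contDiff (θ : Se 𝕜 n) : ContDiff ℝ ∞ θ.1 := θ.2.1

lemma Se.exists_derivBound_le (θ : Se 𝕜 n) (N : ℕ) : ∃ K : ℝ, 0 ≤ K ∧ ∀ i ≤ N,
    DerivBound i K (fun y => Real.exp (-(N * ‖0 - y‖))) θ.1 := by
  obtain ⟨K, hK⟩ := θ.2.2 N
  have hK' : ∀ x, expWeight N θ.1 x ≤ K := fun x => hK ⟨x, rfl⟩
  refine ⟨K, (expWeight_nonneg N θ.1 0).trans (hK' 0), fun i hi y => ?_⟩
  simp only [zero_sub, norm_neg]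
  rw [Real.exp_neg, ← div_eq_mul_inv, le_div_iff₀ (Real.exp_pos _), mul_comm]
  refine le_trans ?_ (hK' y)
  unfold expWeight
  gcongr
  exact Finset.single_le_sum (f := fun i => ‖iteratedFDeriv ℝ i θ.1 y‖)
    (fun _ _ => norm_nonneg _) (Finset.mem_range.2 (Nat.lt_succ_of_le hi))

/-- The components of the weighted jet of `θ`. -/
def jetFun (N : ℕ) (θ : EuclideanSpace ℝ (Fin n) → 𝕜) (a : JetIndex n N) : 𝕜 :=
  (Real.exp (N * ‖a.point‖) * (∏ j, ‖a.dir j‖)⁻¹) • iteratedFDeriv ℝ a.order θ a.point a.dir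

lemma norm_jetFun_le {N : ℕ} {θ : EuclideanSpace ℝ (Fin n) → 𝕜} {K : ℝ}
    (h : ∀ i ≤ N, DerivBound i K (fun y => Real.exp (-(N * ‖0 - y‖))) θ) (a : JetIndex n N) :
    ‖jetFun N θ a‖ ≤ K := by
  have h1 := h a.order (Nat.lt_succ_iff.1 a.order.2) a.point
  simp only [zero_sub, norm_neg] at h1
  rw [Real.exp_neg, ← div_eq_mul_inv, le_div_iff₀ (Real.exp_pos _), mul_comm] at h1
  have h2 := ContinuousMultilinearMap.ratio_le_opNorm (iteratedFDeriv ℝ a.order θ a.point) a.dir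
  rw [jetFun, norm_smul, norm_mul, norm_inv, Real.norm_of_nonneg (Real.exp_pos _).le,
    Real.norm_of_nonneg (Finset.prod_nonneg fun _ _ => norm_nonneg _), mul_assoc,
    mul_comm _⁻¹, ← div_eq_mul_inv]
  exact (mul_le_mul_of_nonneg_left h2 (Real.exp_pos _).le).trans h1

/-- The weighted jet of order `N`. -/
def jet (N : ℕ) : Se 𝕜 n →ₗ[𝕜] JetSpace 𝕜 n N where
  toFun θ := BoundedContinuousFunction.ofNormedAddCommGroupDiscrete (jetFun N θ.1)
    (θ.exists_derivBound_le N).choose (norm_jetFun_le (θ.exists_derivBound_le N).choose_spec.2)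
  map_add' θ η := by
    ext a
    change jetFun N (θ.1 + η.1) a = jetFun N θ.1 a + jetFun N η.1 a
    unfold jetFun
    rw [iteratedFDeriv_add_apply (θ.contDiff.of_le (by exact_mod_cast le_top)).contDiffAt
      (η.contDiff.of_le (by exact_mod_cast le_top)).contDiffAt, ← smul_add]
    rfl
  map_smul' c θ := by
    ext a
    change jetFun N (c • θ.1) a = c • jetFun N θ.1 a
    unfold jetFun
    rw [iteratedFDeriv_const_smul_apply (θ.contDiff.of_le (by exact_mod_cast le_top)).contDiffAt,
      smul_comm c]
    rfl

lemma jet_apply (N : ℕ) (θ : Se 𝕜 n) (a : JetIndex n N) : jet N θ a = jetFun N θ.1 a := rfl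

lemma norm_jet_le {N : ℕ} {θ : Se 𝕜 n} {K : ℝ} (hK : 0 ≤ K)
    (h : ∀ i ≤ N, DerivBound i K (fun y => Real.exp (-(N * ‖0 - y‖))) θ.1) : ‖jet N θ‖ ≤ K :=
  (BoundedContinuousFunction.norm_le hK).2 fun a => norm_jetFun_le h a

lemma le_norm_jet {N : ℕ} (θ : Se 𝕜 n) {i : ℕ} (hi : i ≤ N) (y : EuclideanSpace ℝ (Fin n)) :
    ‖iteratedFDeriv ℝ i θ.1 y‖ * Real.exp (N * ‖y‖) ≤ ‖jet N θ‖ := by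
  rw [← le_div_iff₀ (Real.exp_pos _)]
  refine ContinuousMultilinearMap.opNorm_le_bound (by positivity) fun m => ?_
  have h1 : ‖(Real.exp (N * ‖y‖) * (∏ j, ‖m j‖)⁻¹) • iteratedFDeriv ℝ i θ.1 y m‖ ≤ ‖jet N θ‖ :=
    (jet N θ).norm_coe_le_norm ⟨⟨i, Nat.lt_succ_of_le hi⟩, y, m⟩
  rw [norm_smul, norm_mul, norm_inv, Real.norm_of_nonneg (Real.exp_pos _).le,
    Real.norm_of_nonneg (Finset.prod_nonneg fun _ _ => norm_nonneg _)] at h1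
  -- If a direction vanishes, the inverse in `jetFun` is `0` by convention and carries no
  -- information, but the multilinear form vanishes as well.
  by_cases hm : ∏ j, ‖m j‖ = 0
  · obtain ⟨j, -, hj⟩ := Finset.prod_eq_zero_iff.1 hm
    rw [ContinuousMultilinearMap.map_coord_zero _ j (norm_eq_zero.1 hj), norm_zero]
    exact mul_nonneg (by positivity) (Finset.prod_nonneg fun _ _ => norm_nonneg _)
  · have hpos : 0 < ∏ j, ‖m j‖ :=
      lt_of_le_of_ne (Finset.prod_nonneg fun _ _ => norm_nonneg _) (Ne.symm hm)
    rw [div_mul_eq_mul_div, le_div_iff₀ (Real.exp_pos _), mul_comm, ← div_le_iff₀ hpos]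
    refine le_trans (le_of_eq ?_) h1
    field_simp

lemma jet_injective (N : ℕ) : Function.Injective (jet (𝕜 := 𝕜) (n := n) N) := by
  rw [← LinearMap.ker_eq_bot, LinearMap.ker_eq_bot']
  intro θ hθ
  refine Subtype.ext (funext fun y => ?_)
  have h := le_norm_jet (N := N) θ (Nat.zero_le N) y
  rw [hθ, norm_zero, norm_iteratedFDeriv_zero] at h
  exact norm_le_zero_iff.1 (nonpos_of_mul_nonpos_left h (Real.exp_pos _))

/-- The inclusion of `D(G)` in `S_e`. -/
def testToSe (G : Opens (EuclideanSpace ℝ (Fin n))) : 𝓓(G, 𝕜) →ₗ[𝕜] Se 𝕜 n where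
  toFun θ := ⟨θ, testFunction_mem_se θ⟩
  map_add' _ _ := rfl
  map_smul' _ _ := rfl

/-- A distribution of exponential growth on `G` extends to a functional of finite order. -/
lemma IsExpGrowth.exists_extension {G : Opens (EuclideanSpace ℝ (Fin n))} {f : 𝓓(G, 𝕜) →L[𝕜] 𝕜}
    (hf : IsExpGrowth G f) : ∃ (N : ℕ) (F : JetSpace 𝕜 n N →L[𝕜] 𝕜),
      ∀ θ : 𝓓(G, 𝕜), F (jet N (testToSe G θ)) = f θ := by
  obtain ⟨C, N, hC⟩ := hf
  set J : 𝓓(G, 𝕜) →ₗ[𝕜] JetSpace 𝕜 n N := (jet N).comp (testToSe G) with hJ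
  have hinj : Function.Injective J := by
    refine (jet_injective N).comp fun θ η h => ?_
    ext x
    exact congrFun (congrArg Subtype.val h) x
  -- The growth condition says that `f` is bounded for the norm induced by the jet embedding. Thus
  -- `f` is a bounded functional on the range of `J`, and Hahn-Banach applies there without any use
  -- of the topology of `D(G)`.
  have hb : ∀ θ, ‖f θ‖ ≤ C * ‖J θ‖ := by
    intro θ
    have h1 : ‖f θ‖ₑ ≤ C * ENNReal.ofReal ‖J θ‖ := by
      refine (hC θ).trans (mul_le_mul_right ?_ _)
      refine iSup₂_le fun x _ => iSup₂_le fun i hi => ENNReal.ofReal_le_ofReal ?_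
      exact le_norm_jet (testToSe G θ) (Nat.lt_succ_iff.1 (Finset.mem_range.1 hi)) x
    rw [← ofReal_norm, ← ENNReal.ofReal_coe_nnreal, ← ENNReal.ofReal_mul C.coe_nonneg,
      ENNReal.ofReal_le_ofReal_iff (by positivity)] at h1
    exact h1
  let e := LinearEquiv.ofInjective J hinj
  let f₀ : LinearMap.range J →L[𝕜] 𝕜 :=
    (f.toLinearMap.comp e.symm.toLinearMap).mkContinuous C fun x => by
      have := hb (e.symm x)
      have h2 : J (e.symm x) = x := by
        have := congrArg Subtype.val (e.apply_symm_apply x)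
        exact this
      rw [h2] at this
      exact this
  obtain ⟨F, hF, -⟩ := exists_extension_norm_eq (LinearMap.range J) f₀
  refine ⟨N, F, fun θ => ?_⟩
  have h3 := hF (e θ)
  have h4 : f₀ (e θ) = f θ := by
    change f (e.symm (e θ)) = f θ
    rw [e.symm_apply_apply]
  rw [h4] at h3
  exact h3

end Jets

/-! ### Dilated kernels as elements of `S_e` -/

namespace UnitKernel

variable {𝕜 : Type*} [RCLike 𝕜] {n : ℕ} (κ : UnitKernel 𝕜 n)

/-- `2^{ln} φ₀(2^l w)`. -/
def dilate (l : ℕ) (w : EuclideanSpace ℝ (Fin n)) : 𝕜 :=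
  (2 : 𝕜) ^ (l * n) * κ.toFun ((2 : ℝ) ^ l • w)

lemma contDiff_dilate (l : ℕ) : ContDiff ℝ ∞ (κ.dilate l) :=
  contDiff_const.mul (κ.contDiff.comp (contDiff_const_smul _))

lemma norm_iteratedFDeriv_comp_sub_smul {θ : EuclideanSpace ℝ (Fin n) → 𝕜} (hθ : ContDiff ℝ ∞ θ)
    (i : ℕ) (c : ℝ) (x z : EuclideanSpace ℝ (Fin n)) :
    ‖iteratedFDeriv ℝ i (fun z => θ (c • (x - z))) z‖
      = |c| ^ i * ‖iteratedFDeriv ℝ i θ (c • (x - z))‖ := by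
  have e : (fun z => θ (c • (x - z))) = fun z => (fun w => θ ((-c) • w)) (z - x) := by
    ext z; congr 1; rw [neg_smul, ← smul_neg, neg_sub]
  rw [e, iteratedFDeriv_comp_sub (f := fun w => θ ((-c) • w)),
    iteratedFDeriv_comp_const_smul (i := i) (-c) (hθ.of_le (by exact_mod_cast le_top))]
  simp only [norm_smul, norm_pow, norm_neg, Real.norm_eq_abs, neg_smul]
  rw [← smul_neg, neg_sub]

lemma norm_exp_smul_le_iff {F : Type*} [NormedAddCommGroup F] [NormedSpace ℝ F] {a K : ℝ} (v : F) :
    ‖Real.exp a • v‖ ≤ K ↔ ‖v‖ ≤ K * Real.exp (-a) := by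
  rw [norm_smul, Real.norm_of_nonneg (Real.exp_pos _).le, Real.exp_neg, ← div_eq_mul_inv,
    le_div_iff₀ (Real.exp_pos _), mul_comm]

/-- Compact support allows every exponential rate `a`. Exponential weights are used in place of
supports because they are stable under the averaging operators. -/
lemma exists_decay (i : ℕ) (a : ℝ) : ∃ C, 0 ≤ C ∧ ∀ w : EuclideanSpace ℝ (Fin n),
    ‖iteratedFDeriv ℝ i κ.toFun w‖ ≤ C * Real.exp (-(a * ‖w‖)) := by
  have hc : Continuous fun w => Real.exp (a * ‖w‖) • iteratedFDeriv ℝ i κ.toFun w :=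
    (Real.continuous_exp.comp (continuous_const.mul continuous_norm)).smul
      (κ.contDiff.continuous_iteratedFDeriv (by exact_mod_cast le_top))
  have hs : HasCompactSupport fun w => Real.exp (a * ‖w‖) • iteratedFDeriv ℝ i κ.toFun w :=
    (κ.hasCompactSupport.iteratedFDeriv (𝕜 := ℝ) i).mono fun w hw h0 => hw (by
      simp only [h0, smul_zero])
  obtain ⟨C, hC⟩ := hs.exists_bound_of_continuous hc
  exact ⟨C, (norm_nonneg _).trans (hC 0), fun w => (norm_exp_smul_le_iff _).1 (hC w)⟩

lemma exists_dilate_bound (i : ℕ) (a : ℝ) : ∃ C, 0 ≤ C ∧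
    ∀ (l : ℕ) (x : EuclideanSpace ℝ (Fin n)),
      DerivBound i (C * ((2 : ℝ) ^ (l * n) * 2 ^ (l * i)))
        (fun z => Real.exp (-(a * 2 ^ l * ‖x - z‖))) (fun z => κ.dilate l (x - z)) := by
  obtain ⟨C, hC0, hC⟩ := κ.exists_decay i a
  refine ⟨C, hC0, fun l x z => ?_⟩
  unfold dilate
  have h1 : ContDiffAt ℝ i (fun z => κ.toFun ((2 : ℝ) ^ l • (x - z))) z := by
    refine ContDiff.contDiffAt (κ.contDiff.of_le (by exact_mod_cast le_top) |>.comp ?_)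
    fun_prop
  have h2 := iteratedFDeriv_const_smul_apply (a := (2 : 𝕜) ^ (l * n)) h1
  have h3 : (fun z => (2 : 𝕜) ^ (l * n) * κ.toFun ((2 : ℝ) ^ l • (x - z)))
    = (2 : 𝕜) ^ (l * n) • fun z => κ.toFun ((2 : ℝ) ^ l • (x - z)) := rfl
  rw [h3, h2, norm_smul, norm_pow, RCLike.norm_ofNat, norm_iteratedFDeriv_comp_sub_smul κ.contDiff]
  refine (mul_le_mul_of_nonneg_left (mul_le_mul_of_nonneg_left (hC _) (by positivity))
    (by positivity)).trans_eq ?_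
  rw [norm_smul, abs_of_pos (by positivity : (0 : ℝ) < 2 ^ l), Real.norm_of_nonneg (by positivity),
    ← pow_mul]
  ring_nf

lemma exp_shift_le {a b : ℝ} (ha : 0 ≤ a) (hab : a ≤ b) (x z : EuclideanSpace ℝ (Fin n)) :
    Real.exp (-(b * ‖x - z‖)) ≤ Real.exp (a * ‖x‖) * Real.exp (-(a * ‖0 - z‖)) := by
  rw [← Real.exp_add, Real.exp_le_exp]
  have h : ‖(0 : EuclideanSpace ℝ (Fin n)) - z‖ ≤ ‖x‖ + ‖x - z‖ := by
    calc ‖(0 : EuclideanSpace ℝ (Fin n)) - z‖ = ‖-x + (x - z)‖ := by congr 1; abel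
      _ ≤ ‖-x‖ + ‖x - z‖ := norm_add_le _ _
      _ = _ := by rw [norm_neg]
  have := mul_le_mul_of_nonneg_right hab (norm_nonneg (x - z))
  have := mul_le_mul_of_nonneg_left h ha
  linarith

lemma one_le_two_pow_real (l : ℕ) : (1 : ℝ) ≤ 2 ^ l := one_le_pow₀ (by norm_num)

/-- The functions `z ↦ 2^{ln} φ₀(2^l (x - z))` as elements of `S_e`. -/
def shift (l : ℕ) (x : EuclideanSpace ℝ (Fin n)) : Se 𝕜 n :=
  ⟨fun z => κ.dilate l (x - z), mem_seSubmodule_iff.2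
    ⟨(κ.contDiff_dilate l).comp (contDiff_const.sub contDiff_id), fun N i _ => by
      obtain ⟨C, hC0, hC⟩ := κ.exists_dilate_bound i N
      refine ⟨C * ((2 : ℝ) ^ (l * n) * 2 ^ (l * i)) * Real.exp (N * ‖x‖), by positivity,
        fun z => (hC l x z).trans ?_⟩
      rw [mul_assoc (C * ((2 : ℝ) ^ (l * n) * 2 ^ (l * i)))]
      refine mul_le_mul_of_nonneg_left (exp_shift_le (Nat.cast_nonneg N) ?_ x z) (by positivity)
      exact le_mul_of_one_le_right (Nat.cast_nonneg N) (one_le_two_pow_real l)⟩⟩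

lemma shift_apply (l : ℕ) (x z : EuclideanSpace ℝ (Fin n)) :
    (κ.shift l x).1 z = κ.dilate l (x - z) := rfl

/-- The functions `z ↦ φ_l(x - z)` as elements of `S_e`. -/
def diffShift : ℕ → EuclideanSpace ℝ (Fin n) → Se 𝕜 n
  | 0, x => κ.shift 0 x
  | l + 1, x => κ.shift (l + 1) x - κ.shift l x

/-- By the choice of `φ`, the kernel `φ_{l+1}` is the difference of the dilates of `φ₀` at the
scales `2^{-(l+1)}` and `2^{-l}`. -/
lemma diffShift_apply (l : ℕ) (x z : EuclideanSpace ℝ (Fin n)) :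
    (κ.diffShift l x).1 z = kernel κ.toFun l (x - z) := by
  cases l with
  | zero => simp [diffShift, shift_apply, dilate, kernel]
  | succ l =>
    change κ.dilate (l + 1) (x - z) - κ.dilate l (x - z) = _
    have h2 : (2 : 𝕜) ^ n ≠ 0 := pow_ne_zero _ two_ne_zero
    simp only [dilate, kernel, differenceKernel, Nat.succ_ne_zero, if_false, smul_smul]
    rw [show (2 : ℝ)⁻¹ * 2 ^ (l + 1) = 2 ^ l by rw [pow_succ]; ring]
    rw [add_mul, one_mul, pow_add]
    field_simp

lemma exists_shift_bound (i : ℕ) {a : ℝ} : ∃ C, 0 ≤ C ∧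
    ∀ (l : ℕ) (x : EuclideanSpace ℝ (Fin n)),
      DerivBound i (C * ((2 : ℝ) ^ (l * n) * 2 ^ (l * i)))
        (fun z => Real.exp (-(a * 2 ^ l * ‖x - z‖))) (κ.shift l x).1 :=
  κ.exists_dilate_bound i a

lemma exists_diffShift_bound (i : ℕ) (a : ℝ) : ∃ C, 0 ≤ C ∧
    ∀ (l : ℕ) (x : EuclideanSpace ℝ (Fin n)),
      DerivBound i (C * ((2 : ℝ) ^ (l * n) * 2 ^ (l * i)))
        (fun z => Real.exp (-(a * 2 ^ l * ‖x - z‖))) (κ.diffShift l x).1 := by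
  obtain ⟨C, hC0, hC⟩ := κ.exists_shift_bound i (a := a)
  -- The coarser dilate needs twice the rate, as `a 2^{l+1} = (2a) 2^l`.
  obtain ⟨C', hC0', hC'⟩ := κ.exists_shift_bound i (a := 2 * a)
  refine ⟨C + C', by positivity, fun l x => ?_⟩
  cases l with
  | zero =>
    intro z
    refine (hC 0 x z).trans (mul_le_mul_of_nonneg_right ?_ (Real.exp_pos _).le)
    exact mul_le_mul_of_nonneg_right (by linarith) (by positivity)
  | succ l =>
    have h1 : DerivBound i (C' * ((2 : ℝ) ^ ((l + 1) * n) * 2 ^ ((l + 1) * i)))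
        (fun z => Real.exp (-(a * 2 ^ (l + 1) * ‖x - z‖))) (-κ.shift l x).1 := by
      intro z
      change ‖iteratedFDeriv ℝ i (-(κ.shift l x).1) z‖ ≤ _
      rw [iteratedFDeriv_neg, Pi.neg_apply, norm_neg]
      refine (hC' l x z).trans ?_
      rw [show a * 2 ^ (l + 1) = 2 * a * 2 ^ l by rw [pow_succ]; ring]
      refine mul_le_mul_of_nonneg_right ?_ (Real.exp_pos _).le
      gcongr <;> norm_num
    have h2 := DerivBound.add (hC (l + 1) x) h1
    rw [← add_mul] at h2
    have h3 : κ.diffShift (l + 1) x = κ.shift (l + 1) x + -κ.shift l x := by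
      rw [diffShift, sub_eq_add_neg]
    rw [h3]
    exact h2

/-- Both sides are the convolution of the dilates of `φ₀` at the scales `2^{-i}` and `2^{-l}`,
reflected and centred at `x`; a linear change of variables exchanges the two factors. -/
lemma A_shift_comm (i l : ℕ) (x : EuclideanSpace ℝ (Fin n)) :
    κ.A i (κ.shift l x) = κ.A l (κ.shift i x) := by
  refine Subtype.ext (funext fun z => ?_)
  rw [A_apply, A_apply]
  simp only [shift_apply, dilate]
  have key := Measure.integral_comp_smul (volume : Measure (EuclideanSpace ℝ (Fin n)))
    (fun w => κ.toFun ((2 : ℝ) ^ i • (x - z) - w) *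
      ((2 : 𝕜) ^ (l * n) * κ.toFun (((2 : ℝ) ^ l * (2 ^ i)⁻¹) • w))) ((2 : ℝ) ^ i * (2 ^ l)⁻¹)
  have hi : (2 : ℝ) ^ i ≠ 0 := by positivity
  have hl : (2 : ℝ) ^ l ≠ 0 := by positivity
  have e1 : ∫ w, κ.toFun w * ((2 : 𝕜) ^ (l * n) * κ.toFun ((2 : ℝ) ^ l • (x - (z + ((2 : ℝ) ^ i)⁻¹ • w))))
      = ∫ w, κ.toFun ((2 : ℝ) ^ i • (x - z) - w) *
      ((2 : 𝕜) ^ (l * n) * κ.toFun (((2 : ℝ) ^ l * (2 ^ i)⁻¹) • w)) := by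
    rw [← integral_sub_left_eq_self (fun w => κ.toFun w * ((2 : 𝕜) ^ (l * n) *
      κ.toFun ((2 : ℝ) ^ l • (x - (z + ((2 : ℝ) ^ i)⁻¹ • w))))) volume ((2 : ℝ) ^ i • (x - z))]
    congr 1; ext w; congr 3
    rw [mul_smul]
    congr 1
    rw [smul_sub, smul_smul, inv_mul_cancel₀ hi, one_smul]
    abel
  rw [e1]
  rw [eq_comm, abs_of_pos (by positivity), finrank_euclideanSpace, Fintype.card_fin,
    inv_smul_eq_iff₀ (by positivity)] at key
  rw [key, ← integral_smul]
  congr 1; ext w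
  rw [smul_smul, show (2 : ℝ) ^ l * (2 ^ i)⁻¹ * (2 ^ i * (2 ^ l)⁻¹) = 1 by field_simp, one_smul]
  rw [show (2 : ℝ) ^ i • (x - (z + ((2 : ℝ) ^ l)⁻¹ • w))
    = (2 : ℝ) ^ i • (x - z) - ((2 : ℝ) ^ i * (2 ^ l)⁻¹) • w by
      rw [← sub_sub, smul_sub _ (x - z), smul_smul]]
  rw [RCLike.real_smul_eq_coe_mul]
  push_cast
  have : (2 : 𝕜) ^ l ≠ 0 := pow_ne_zero _ two_ne_zero
  rw [mul_pow, inv_pow, ← pow_mul, ← pow_mul]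
  have : (2 : 𝕜) ^ (l * n) ≠ 0 := pow_ne_zero _ two_ne_zero
  field_simp

lemma A_diffShift (l : ℕ) (x : EuclideanSpace ℝ (Fin n)) :
    κ.A l (κ.diffShift l x) = κ.D l (κ.shift l x) := by
  cases l with
  | zero => rfl
  | succ l =>
    rw [diffShift, D, map_sub, LinearMap.sub_apply, κ.A_shift_comm (l + 1) l]

lemma commute_D_A (i j : ℕ) : Commute (κ.D i) (κ.A j) := by
  cases i with
  | zero => exact κ.commute_A 0 j
  | succ i => exact (κ.commute_A (i + 1) j).sub_left (κ.commute_A i j)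

lemma commute_D_geom (i N j : ℕ) : Commute (κ.D i) (κ.geom N j) := by
  cases i with
  | zero => exact κ.commute_A_geom 0 N j
  | succ i => exact (κ.commute_A_geom (i + 1) N j).sub_left (κ.commute_A_geom i N j)

/-- This is the initial term of the reproducing formula started at level `l`. The spare factor `A_l`
in `P_l` turns `φ_l` into `D_l` applied to a dilate of `φ₀`, so that the term becomes an integral of
`φ_l * f` itself and no coarser level appears. -/
lemma P_diffShift (N l : ℕ) (x : EuclideanSpace ℝ (Fin n)) :
    κ.P N l (κ.diffShift l x) = κ.D l ((κ.geom N l * κ.geom N l * κ.A l) (κ.shift l x)) := by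
  have h1 : κ.P N l = κ.geom N l * κ.geom N l * κ.A l * κ.A l := by
    have h := (κ.commute_A_geom l N l).eq
    rw [P_eq]
    simp only [← mul_assoc]
    rw [h, mul_assoc (κ.geom N l) (κ.A l), h, ← mul_assoc]
  have h2 : Commute (κ.D l) (κ.geom N l * κ.geom N l * κ.A l) :=
    ((κ.commute_D_geom l N l).mul_right (κ.commute_D_geom l N l)).mul_right (κ.commute_D_A l l)
  rw [h1, Module.End.mul_apply, A_diffShift, ← Module.End.mul_apply, ← h2.eq, Module.End.mul_apply]

variable {κ} {G : Set (EuclideanSpace ℝ (Fin n))}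

lemma Absorbs.shift (hG : κ.Absorbs G) (l : ℕ) {x : EuclideanSpace ℝ (Fin n)} (hx : x ∈ G) :
    IsTestOn G (κ.shift l x).1 := by
  set s : ℝ := ((2 : ℝ) ^ l)⁻¹
  have hs : 0 < s := by positivity
  have hcpt : IsCompact ((fun w : EuclideanSpace ℝ (Fin n) => x - s • w) '' tsupport κ.toFun) :=
    κ.hasCompactSupport.isCompact.image (by fun_prop)
  have hz : ∀ z, z ∉ ((fun w : EuclideanSpace ℝ (Fin n) => x - s • w) '' tsupport κ.toFun) →
      (κ.shift l x).1 z = 0 := by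
    intro z hz
    rw [shift_apply, dilate]
    by_contra h
    refine hz ⟨(2 : ℝ) ^ l • (x - z), subset_tsupport _ fun h0 => h (by rw [h0, mul_zero]), ?_⟩
    have h2 : s * 2 ^ l = 1 := inv_mul_cancel₀ (by positivity)
    simp [smul_smul, h2]
  refine ⟨(κ.shift l x).2.1, HasCompactSupport.intro hcpt hz, ?_⟩
  refine (closure_minimal (fun y hy => ?_) hcpt.isClosed).trans ?_
  · by_contra h
    exact hy (hz y h)
  · rintro _ ⟨w, hw, rfl⟩
    exact hG x hx w hw s hs

lemma Absorbs.diffShift (hG : κ.Absorbs G) (l : ℕ) {x : EuclideanSpace ℝ (Fin n)} (hx : x ∈ G) :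
    IsTestOn G (κ.diffShift l x).1 := by
  cases l with
  | zero => exact hG.shift 0 hx
  | succ l =>
    have h3 : κ.diffShift (l + 1) x = κ.shift (l + 1) x + -κ.shift l x := by
      rw [UnitKernel.diffShift, sub_eq_add_neg]
    rw [h3]
    exact (hG.shift (l + 1) hx).add (hG.shift l hx).neg

lemma absorbs_univ : κ.Absorbs Set.univ := fun _ _ _ _ _ _ => trivial

end UnitKernel

/-! ### Reproducing formulas -/

namespace UnitKernel

open Filter
open scoped Topology

variable {𝕜 : Type*} [RCLike 𝕜] {n : ℕ} (κ : UnitKernel 𝕜 n) {N : ℕ}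
  (F : JetSpace 𝕜 n N →L[𝕜] 𝕜)

/-- The convolution `y ↦ ⟨f, φ_j(y - ·)⟩` of a functional of finite order with a kernel. -/
def coeff (j : ℕ) (y : EuclideanSpace ℝ (Fin n)) : 𝕜 := F (jet N (κ.diffShift j y))

lemma norm_apply_jet_le {θ : Se 𝕜 n} {K : ℝ} (hK : 0 ≤ K)
    (h : ∀ i ≤ N, DerivBound i K (fun y => Real.exp (-(N * ‖0 - y‖))) θ.1) :
    ‖F (jet N θ)‖ ≤ ‖F‖ * K :=
  (F.le_opNorm _).trans (mul_le_mul_of_nonneg_left (norm_jet_le hK h) (norm_nonneg _))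

/-- The rate depends on the order `N` of the functional, so this bound only guarantees finiteness;
it never enters a final constant. -/
lemma exists_coeff_growth : ∃ C, 0 ≤ C ∧ ∀ (j : ℕ) (y : EuclideanSpace ℝ (Fin n)),
    ‖κ.coeff F j y‖ ≤ C * (2 : ℝ) ^ (j * (n + N)) * Real.exp (N * ‖y‖) := by
  choose C hC0 hC using fun i => κ.exists_diffShift_bound i (N : ℝ)
  set S := ∑ i ∈ Finset.range (N + 1), C i
  have hS0 : 0 ≤ S := Finset.sum_nonneg fun i _ => hC0 i
  refine ⟨‖F‖ * S, by positivity, fun j y => ?_⟩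
  have := norm_apply_jet_le F (θ := κ.diffShift j y)
    (K := S * (2 : ℝ) ^ (j * (n + N)) * Real.exp (N * ‖y‖)) (by positivity) fun i hi z => by
      refine (hC i j y z).trans ?_
      rw [mul_assoc (S * _)]
      refine mul_le_mul ?_ (exp_shift_le (Nat.cast_nonneg N)
        (le_mul_of_one_le_right (Nat.cast_nonneg N) (one_le_two_pow_real j)) y z)
        (Real.exp_pos _).le (by positivity)
      rw [← pow_add, ← mul_add]
      refine mul_le_mul ?_ ?_ (by positivity) hS0
      · exact Finset.single_le_sum (f := C) (fun i _ => hC0 i)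
          (Finset.mem_range.2 (Nat.lt_succ_of_le hi))
      · exact pow_le_pow_right₀ (by norm_num) (by gcongr)
  rw [coeff]
  refine this.trans (le_of_eq (by ring))

lemma iteratedFDeriv_shift (l i : ℕ) (y z : EuclideanSpace ℝ (Fin n)) :
    iteratedFDeriv ℝ i (κ.shift l y).1 z = iteratedFDeriv ℝ i (κ.shift l 0).1 (z - y) := by
  have e : (κ.shift l y).1 = fun z => (κ.shift l 0).1 (z - y) := by
    ext z; rw [shift_apply, shift_apply]; congr 1; abel
  rw [e, iteratedFDeriv_comp_sub (f := (κ.shift l 0).1)]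

lemma hasCompactSupport_shift (l : ℕ) (x : EuclideanSpace ℝ (Fin n)) :
    HasCompactSupport (κ.shift l x).1 :=
  (κ.absorbs_univ.shift l (Set.mem_univ x)).hasCompactSupport

/-- Needed for Bochner integrals in the jet space. All derivatives of the dilate are Lipschitz with
compact support, and for `y` near `y₀` only a bounded set of base points contributes, on which the
exponential weight is bounded. -/
lemma continuous_jet_shift (N l : ℕ) :
    Continuous fun y : EuclideanSpace ℝ (Fin n) => jet N (κ.shift l y) := by
  set ψ := (κ.shift l 0).1 with hψ
  have hsm : ContDiff ℝ ∞ ψ := (κ.shift l 0).contDiff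
  have hlip : ∀ i, ∃ L : ℝ≥0, LipschitzWith L (iteratedFDeriv ℝ i ψ) := fun i =>
    ContDiff.lipschitzWith_of_hasCompactSupport (𝕂 := ℝ) (n := 1)
      ((κ.hasCompactSupport_shift l 0).iteratedFDeriv (𝕜 := ℝ) i)
      (hsm.iteratedFDeriv_right (by exact_mod_cast le_top)) one_ne_zero
  choose L hL using hlip
  obtain ⟨R, hR⟩ := (κ.hasCompactSupport_shift l 0).isCompact.isBounded.exists_norm_le
  have hzero : ∀ i w, R < ‖w‖ → iteratedFDeriv ℝ i ψ w = 0 := fun i w hw => by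
    by_contra h
    exact absurd (hR w (support_iteratedFDeriv_subset (𝕜 := ℝ) i h)) (not_le.2 hw)
  set S : ℝ := ∑ i ∈ Finset.range (N + 1), (L i : ℝ)
  have hS0 : 0 ≤ S := Finset.sum_nonneg fun i _ => (L i).2
  refine continuous_iff_continuousAt.2 fun y₀ => ?_
  refine tendsto_iff_norm_sub_tendsto_zero.2 ?_
  have hb : ∀ y ∈ Metric.ball y₀ 1, ‖jet N (κ.shift l y) - jet N (κ.shift l y₀)‖ ≤
      S * Real.exp (N * (R + ‖y₀‖ + 1)) * ‖y - y₀‖ := by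
    intro y hy
    rw [Metric.mem_ball, dist_eq_norm] at hy
    rw [← map_sub]
    refine norm_jet_le (by positivity) fun i hi z => ?_
    change ‖iteratedFDeriv ℝ i ((κ.shift l y).1 - (κ.shift l y₀).1) z‖ ≤ _
    rw [iteratedFDeriv_sub_apply
      ((κ.shift l y).contDiff.of_le (by exact_mod_cast le_top)).contDiffAt
      ((κ.shift l y₀).contDiff.of_le (by exact_mod_cast le_top)).contDiffAt,
      iteratedFDeriv_shift, κ.iteratedFDeriv_shift l i y₀]
    by_cases hz : ‖z‖ ≤ R + ‖y₀‖ + 1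
    · have h1 := (hL i).norm_sub_le (z - y) (z - y₀)
      rw [show z - y - (z - y₀) = -(y - y₀) by abel, norm_neg] at h1
      refine h1.trans ?_
      have h2 : (L i : ℝ) ≤ S := Finset.single_le_sum (f := fun i => (L i : ℝ))
        (fun i _ => (L i).2) (Finset.mem_range.2 (Nat.lt_succ_of_le hi))
      have h3 : 1 ≤ Real.exp (N * (R + ‖y₀‖ + 1)) * Real.exp (-(N * ‖0 - z‖)) := by
        rw [← Real.exp_add, zero_sub, norm_neg]
        refine Real.one_le_exp ?_
        have := mul_le_mul_of_nonneg_left hz (Nat.cast_nonneg (α := ℝ) N)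
        linarith
      calc (L i : ℝ) * ‖y - y₀‖ ≤ S * ‖y - y₀‖ * 1 := by rw [mul_one]; gcongr
        _ ≤ S * ‖y - y₀‖ * (Real.exp (N * (R + ‖y₀‖ + 1)) * Real.exp (-(N * ‖0 - z‖))) := by
          gcongr
        _ = _ := by ring
    · push Not at hz
      have h1 : R < ‖z - y₀‖ := by
        have := norm_sub_norm_le z y₀
        linarith
      have h2 : R < ‖z - y‖ := by
        have h3 := norm_sub_norm_le z y
        have h4 := norm_sub_norm_le y y₀
        linarith
      rw [hzero i _ h1, hzero i _ h2, sub_zero, norm_zero]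
      positivity
  refine squeeze_zero' (Eventually.of_forall fun _ => norm_nonneg _)
    (Filter.eventually_of_mem (Metric.ball_mem_nhds y₀ one_pos) hb) ?_
  have : Tendsto (fun y => S * Real.exp (N * (R + ‖y₀‖ + 1)) * ‖y - y₀‖) (𝓝 y₀)
      (𝓝 (S * Real.exp (N * (R + ‖y₀‖ + 1)) * ‖y₀ - y₀‖)) :=
    (continuous_const.mul ((continuous_id.sub continuous_const).norm)).tendsto y₀
  simpa using this

lemma continuous_coeff (j : ℕ) : Continuous (κ.coeff F j) := by
  cases j with
  | zero => exact F.continuous.comp (κ.continuous_jet_shift N 0)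
  | succ j =>
    have : κ.coeff F (j + 1) = fun y => F (jet N (κ.shift (j + 1) y)) - F (jet N (κ.shift j y)) := by
      ext y; rw [coeff, diffShift, map_sub, map_sub]
    rw [this]
    exact (F.continuous.comp (κ.continuous_jet_shift N (j + 1))).sub
      (F.continuous.comp (κ.continuous_jet_shift N j))

/-- The roles of kernel and function are exchanged, so that derivatives of `A_l η` fall on the
dilate of `φ₀`. -/
lemma A_eq_avg (l : ℕ) (η : Se 𝕜 n) :
    (κ.A l η).1 = avg (fun w => η.1 (-w)) 1 (κ.shift l 0).1 := by
  ext z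
  rw [A_apply, avg]
  have e1 : ∫ w, η.1 (-w) * (κ.shift l 0).1 (z + (1 : ℝ) • w) =
      ∫ v, η.1 (z + v) * κ.dilate l v := by
    rw [← integral_neg_eq_self, ← integral_add_left_eq_self _ z]
    congr 1; ext v
    rw [neg_neg, shift_apply]
    congr 2
    rw [one_smul]; abel
  rw [e1]
  have key := Measure.integral_comp_smul (volume : Measure (EuclideanSpace ℝ (Fin n)))
    (fun w => κ.toFun w * η.1 (z + ((2 : ℝ) ^ l)⁻¹ • w)) ((2 : ℝ) ^ l)
  rw [eq_comm, abs_of_pos (by positivity), finrank_euclideanSpace, Fintype.card_fin,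
    inv_smul_eq_iff₀ (by positivity)] at key
  rw [key, ← integral_smul]
  congr 1; ext v
  rw [smul_smul, inv_mul_cancel₀ (by positivity), one_smul, dilate, RCLike.real_smul_eq_coe_mul]
  push_cast
  rw [← pow_mul]
  ring

/-- `A_l η` is the superposition `∫ η(y) φ₀-dilate(y - ·) dy`. Read as a Bochner integral in the jet
space, it commutes with the bounded functional `F`. -/
lemma apply_jet_A (l : ℕ) {η : Se 𝕜 n} (hη : HasCompactSupport η.1) :
    F (jet N (κ.A l η)) = ∫ y, η.1 y * F (jet N (κ.shift l y)) := by
  have hcont : Continuous fun y => η.1 y • jet N (κ.shift l y) :=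
    η.contDiff.continuous.smul (κ.continuous_jet_shift N l)
  have hint : Integrable (fun y => η.1 y • jet N (κ.shift l y)) :=
    hcont.integrable_of_hasCompactSupport (hη.mono fun y hy h0 => hy (by simp only [h0, zero_smul]))
  have e1 : jet N (κ.A l η) = ∫ y, η.1 y • jet N (κ.shift l y) := by
    ext a
    have h1 := (BoundedContinuousFunction.evalCLM 𝕜 a).integral_comp_comm hint
    simp only [BoundedContinuousFunction.evalCLM_apply, BoundedContinuousFunction.coe_smul] at h1
    rw [← h1]
    have e2 : ∀ y, jet N (κ.shift l y) a = (Real.exp (N * ‖a.point‖) * (∏ j, ‖a.dir j‖)⁻¹) •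
        iteratedFDeriv ℝ a.order (κ.shift l 0).1 (a.point - y) a.dir := fun y => by
      rw [jet_apply, jetFun, iteratedFDeriv_shift]
    simp only [e2]
    rw [jet_apply, jetFun, A_eq_avg, iteratedFDeriv_avg_apply (φ := fun w => η.1 (-w))
      (η.contDiff.continuous.comp continuous_neg) (hη.comp_homeomorph (Homeomorph.neg _))
      (κ.shift l 0).contDiff, avg, ← integral_neg_eq_self, ← integral_smul]
    congr 1; ext y
    rw [neg_neg, one_smul, ← sub_eq_add_neg, smul_eq_mul, mul_smul_comm]
  rw [e1, ← F.integral_comp_comm hint]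
  simp only [map_smul, smul_eq_mul]

/-- The pairing of a distribution with a convolution. -/
lemma apply_jet_D (j : ℕ) {η : Se 𝕜 n} (hη : HasCompactSupport η.1) :
    F (jet N (κ.D j η)) = ∫ y, κ.coeff F j y * η.1 y := by
  have hint : ∀ l, Integrable fun y => η.1 y * F (jet N (κ.shift l y)) := fun l =>
    (η.contDiff.continuous.mul (F.continuous.comp
      (κ.continuous_jet_shift N l))).integrable_of_hasCompactSupport hη.mul_right
  cases j with
  | zero =>
    rw [D, κ.apply_jet_A F 0 hη]
    simp only [coeff, diffShift, mul_comm]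
  | succ j =>
    rw [D, LinearMap.sub_apply, map_sub, map_sub, κ.apply_jet_A F _ hη, κ.apply_jet_A F _ hη,
      ← integral_sub (hint _) (hint _)]
    congr 1; ext y
    rw [coeff, diffShift, map_sub, map_sub]
    ring

/-- The jet of order `N` of `θ - P_j θ` is `O(2^{-j})`, paid for by one more derivative of `θ`;
elements of `S_e` have derivatives of all orders under control. -/
lemma tendsto_apply_jet_P {M : ℕ} (hM : 1 ≤ M) (θ : Se 𝕜 n) :
    Tendsto (fun j => F (jet N (κ.P M j θ))) atTop (𝓝 (F (jet N θ))) := by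
  obtain ⟨C, hC0, hC⟩ := κ.one_sub_P_bound hM (Real.exp_pos ((N + 1 : ℕ) * κ.radius)).le
  obtain ⟨K, hK0, hK⟩ := θ.exists_derivBound_le (N + 1)
  have hb : ∀ j, ‖F (jet N (κ.P M j θ)) - F (jet N θ)‖ ≤
      ‖F‖ * (C * ((2 : ℝ) ^ j)⁻¹ * K) := by
    intro j
    rw [norm_sub_rev, ← map_sub, ← map_sub]
    have e : θ - κ.P M j θ = (1 - κ.P M j) θ := by simp
    rw [e]
    refine norm_apply_jet_le F (by positivity) fun i hi y => ?_
    refine ((hC j).2 _ (slowlyVarying_exp (Nat.cast_nonneg (N + 1)) 0 κ.radius) i K θ hK0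
      (hK (i + 1) (Nat.succ_le_succ hi)) y).trans ?_
    refine mul_le_mul_of_nonneg_left (Real.exp_le_exp.2 ?_) (by positivity)
    push_cast
    nlinarith [norm_nonneg ((0 : EuclideanSpace ℝ (Fin n)) - y)]
  refine tendsto_iff_norm_sub_tendsto_zero.2 (squeeze_zero (fun _ => norm_nonneg _) hb ?_)
  have h1 : Tendsto (fun j : ℕ => ((2 : ℝ) ^ j)⁻¹) atTop (𝓝 0) := by
    have := tendsto_pow_atTop_nhds_zero_of_lt_one (r := (2 : ℝ)⁻¹) (by norm_num) (by norm_num)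
    simpa using this
  simpa using ((h1.const_mul C).mul_const K).const_mul ‖F‖

variable {κ} {G : Set (EuclideanSpace ℝ (Fin n))}

lemma setIntegral_eq_of_isTestOn (j : ℕ) {η : Se 𝕜 n} (hη : IsTestOn G η.1) :
    ∫ y in G, κ.coeff F j y * η.1 y = F (jet N (κ.D j η)) := by
  rw [κ.apply_jet_D F j hη.hasCompactSupport]
  refine setIntegral_eq_integral_of_forall_compl_eq_zero fun y hy => ?_
  rw [image_eq_zero_of_notMem_tsupport fun h => hy (hη.tsupport_subset h), mul_zero]

/-- The reproducing formula for a distribution on `G`. -/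
lemma Absorbs.tendsto_sum (hG : κ.Absorbs G) {M : ℕ} (hM : 1 ≤ M) {θ : Se 𝕜 n}
    (hθ : IsTestOn G θ.1) :
    Tendsto (fun m => ∑ i ∈ Finset.range m, ∫ y in G, κ.coeff F i y * (κ.Q M i θ).1 y)
      atTop (𝓝 (F (jet N θ))) := by
  rw [← tendsto_add_atTop_iff_nat 1]
  refine (κ.tendsto_apply_jet_P F hM θ).congr fun m => ?_
  rw [P_eq_sum, LinearMap.sum_apply, map_sum, map_sum]
  refine Finset.sum_congr rfl fun i _ => ?_
  rw [setIntegral_eq_of_isTestOn F i (hG.Q M i θ hθ), Module.End.mul_apply]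

/-- The local reproducing formula for the convolutions of a distribution on `G`. -/
lemma Absorbs.tendsto_coeff (hG : κ.Absorbs G) {M : ℕ} (hM : 1 ≤ M) (l : ℕ)
    {x : EuclideanSpace ℝ (Fin n)} (hx : x ∈ G) :
    Tendsto (fun m => (∫ y in G, κ.coeff F l y *
        ((κ.geom M l * κ.geom M l * κ.A l) (κ.shift l x)).1 y) +
      ∑ i ∈ Finset.range m, ∫ y in G, κ.coeff F (l + i + 1) y *
        (κ.Q M (l + i + 1) (κ.diffShift l x)).1 y) atTop (𝓝 (κ.coeff F l x)) := by
  -- The telescoping sum is started at `P_l`, so that only levels `≥ l` occur. All the functions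
  -- tested are supported in `G`, which restricts the integrals to `G`.
  have h1 := (κ.tendsto_apply_jet_P F hM (κ.diffShift l x)).comp (tendsto_add_atTop_nat l)
  refine h1.congr fun m => ?_
  rw [Function.comp_apply, add_comm m l, P_eq_add_sum, LinearMap.add_apply, LinearMap.sum_apply,
    map_add, map_add, map_sum, map_sum, P_diffShift,
    setIntegral_eq_of_isTestOn F l
      ((((hG.geom M l).mul (hG.geom M l)).mul (hG.A l)) _ (hG.shift l hx))]
  congr 1
  refine Finset.sum_congr rfl fun i _ => ?_
  rw [setIntegral_eq_of_isTestOn F _ (hG.Q M _ _ (hG.diffShift l hx)), Module.End.mul_apply]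

end UnitKernel

/-! ### A pointwise estimate of Peetre type -/

section Peetre

variable {n : ℕ}

/-- The weights `exp(-a 2^j |x - z|)`. -/
def expDecay (a : ℝ) (j : ℕ) (x z : EuclideanSpace ℝ (Fin n)) : ℝ≥0∞ :=
  ENNReal.ofReal (Real.exp (-(a * 2 ^ j * ‖x - z‖)))

lemma expDecay_self (a : ℝ) (j : ℕ) (x : EuclideanSpace ℝ (Fin n)) : expDecay a j x x = 1 := by
  simp [expDecay]

lemma expDecay_ne_top (a : ℝ) (j : ℕ) (x z : EuclideanSpace ℝ (Fin n)) : expDecay a j x z ≠ ⊤ :=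
  ENNReal.ofReal_ne_top

lemma expDecay_mono {a b : ℝ} {j k : ℕ} (hab : a ≤ b) (hb : 0 ≤ b) (hjk : j ≤ k)
    (x z : EuclideanSpace ℝ (Fin n)) : expDecay b k x z ≤ expDecay a j x z := by
  refine ENNReal.ofReal_le_ofReal (Real.exp_le_exp.2 (neg_le_neg ?_))
  gcongr
  norm_num

lemma expDecay_mul_le {a : ℝ} (ha : 0 ≤ a) {j k : ℕ} (hjk : j ≤ k)
    (x y z : EuclideanSpace ℝ (Fin n)) :
    expDecay a j x y * expDecay a k y z ≤ expDecay a j x z := by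
  refine (mul_le_mul_right (expDecay_mono le_rfl ha hjk y z) _).trans ?_
  rw [expDecay, expDecay, ← ENNReal.ofReal_mul (Real.exp_pos _).le, ← Real.exp_add]
  refine ENNReal.ofReal_le_ofReal (Real.exp_le_exp.2 ?_)
  have h : ‖x - z‖ ≤ ‖x - y‖ + ‖y - z‖ := norm_sub_le_norm_sub_add_norm_sub x y z
  have := mul_le_mul_of_nonneg_left h (show 0 ≤ a * 2 ^ j by positivity)
  linarith

lemma expDecay_rpow (a : ℝ) {r : ℝ} (hr : 0 ≤ r) (j : ℕ) (x z : EuclideanSpace ℝ (Fin n)) :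
    expDecay a j x z ^ r = expDecay (r * a) j x z := by
  rw [expDecay, ENNReal.ofReal_rpow_of_nonneg (Real.exp_pos _).le hr, ← Real.exp_mul, expDecay]
  ring_nf

lemma measurable_expDecay (a : ℝ) (j : ℕ) (x : EuclideanSpace ℝ (Fin n)) :
    Measurable (expDecay a j x) := by
  unfold expDecay
  fun_prop

variable (G : Set (EuclideanSpace ℝ (Fin n)))

/-- The averages `2^{jn} ∫_G f_{j+i}^r exp(-a 2^j |x - ·|)`. -/
def expMean (f : ℕ → EuclideanSpace ℝ (Fin n) → ℝ≥0∞) (r a : ℝ) (i j : ℕ)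
    (x : EuclideanSpace ℝ (Fin n)) : ℝ≥0∞ :=
  2 ^ (j * n) * ∫⁻ z in G, f i z ^ r * expDecay a j x z

/-- The weighted sums of averages, over all levels `≥ j`. -/
def expSum (f : ℕ → EuclideanSpace ℝ (Fin n) → ℝ≥0∞) (r : ℝ) (N a : ℕ) (j : ℕ)
    (x : EuclideanSpace ℝ (Fin n)) : ℝ≥0∞ :=
  ∑' i, ((2⁻¹ : ℝ≥0∞) ^ (i * N)) ^ r * 2 ^ (i * n) * expMean G f r (r * a) (j + i) j x

/-- The maximal function. -/
def peetreSup (f : ℕ → EuclideanSpace ℝ (Fin n) → ℝ≥0∞) (N a : ℕ) (j : ℕ)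
    (x : EuclideanSpace ℝ (Fin n)) : ℝ≥0∞ :=
  ⨆ (m : ℕ) (y ∈ G), (2⁻¹ : ℝ≥0∞) ^ (m * N) * f (j + m) y * expDecay a j x y

/-- `f_l` is controlled by the averages of `f_i`, `i ≥ l`. -/
def SelfControlled (C : ℝ≥0) (N a : ℕ) (f : ℕ → EuclideanSpace ℝ (Fin n) → ℝ≥0∞) : Prop :=
  ∀ l, ∀ y ∈ G, f l y ≤ C * ∑' i, (2⁻¹ : ℝ≥0∞) ^ (i * N) * expMean G f 1 a (l + i) l y

variable {G} {f : ℕ → EuclideanSpace ℝ (Fin n) → ℝ≥0∞} {r : ℝ} {N a : ℕ}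

lemma le_peetreSup (m : ℕ) {j : ℕ} {x y : EuclideanSpace ℝ (Fin n)} (hy : y ∈ G) :
    (2⁻¹ : ℝ≥0∞) ^ (m * N) * f (j + m) y * expDecay a j x y ≤ peetreSup G f N a j x :=
  le_iSup_of_le m (le_iSup₂_of_le y hy le_rfl)

lemma half_pow_ne_top (k : ℕ) : (2⁻¹ : ℝ≥0∞) ^ k ≠ ⊤ := ENNReal.pow_ne_top (by simp)

/-- The Strömberg-Torchinsky device. Under the integral, the weighted value `g` of `f` is at most
the maximal function `M`, hence `g = g^{1-r} g^r ≤ M^{1-r} g^r`. Submultiplicativity of the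
exponential weights recentres the means from `y` to `x`. -/
lemma SelfControlled.peetreSup_le (hG : MeasurableSet G) {C : ℝ≥0} (h : SelfControlled G C N a f)
    (hr0 : 0 ≤ r) (hr1 : r ≤ 1)
    {j : ℕ} {x : EuclideanSpace ℝ (Fin n)} (hM : peetreSup G f N a j x ≠ ⊤) :
    peetreSup G f N a j x ≤ peetreSup G f N a j x ^ (1 - r) * (C * expSum G f r N a j x) := by
  set M := peetreSup G f N a j x with hMdef
  refine iSup_le fun m => iSup₂_le fun y hy => ?_
  have hterm : ∀ i, (2⁻¹ : ℝ≥0∞) ^ (m * N) * expDecay a j x y *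
      ((2⁻¹ : ℝ≥0∞) ^ (i * N) * expMean G f 1 a (j + m + i) (j + m) y) ≤
      M ^ (1 - r) * (((2⁻¹ : ℝ≥0∞) ^ ((m + i) * N)) ^ r * 2 ^ ((m + i) * n)
        * expMean G f r (r * a) (j + (m + i)) j x) := by
    intro i
    have hpt : ∀ z ∈ G, (2⁻¹ : ℝ≥0∞) ^ (m * N) * expDecay a j x y * (2⁻¹ : ℝ≥0∞) ^ (i * N) *
        (f (j + m + i) z ^ (1 : ℝ) * expDecay a (j + m) y z) ≤
        M ^ (1 - r) * ((2⁻¹ : ℝ≥0∞) ^ ((m + i) * N)) ^ r *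
          (f (j + (m + i)) z ^ r * expDecay (r * a) j x z) := by
      intro z hz
      set g := (2⁻¹ : ℝ≥0∞) ^ ((m + i) * N) * f (j + (m + i)) z * expDecay a j x z with hg
      have hgM : g ≤ M := le_peetreSup (m + i) hz
      calc _ = (2⁻¹ : ℝ≥0∞) ^ ((m + i) * N) * f (j + (m + i)) z *
            (expDecay a j x y * expDecay a (j + m) y z) := by
            rw [ENNReal.rpow_one, add_mul, pow_add, add_assoc]; ring
        _ ≤ g := mul_le_mul_right
            (expDecay_mul_le (Nat.cast_nonneg a) (Nat.le_add_right j m) x y z) _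
        _ = g ^ (1 - r) * g ^ r := by
            rw [← ENNReal.rpow_add_of_nonneg _ _ (by linarith) hr0]; simp
        _ ≤ M ^ (1 - r) * g ^ r := by gcongr
        _ = _ := by
            rw [hg, ENNReal.mul_rpow_of_nonneg _ _ hr0, ENNReal.mul_rpow_of_nonneg _ _ hr0,
              expDecay_rpow _ hr0]
            ring
    have hint : (2⁻¹ : ℝ≥0∞) ^ (m * N) * expDecay a j x y * (2⁻¹ : ℝ≥0∞) ^ (i * N) *
        ∫⁻ z in G, f (j + m + i) z ^ (1 : ℝ) * expDecay a (j + m) y z ≤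
        M ^ (1 - r) * ((2⁻¹ : ℝ≥0∞) ^ ((m + i) * N)) ^ r *
          ∫⁻ z in G, f (j + (m + i)) z ^ r * expDecay (r * a) j x z := by
      rw [← lintegral_const_mul' _ _ (ENNReal.mul_ne_top (ENNReal.mul_ne_top (half_pow_ne_top _)
        (expDecay_ne_top _ _ _ _)) (half_pow_ne_top _)), ← lintegral_const_mul' _ _
        (ENNReal.mul_ne_top (ENNReal.rpow_ne_top_of_nonneg (by linarith) hM)
          (ENNReal.rpow_ne_top_of_nonneg hr0 (half_pow_ne_top _)))]
      exact setLIntegral_mono' hG hpt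
    have hpow : (2 : ℝ≥0∞) ^ ((j + m) * n) ≤ 2 ^ ((m + i) * n) * 2 ^ (j * n) := by
      rw [← pow_add, ← add_mul]
      exact pow_le_pow_right₀ (by norm_num) (Nat.mul_le_mul_right _ (by omega))
    unfold expMean
    calc _ = 2 ^ ((j + m) * n) * ((2⁻¹ : ℝ≥0∞) ^ (m * N) * expDecay a j x y *
        (2⁻¹ : ℝ≥0∞) ^ (i * N) *
        ∫⁻ z in G, f (j + m + i) z ^ (1 : ℝ) * expDecay a (j + m) y z) := by ring
      _ ≤ 2 ^ ((m + i) * n) * 2 ^ (j * n) * (M ^ (1 - r) * ((2⁻¹ : ℝ≥0∞) ^ ((m + i) * N)) ^ r *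
          ∫⁻ z in G, f (j + (m + i)) z ^ r * expDecay (r * a) j x z) := mul_le_mul' hpow hint
      _ = _ := by ring
  calc (2⁻¹ : ℝ≥0∞) ^ (m * N) * f (j + m) y * expDecay a j x y
      ≤ (2⁻¹ : ℝ≥0∞) ^ (m * N) * (C * ∑' i, (2⁻¹ : ℝ≥0∞) ^ (i * N) *
        expMean G f 1 a (j + m + i) (j + m) y) * expDecay a j x y := by
        gcongr; exact h (j + m) y hy
    _ = C * ∑' i, (2⁻¹ : ℝ≥0∞) ^ (m * N) * expDecay a j x y *
      ((2⁻¹ : ℝ≥0∞) ^ (i * N) * expMean G f 1 a (j + m + i) (j + m) y) := by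
        rw [ENNReal.tsum_mul_left]; ring
    _ ≤ C * ∑' i, M ^ (1 - r) * (((2⁻¹ : ℝ≥0∞) ^ ((m + i) * N)) ^ r * 2 ^ ((m + i) * n)
        * expMean G f r (r * a) (j + (m + i)) j x) := by
        exact mul_le_mul_right (ENNReal.tsum_le_tsum hterm) _
    _ = M ^ (1 - r) * (C * ∑' i, ((2⁻¹ : ℝ≥0∞) ^ ((m + i) * N)) ^ r * 2 ^ ((m + i) * n)
        * expMean G f r (r * a) (j + (m + i)) j x) := by rw [ENNReal.tsum_mul_left]; ring
    _ ≤ _ := by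
        gcongr
        exact ENNReal.tsum_comp_le_tsum_of_injective (add_right_injective m) _

/-- Division by `M^{1-r}`, which is legitimate only because `M` is finite. -/
lemma SelfControlled.peetreSup_rpow_le (hG : MeasurableSet G) {C : ℝ≥0}
    (h : SelfControlled G C N a f) (hr0 : 0 < r) (hr1 : r ≤ 1)
    {j : ℕ} {x : EuclideanSpace ℝ (Fin n)} (hM : peetreSup G f N a j x ≠ ⊤) :
    peetreSup G f N a j x ^ r ≤ C * expSum G f r N a j x := by
  have h1 := h.peetreSup_le hG hr0.le hr1 hM
  set M := peetreSup G f N a j x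
  rcases eq_or_ne M 0 with h0 | h0
  · rw [h0, ENNReal.zero_rpow_of_pos hr0]; exact zero_le
  · have h2 : M ^ (1 - r) ≠ 0 := by
      rw [Ne, ENNReal.rpow_eq_zero_iff]
      rintro (h | h)
      · exact h0 h.1
      · exact hM h.1
    have h3 : M ^ (1 - r) ≠ ⊤ := ENNReal.rpow_ne_top_of_nonneg (by linarith) hM
    rw [← ENNReal.mul_le_mul_iff_right h2 h3]
    refine le_trans (le_of_eq ?_) h1
    rw [← ENNReal.rpow_add_of_nonneg _ _ (by linarith) hr0.le]
    simp

lemma rpow_le_peetreSup (hr0 : 0 ≤ r) {j : ℕ} {x : EuclideanSpace ℝ (Fin n)} (hx : x ∈ G) :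
    f j x ^ r ≤ peetreSup G f N a j x ^ r := by
  refine ENNReal.rpow_le_rpow ?_ hr0
  have := le_peetreSup (G := G) (f := f) (N := N) (a := a) (x := x) (j := j) 0 hx
  simpa [expDecay_self] using this

/-- With this, a pointwise bound by `expSum` at all points and levels passes to the maximal
function; it is used to recover finiteness. -/
lemma expSum_shift_le (hr0 : 0 ≤ r) {j : ℕ} (m : ℕ)
    (x y : EuclideanSpace ℝ (Fin n)) :
    ((2⁻¹ : ℝ≥0∞) ^ (m * N)) ^ r * expDecay a j x y ^ r * expSum G f r N a (j + m) y
      ≤ expSum G f r N a j x := by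
  unfold expSum
  rw [← ENNReal.tsum_mul_left]
  refine le_trans (ENNReal.tsum_le_tsum fun i => ?_)
    (ENNReal.tsum_comp_le_tsum_of_injective (add_right_injective m) _)
  have hint : expDecay a j x y ^ r *
      ∫⁻ z in G, f (j + m + i) z ^ r * expDecay (r * a) (j + m) y z ≤
        ∫⁻ z in G, f (j + (m + i)) z ^ r * expDecay (r * a) j x z := by
    rw [← lintegral_const_mul' _ _ (ENNReal.rpow_ne_top_of_nonneg hr0 (expDecay_ne_top _ _ _ _))]
    refine lintegral_mono fun z => ?_
    rw [expDecay_rpow _ hr0, mul_left_comm, add_assoc]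
    exact mul_le_mul_right (expDecay_mul_le (by positivity) (Nat.le_add_right j m) x y z) _
  unfold expMean
  calc _ = ((2⁻¹ : ℝ≥0∞) ^ (m * N)) ^ r * ((2⁻¹ : ℝ≥0∞) ^ (i * N)) ^ r *
        (2 ^ (i * n) * 2 ^ ((j + m) * n)) * (expDecay a j x y ^ r *
      ∫⁻ z in G, f (j + m + i) z ^ r * expDecay (r * a) (j + m) y z) := by ring
    _ ≤ ((2⁻¹ : ℝ≥0∞) ^ (m * N)) ^ r * ((2⁻¹ : ℝ≥0∞) ^ (i * N)) ^ r *
        (2 ^ (i * n) * 2 ^ ((j + m) * n)) *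
        ∫⁻ z in G, f (j + (m + i)) z ^ r * expDecay (r * a) j x z := by gcongr
    _ = _ := by
      rw [← ENNReal.mul_rpow_of_nonneg _ _ hr0, ← pow_add, ← pow_add, ← add_mul, ← add_mul]
      rw [show i + (j + m) = (m + i) + j by ring, add_mul (m + i) j n, pow_add]
      ring

/-- A family of at most exponential growth is controlled by its averages of order `r ≤ 1`, with
constants which do not depend on the growth. -/
lemma rpow_le_expSum (hG : MeasurableSet G) {C : ℕ → ℕ → ℝ≥0}
    (h : ∀ N a, SelfControlled G (C N a) N a f) {Cf : ℝ≥0} {Nf : ℕ}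
    (hf : ∀ l, ∀ y ∈ G, f l y ≤ Cf * 2 ^ (l * Nf) * ENNReal.ofReal (Real.exp (Nf * ‖y‖)))
    (hr0 : 0 < r) (hr1 : r ≤ 1) (N a j : ℕ) {x : EuclideanSpace ℝ (Fin n)} (hx : x ∈ G) :
    f j x ^ r ≤ (C N a + 1 : ℝ≥0) * expSum G f r N a j x := by
  -- For parameters beyond the growth rate of `f` the maximal function is finite, but the constant
  -- `C N a` then depends on `f`.
  have hlarge : ∀ N a, Nf ≤ N → Nf ≤ a → ∀ j x, peetreSup G f N a j x ≠ ⊤ := by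
    intro N a hN ha j x
    have : peetreSup G f N a j x ≤
        Cf * 2 ^ (j * Nf) * ENNReal.ofReal (Real.exp (Nf * ‖x‖)) := by
      refine iSup_le fun m => iSup₂_le fun y hy => ?_
      have h1 : (2⁻¹ : ℝ≥0∞) ^ (m * N) * 2 ^ ((j + m) * Nf) ≤ 2 ^ (j * Nf) := by
        rw [add_mul, pow_add, mul_left_comm]
        refine mul_le_of_le_one_right zero_le ?_
        calc (2⁻¹ : ℝ≥0∞) ^ (m * N) * 2 ^ (m * Nf) ≤ (2⁻¹ : ℝ≥0∞) ^ (m * Nf) * 2 ^ (m * Nf) := by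
              gcongr ?_ * _
              exact pow_le_pow_of_le_one zero_le (by simp) (Nat.mul_le_mul_left _ hN)
          _ = 1 := by rw [← mul_pow, ENNReal.inv_mul_cancel (by simp) (by simp), one_pow]
      have h2 : ENNReal.ofReal (Real.exp (Nf * ‖y‖)) * expDecay a j x y ≤
          ENNReal.ofReal (Real.exp (Nf * ‖x‖)) := by
        rw [expDecay, ← ENNReal.ofReal_mul (Real.exp_pos _).le, ← Real.exp_add]
        refine ENNReal.ofReal_le_ofReal (Real.exp_le_exp.2 ?_)
        have h3 : ‖y‖ ≤ ‖x‖ + ‖x - y‖ := by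
          have := norm_sub_norm_le y x
          rw [norm_sub_rev] at this; linarith
        have h4 : (Nf : ℝ) ≤ a * 2 ^ j :=
          le_trans (by exact_mod_cast ha) (le_mul_of_one_le_right (Nat.cast_nonneg a)
            (one_le_pow₀ (by norm_num)))
        have h5 := mul_le_mul_of_nonneg_left h3 (Nat.cast_nonneg (α := ℝ) Nf)
        have h6 := mul_le_mul_of_nonneg_right h4 (norm_nonneg (x - y))
        linarith
      calc _ ≤ (2⁻¹ : ℝ≥0∞) ^ (m * N) * (Cf * 2 ^ ((j + m) * Nf) *
            ENNReal.ofReal (Real.exp (Nf * ‖y‖))) * expDecay a j x y := by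
            gcongr; exact hf (j + m) y hy
        _ = Cf * ((2⁻¹ : ℝ≥0∞) ^ (m * N) * 2 ^ ((j + m) * Nf)) *
          (ENNReal.ofReal (Real.exp (Nf * ‖y‖)) * expDecay a j x y) := by ring
        _ ≤ _ := by gcongr
    refine ne_top_of_le_ne_top ?_ this
    exact ENNReal.mul_ne_top (ENNReal.mul_ne_top ENNReal.coe_ne_top
      (ENNReal.pow_ne_top (by simp))) ENNReal.ofReal_ne_top
  by_cases hR : expSum G f r N a j x = ⊤
  · rw [hR, ENNReal.mul_top]
    · exact le_top
    · simp
  -- Bootstrap. The estimate for the large parameters `N'`, `a'` holds a fortiori with `expSum` for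
  -- `N`, `a`, since `expSum` decreases in both. As that sum is finite at `(j, x)`, so is the
  -- maximal function with the original parameters, and the argument can be repeated with the
  -- constant `C N a`, which does not see the growth of `f`.
  have hfin : peetreSup G f N a j x ≠ ⊤ := by
    set N' := max N Nf
    set a' := max a Nf
    have h1 : ∀ l, ∀ y ∈ G, f l y ^ r ≤ C N' a' * expSum G f r N a l y := by
      intro l y hy
      refine (rpow_le_peetreSup hr0.le hy).trans (((h N' a').peetreSup_rpow_le hG hr0 hr1
        (hlarge N' a' (le_max_right _ _) (le_max_right _ _) l y)).trans ?_)
      refine mul_le_mul_right (ENNReal.tsum_le_tsum fun i => ?_) _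
      refine mul_le_mul' (mul_le_mul_left (ENNReal.rpow_le_rpow ?_ hr0.le) _)
        (mul_le_mul_right (lintegral_mono fun z => mul_le_mul_right ?_ _) _)
      · exact pow_le_pow_of_le_one zero_le (by simp) (Nat.mul_le_mul_left _ (le_max_left _ _))
      · refine expDecay_mono ?_ (by positivity) le_rfl y z
        refine mul_le_mul_of_nonneg_left ?_ hr0.le
        exact_mod_cast le_max_left _ _
    have h2 : peetreSup G f N a j x ≤ (C N' a' * expSum G f r N a j x) ^ r⁻¹ := by
      refine iSup_le fun m => iSup₂_le fun y hy => ?_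
      rw [ENNReal.le_rpow_inv_iff hr0, ENNReal.mul_rpow_of_nonneg _ _ hr0.le,
        ENNReal.mul_rpow_of_nonneg _ _ hr0.le]
      calc _ ≤ ((2⁻¹ : ℝ≥0∞) ^ (m * N)) ^ r * (C N' a' * expSum G f r N a (j + m) y) *
            expDecay a j x y ^ r := by gcongr; exact h1 _ y hy
        _ = C N' a' * (((2⁻¹ : ℝ≥0∞) ^ (m * N)) ^ r * expDecay a j x y ^ r *
            expSum G f r N a (j + m) y) := by ring
        _ ≤ _ := by gcongr; exact expSum_shift_le hr0.le m x y
    refine ne_top_of_le_ne_top ?_ h2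
    exact ENNReal.rpow_ne_top_of_nonneg (by positivity) (ENNReal.mul_ne_top ENNReal.coe_ne_top hR)
  refine (rpow_le_peetreSup hr0.le hx).trans (((h N a).peetreSup_rpow_le hG hr0 hr1 hfin).trans ?_)
  gcongr
  exact le_self_add

lemma half_rpow_mul_le {N₁ : ℕ} {i : ℕ} (hN : (N + n : ℕ) ≤ N₁ * r) :
    ((2⁻¹ : ℝ≥0∞) ^ (i * N₁)) ^ r * 2 ^ (i * n) ≤ (2⁻¹ : ℝ≥0∞) ^ (i * N) := by
  have h1 : ((2⁻¹ : ℝ≥0∞) ^ (i * N₁)) ^ r ≤ (2⁻¹ : ℝ≥0∞) ^ (i * (N + n)) := by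
    rw [← ENNReal.rpow_natCast, ← ENNReal.rpow_mul, ← ENNReal.rpow_natCast]
    refine ENNReal.rpow_le_rpow_of_exponent_ge (by simp) ?_
    push_cast at hN ⊢
    rw [mul_assoc]
    exact mul_le_mul_of_nonneg_left hN (Nat.cast_nonneg i)
  calc _ ≤ (2⁻¹ : ℝ≥0∞) ^ (i * (N + n)) * 2 ^ (i * n) := by gcongr
    _ = (2⁻¹ : ℝ≥0∞) ^ (i * N) * ((2⁻¹ : ℝ≥0∞) ^ (i * n) * 2 ^ (i * n)) := by
      rw [mul_add, pow_add, mul_assoc]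
    _ = _ := by rw [← mul_pow, ENNReal.inv_mul_cancel (by simp) (by simp), one_pow, mul_one]

/-- The estimate of Peetre type in its final form. -/
lemma exists_rpow_le_tsum_expMean (hG : MeasurableSet G) (C : ℕ → ℕ → ℝ≥0)
    (hr0 : 0 < r) (hr1 : r ≤ 1) (N : ℕ) (a : ℝ) : ∃ C' : ℝ≥0,
    ∀ f : ℕ → EuclideanSpace ℝ (Fin n) → ℝ≥0∞,
    (∀ N a, SelfControlled G (C N a) N a f) → (∃ (Cf : ℝ≥0) (Nf : ℕ),
    ∀ l, ∀ y ∈ G, f l y ≤ Cf * 2 ^ (l * Nf) * ENNReal.ofReal (Real.exp (Nf * ‖y‖))) →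
    ∀ j, ∀ x ∈ G, f j x ^ r ≤
      C' * ∑' i, (2⁻¹ : ℝ≥0∞) ^ (i * N) * expMean G f r a (j + i) j x := by
  -- `N₁ r ≥ N + n` absorbs the factor `2^{in}` in `expSum`, and `a₁ r ≥ a` restores the decay after
  -- taking the power `r`.
  obtain ⟨N₁, hN₁⟩ := exists_nat_ge ((N + n : ℕ) / r)
  obtain ⟨a₁, ha₁⟩ := exists_nat_ge (a / r)
  rw [div_le_iff₀ hr0] at hN₁ ha₁
  refine ⟨C N₁ a₁ + 1, fun f h ⟨Cf, Nf, hf⟩ j x hx => ?_⟩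
  refine (rpow_le_expSum hG h hf hr0 hr1 N₁ a₁ j hx).trans
    (mul_le_mul_right (ENNReal.tsum_le_tsum fun i => ?_) _)
  refine mul_le_mul' (half_rpow_mul_le hN₁)
    (mul_le_mul_right (lintegral_mono fun z => mul_le_mul_right ?_ _) _)
  exact expDecay_mono (by linarith) (by positivity) le_rfl x z

end Peetre

/-! ### Kernels with vanishing moments -/

section Moments

variable {𝕜 : Type*} [RCLike 𝕜] {n : ℕ}

/-- All moments of order less than `m` vanish. -/
def VanishingMoments (m : ℕ) (ψ : EuclideanSpace ℝ (Fin n) → 𝕜) : Prop :=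
  ∀ β : Fin n → ℕ, ∑ i, β i < m → ∫ x, ((∏ i, x i ^ β i : ℝ) : 𝕜) * ψ x = 0

/-- The supremum exceeds `α - 1`, so some admissible `L` does, and `m = L + 1` works. The value `L =
-1` gives `m = 0`, that is, no moment condition. -/
lemma exists_vanishingMoments {ψ : EuclideanSpace ℝ (Fin n) → 𝕜} {α : ℝ}
    (h : (α : EReal) < momentOrder ψ + 1) : ∃ m : ℕ, α < m ∧ VanishingMoments m ψ := by
  have h1 : ((α - 1 : ℝ) : EReal) < momentOrder ψ := by
    rw [EReal.coe_sub]
    exact EReal.sub_lt_of_lt_add h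
  obtain ⟨L, hL⟩ := lt_iSup_iff.1 h1
  obtain ⟨hL2, hL3⟩ := lt_iSup_iff.1 hL
  have h3 : α - 1 < L := EReal.coe_lt_coe_iff.1 hL3
  refine ⟨(L + 1).toNat, ?_, fun β hβ => hL2.2 β (by omega)⟩
  have h4 : ((L + 1).toNat : ℤ) = L + 1 := Int.toNat_of_nonneg (by omega)
  have h5 : ((L + 1).toNat : ℝ) = L + 1 := by exact_mod_cast h4
  rw [h5]; linarith

lemma iteratedDeriv_comp_line {g : EuclideanSpace ℝ (Fin n) → 𝕜} (hg : ContDiff ℝ ∞ g)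
    (x w : EuclideanSpace ℝ (Fin n)) (i : ℕ) (t : ℝ) :
    iteratedDeriv i (fun t : ℝ => g (x + t • w)) t = iteratedFDeriv ℝ i g (x + t • w) fun _ => w := by
  induction i generalizing t with
  | zero => simp
  | succ i ih =>
    rw [iteratedDeriv_succ, funext ih]
    have h1 : HasFDerivAt (fun y => iteratedFDeriv ℝ i g y fun _ => w)
        (fderiv ℝ (fun y => iteratedFDeriv ℝ i g y fun _ => w) (x + t • w)) (x + t • w) :=
      ((contDiff_iteratedFDeriv_apply hg i _).differentiable (by simp) _).hasFDerivAt
    have h2 : HasDerivAt (fun t : ℝ => x + t • w) w t := by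
      simpa using ((hasDerivAt_id t).smul_const w).const_add x
    have h3 : HasDerivAt (fun t : ℝ => iteratedFDeriv ℝ i g (x + t • w) fun _ => w)
        (fderiv ℝ (fun y => iteratedFDeriv ℝ i g y fun _ => w) (x + t • w) w) t :=
      HasFDerivAt.comp_hasDerivAt (l := fun y => iteratedFDeriv ℝ i g y fun _ => w) t h1 h2
    rw [h3.deriv, DifferentiableAt.iteratedFDeriv_succ_apply_left'
      (hg.differentiable_iteratedFDeriv (by exact_mod_cast ENat.natCast_lt_top i) _)]
    rfl

/-- On the diagonal a multilinear form of degree `i` is a combination of monomials of degree `i <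
m`, one for each `s : Fin i → Fin n`; the exponent of `v k` counts the fibre of `s` over `k`. -/
lemma integral_multilinear_eq_zero {m : ℕ} {ψ : EuclideanSpace ℝ (Fin n) → 𝕜}
    (hψ : VanishingMoments m ψ) (hc : Continuous ψ) (hs : HasCompactSupport ψ) {i : ℕ} (hi : i < m)
    (T : ContinuousMultilinearMap ℝ (fun _ : Fin i => EuclideanSpace ℝ (Fin n)) 𝕜) :
    ∫ v, T (fun _ => v) * ψ v = 0 := by
  classical
  have hexp : ∀ v : EuclideanSpace ℝ (Fin n), T (fun _ => v) * ψ v =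
      ∑ s : Fin i → Fin n, T (fun j => EuclideanSpace.single (s j) (1 : ℝ)) *
        (((∏ k, v k ^ (Finset.univ.filter fun j => s j = k).card : ℝ) : 𝕜) * ψ v) := by
    intro v
    have hv : v = ∑ k, v k • EuclideanSpace.single k (1 : ℝ) := by
      ext l
      simp [Finset.sum_apply, Pi.single_apply]
    have h1 : T (fun _ => v) = ∑ s : Fin i → Fin n,
        T (fun j => v (s j) • EuclideanSpace.single (s j) (1 : ℝ)) := by
      conv_lhs => rw [hv]
      exact T.map_sum fun _ k => v k • EuclideanSpace.single k (1 : ℝ)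
    rw [h1, Finset.sum_mul]
    refine Finset.sum_congr rfl fun s _ => ?_
    rw [T.map_smul_univ fun j => v (s j), RCLike.real_smul_eq_coe_mul]
    have h2 : ∏ j, v (s j) = ∏ k, v k ^ (Finset.univ.filter fun j => s j = k).card := by
      rw [← Finset.prod_fiberwise_of_maps_to' (s := Finset.univ) (t := Finset.univ) (g := s)
        (fun _ _ => Finset.mem_univ _) (fun k => v k)]
      simp
    rw [h2]; ring
  simp_rw [hexp]
  have hint : ∀ s : Fin i → Fin n, Integrable fun v : EuclideanSpace ℝ (Fin n) =>
      T (fun j => EuclideanSpace.single (s j) (1 : ℝ)) *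
        (((∏ k, v k ^ (Finset.univ.filter fun j => s j = k).card : ℝ) : 𝕜) * ψ v) := fun s => by
    refine Continuous.integrable_of_hasCompactSupport ?_ hs.mul_left.mul_left
    refine continuous_const.mul ((RCLike.continuous_ofReal.comp ?_).mul hc)
    fun_prop
  rw [integral_finsetSum _ fun s _ => hint s]
  refine Finset.sum_eq_zero fun s _ => ?_
  rw [integral_const_mul, hψ, mul_zero]
  rw [← Finset.card_eq_sum_card_fiberwise (f := s) (s := Finset.univ) (t := Finset.univ)
    (fun _ _ => Finset.mem_univ _)]
  simpa using hi

/-- The one-dimensional Taylor formula along the segment from `x` to `x + w`; the factorial in the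
remainder is discarded. -/
lemma exists_taylor_bound {g : EuclideanSpace ℝ (Fin n) → 𝕜} (hg : ContDiff ℝ ∞ g) (m : ℕ)
    (x w : EuclideanSpace ℝ (Fin n)) {C : ℝ}
    (hC : ∀ t ∈ Set.Icc (0 : ℝ) 1, ‖iteratedFDeriv ℝ (m + 1) g (x + t • w)‖ ≤ C) :
    ‖g (x + w) - ∑ k ∈ Finset.range (m + 1), ((k.factorial : ℝ)⁻¹) •
      iteratedFDeriv ℝ k g x fun _ => w‖ ≤ C * ‖w‖ ^ (m + 1) := by
  set h : ℝ → 𝕜 := fun t => g (x + t • w)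
  have hh : ContDiff ℝ ∞ h := hg.comp (by fun_prop)
  have hw : ∀ k : ℕ, ∀ t ∈ Set.Icc (0 : ℝ) 1, iteratedDerivWithin k h (Set.Icc 0 1) t =
      iteratedFDeriv ℝ k g (x + t • w) fun _ => w := fun k t ht => by
    rw [iteratedDerivWithin_eq_iteratedDeriv (uniqueDiffOn_Icc zero_lt_one)
      (hh.of_le (by exact_mod_cast le_top)).contDiffAt ht, iteratedDeriv_comp_line hg]
  have h1 := taylor_mean_remainder_bound (f := h) (a := 0) (b := 1) (x := 1) (n := m)
    (C := C * ‖w‖ ^ (m + 1)) zero_le_one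
    (ContDiff.contDiffOn (hh.of_le (by exact_mod_cast le_top))) ⟨zero_le_one, le_rfl⟩
    (fun t ht => by
      rw [hw _ t ht]
      refine (ContinuousMultilinearMap.le_opNorm _ _).trans ?_
      rw [Finset.prod_const, Finset.card_univ, Fintype.card_fin]
      exact mul_le_mul_of_nonneg_right (hC t ht) (by positivity))
  rw [taylor_within_apply] at h1
  have h2 : ∀ k ∈ Finset.range (m + 1), (((k.factorial : ℝ)⁻¹) * (1 - 0) ^ k) •
      iteratedDerivWithin k h (Set.Icc 0 1) 0 = ((k.factorial : ℝ)⁻¹) •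
      iteratedFDeriv ℝ k g x fun _ => w := fun k _ => by
    rw [hw k 0 ⟨le_rfl, zero_le_one⟩, zero_smul, add_zero, sub_zero, one_pow, mul_one]
  rw [Finset.sum_congr rfl h2] at h1
  have h3 : h 1 = g (x + w) := by simp [h]
  rw [h3] at h1
  refine h1.trans ?_
  have hC0 : 0 ≤ C := (norm_nonneg _).trans (hC 0 ⟨le_rfl, zero_le_one⟩)
  rw [sub_zero, one_pow, mul_one]
  exact div_le_self (by positivity) (by exact_mod_cast Nat.succ_le_of_lt (Nat.factorial_pos m))

variable (κ : UnitKernel 𝕜 n)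

/-- Convolutions of a dilated kernel with vanishing moments with a smooth kernel are small. -/
lemma UnitKernel.exists_moment_bound {m : ℕ} {ψ : EuclideanSpace ℝ (Fin n) → 𝕜}
    (hψ : VanishingMoments m ψ) (hc : Continuous ψ) (hs : HasCompactSupport ψ) {a : ℝ}
    (ha : 0 ≤ a) :
    ∃ C, 0 ≤ C ∧ ∀ (ε : ℝ) (x : EuclideanSpace ℝ (Fin n)), 0 ≤ ε → ε ≤ 1 →
      ‖∫ v, κ.toFun (x - ε • v) * ψ v‖ ≤ C * ε ^ m * Real.exp (-(a * ‖x‖)) := by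
  obtain ⟨S, hS⟩ := hs.isCompact.isBounded.exists_norm_le
  set R := max S 0
  have hR0 : 0 ≤ R := le_max_right _ _
  have hR : ∀ v, ψ v ≠ 0 → ‖v‖ ≤ R := fun v hv =>
    (hS v (subset_tsupport _ hv)).trans (le_max_left _ _)
  obtain ⟨C, hC0, hC⟩ := κ.exists_decay m a
  have hI : 0 ≤ ∫ v, ‖ψ v‖ := integral_nonneg fun _ => norm_nonneg _
  refine ⟨C * Real.exp (a * R) * R ^ m * ∫ v, ‖ψ v‖, by positivity, fun ε x hε0 hε1 => ?_⟩
  have hdec : ∀ v, ψ v ≠ 0 → ∀ t ∈ Set.Icc (0 : ℝ) 1,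
      ‖iteratedFDeriv ℝ m κ.toFun (x + t • -(ε • v))‖ ≤
        C * Real.exp (a * R) * Real.exp (-(a * ‖x‖)) := by
    intro v hv t ht
    refine (hC _).trans ?_
    rw [mul_assoc, ← Real.exp_add]
    refine mul_le_mul_of_nonneg_left (Real.exp_le_exp.2 ?_) hC0
    have h1 : ‖x‖ ≤ ‖x + t • -(ε • v)‖ + R := by
      have h2 : ‖t • -(ε • v)‖ ≤ R := by
        rw [norm_smul, norm_neg, norm_smul, Real.norm_of_nonneg ht.1, Real.norm_of_nonneg hε0]
        have h3 := hR v hv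
        have : ε * ‖v‖ ≤ 1 * R := mul_le_mul hε1 h3 (norm_nonneg _) zero_le_one
        calc t * (ε * ‖v‖) ≤ 1 * (1 * R) := mul_le_mul ht.2 this (by positivity) zero_le_one
          _ = R := by ring
      have := norm_sub_le (x + t • -(ε • v)) (t • -(ε • v))
      rw [add_sub_cancel_right] at this
      linarith
    nlinarith
  have hcomp : Continuous fun v => κ.toFun (x - ε • v) * ψ v :=
    (κ.continuous.comp (by fun_prop)).mul hc
  -- Any `T` orthogonal to `ψ` may be subtracted from the kernel. It will be the Taylor polynomial
  -- of degree `m - 1` at `x`, or `0` if there are no moments.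
  have key : ∀ T : EuclideanSpace ℝ (Fin n) → 𝕜, Continuous T → ∫ v, T v * ψ v = 0 →
      (∀ v, ψ v ≠ 0 → ‖κ.toFun (x - ε • v) - T v‖ ≤
        C * Real.exp (a * R) * Real.exp (-(a * ‖x‖)) * (ε * R) ^ m) →
      ‖∫ v, κ.toFun (x - ε • v) * ψ v‖ ≤
        C * Real.exp (a * R) * R ^ m * (∫ v, ‖ψ v‖) * ε ^ m * Real.exp (-(a * ‖x‖)) := by
    intro T hT hT0 hb
    have e1 : ∫ v, κ.toFun (x - ε • v) * ψ v = ∫ v, (κ.toFun (x - ε • v) - T v) * ψ v := by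
      have hTψ : Integrable fun v => T v * ψ v :=
        Continuous.integrable_of_hasCompactSupport (hT.mul hc) hs.mul_left
      simp_rw [sub_mul]
      rw [integral_sub (hcomp.integrable_of_hasCompactSupport hs.mul_left) hTψ, hT0, sub_zero]
    rw [e1]
    have e2 : C * Real.exp (a * R) * R ^ m * (∫ v, ‖ψ v‖) * ε ^ m * Real.exp (-(a * ‖x‖)) =
        ∫ v, C * Real.exp (a * R) * Real.exp (-(a * ‖x‖)) * (ε * R) ^ m * ‖ψ v‖ := by
      rw [integral_const_mul, mul_pow]; ring
    rw [e2]
    refine norm_integral_le_of_norm_le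
      ((hc.norm.integrable_of_hasCompactSupport hs.norm).const_mul _)
      (Filter.Eventually.of_forall fun v => ?_)
    rw [norm_mul]
    by_cases hv : ψ v = 0
    · simp [hv]
    · exact mul_le_mul_of_nonneg_right (hb v hv) (norm_nonneg _)
  cases m with
  | zero =>
    refine key (fun _ => 0) continuous_const (by simp) fun v hv => ?_
    have := hdec v hv 1 ⟨zero_le_one, le_rfl⟩
    rw [norm_iteratedFDeriv_zero, one_smul, ← sub_eq_add_neg] at this
    simpa using this
  | succ k =>
    refine key (fun v => ∑ i ∈ Finset.range (k + 1), ((i.factorial : ℝ)⁻¹) •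
      iteratedFDeriv ℝ i κ.toFun x fun _ => -(ε • v)) ?_ ?_ fun v hv => ?_
    · refine continuous_finsetSum _ fun i _ => Continuous.const_smul ?_ _
      exact (iteratedFDeriv ℝ i κ.toFun x).cont.comp (by fun_prop)
    · simp_rw [Finset.sum_mul]
      rw [integral_finsetSum]
      · refine Finset.sum_eq_zero fun i hi => ?_
        have h1 : ∀ v, ((i.factorial : ℝ)⁻¹ • iteratedFDeriv ℝ i κ.toFun x fun _ => -(ε • v)) * ψ v =
            ((i.factorial : ℝ)⁻¹ * (-ε) ^ i) •
              ((iteratedFDeriv ℝ i κ.toFun x fun _ => v) * ψ v) := by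
          intro v
          have h2 : (iteratedFDeriv ℝ i κ.toFun x fun _ => -(ε • v)) =
              (-ε) ^ i • iteratedFDeriv ℝ i κ.toFun x fun _ => v := by
            have := (iteratedFDeriv ℝ i κ.toFun x).map_smul_univ (fun _ => -ε) (fun _ => v)
            simp only [neg_smul, Finset.prod_const, Finset.card_univ, Fintype.card_fin] at this
            exact this
          rw [h2, smul_smul, smul_mul_assoc]
        simp_rw [h1]
        rw [integral_smul, integral_multilinear_eq_zero hψ hc hs (Finset.mem_range.1 hi), smul_zero]
      · intro i _
        refine Continuous.integrable_of_hasCompactSupport ?_ hs.mul_left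
        refine (Continuous.const_smul ?_ _).mul hc
        exact (iteratedFDeriv ℝ i κ.toFun x).cont.comp (by fun_prop)
    · have h1 := exists_taylor_bound κ.contDiff k x (-(ε • v)) (hdec v hv)
      rw [← sub_eq_add_neg] at h1
      refine h1.trans (mul_le_mul_of_nonneg_left ?_ (by positivity))
      rw [norm_neg, norm_smul, Real.norm_of_nonneg hε0]
      have := hR v hv
      gcongr

end Moments

/-! ### Kernel estimates -/

namespace UnitKernel

variable {𝕜 : Type*} [RCLike 𝕜] {n : ℕ} (κ : UnitKernel 𝕜 n)

lemma DerivBound.mono {W : EuclideanSpace ℝ (Fin n) → ℝ} (hW : ∀ y, 0 ≤ W y) {i : ℕ} {K K' : ℝ}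
    {θ : EuclideanSpace ℝ (Fin n) → 𝕜} (h : DerivBound i K W θ) (hK : K ≤ K') :
    DerivBound i K' W θ :=
  fun y => (h y).trans (mul_le_mul_of_nonneg_right hK (hW y))

/-- `Q_j` moves mass by multiples of `2^{-j}`, which is short on the scale `2^{-l}` if `l ≤ j`. The
resulting factor is uniform in `l` and `j`. -/
lemma slowlyVarying_expDecay {a : ℝ} (ha : 0 ≤ a) {l j : ℕ} (hlj : l ≤ j)
    (x : EuclideanSpace ℝ (Fin n)) :
    SlowlyVarying (fun z => Real.exp (-(a * 2 ^ l * ‖x - z‖))) (2 * ((2 : ℝ) ^ j)⁻¹ * κ.radius)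
      (Real.exp (a * (2 * κ.radius))) := by
  refine (slowlyVarying_exp (a := a * 2 ^ l) (by positivity) x _).mono le_rfl
    (Real.exp_le_exp.2 ?_)
  have h1 : (2 : ℝ) ^ l * ((2 : ℝ) ^ j)⁻¹ ≤ 1 := by
    rw [← div_eq_mul_inv, div_le_one (by positivity)]
    exact pow_le_pow_right₀ (by norm_num) hlj
  have h2 := κ.radius_nonneg
  calc a * 2 ^ l * (2 * ((2 : ℝ) ^ j)⁻¹ * κ.radius)
      = a * (2 * κ.radius) * ((2 : ℝ) ^ l * ((2 : ℝ) ^ j)⁻¹) := by ring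
    _ ≤ a * (2 * κ.radius) * 1 := by gcongr
    _ = _ := mul_one _

/-- The kernels of `φ_l * Q_j` for `j ≥ l`. -/
lemma exists_Q_diffShift_bound (N : ℕ) {a : ℝ} (ha : 0 ≤ a) : ∃ C, 0 ≤ C ∧
    ∀ (l k : ℕ) (x : EuclideanSpace ℝ (Fin n)),
      DerivBound 0 (C * ((2 : ℝ)⁻¹ ^ (k * N) * 2 ^ (l * n)))
        (fun z => Real.exp (-(a * 2 ^ l * ‖x - z‖)))
        (κ.Q (N + 1) (l + k) (κ.diffShift l x)).1 := by
  obtain ⟨C, hC0, hC⟩ := κ.Q_bound (N + 1) (Real.exp_pos (a * (2 * κ.radius))).le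
  obtain ⟨C₀, hC₀, h₀⟩ := κ.exists_diffShift_bound 0 a
  obtain ⟨C₁, hC₁, h₁⟩ := κ.exists_diffShift_bound N a
  refine ⟨C * (C₀ + C₁), by positivity, fun l k x => ?_⟩
  have hW : ∀ z, 0 ≤ Real.exp (-(a * 2 ^ l * ‖x - z‖)) := fun z => (Real.exp_pos _).le
  have hl : (1 : ℝ) ≤ 2 ^ (l * N) := one_le_two_pow_real _
  -- The `N` derivatives of `φ_l` cost `2^{lN}` and `Q_{l+k}` gains `2^{-(l+k)N}`; the quotient is
  -- `2^{-kN}`.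
  have := hC (l + k) _ ((C₀ + C₁) * (2 ^ (l * n) * 2 ^ (l * N))) le_rfl (by positivity) _
    (κ.slowlyVarying_expDecay ha (Nat.le_add_right l k) x) (κ.diffShift l x)
    (DerivBound.mono hW (h₀ l x) (by
      rw [mul_zero, pow_zero]; gcongr; linarith))
    (DerivBound.mono hW (h₁ l x) (by gcongr; linarith))
  refine DerivBound.mono hW this (le_of_eq ?_)
  rw [Nat.add_sub_cancel, pow_add, mul_inv, mul_pow, inv_pow, ← pow_mul, inv_pow, ← pow_mul,
    inv_pow]
  field_simp

/-- Rescaling to the scale `2^{-j}` exhibits the small parameter `ε = 2^{j-l-1}` of the moment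
estimate. -/
lemma A_diffShift_apply (j l : ℕ) (x z : EuclideanSpace ℝ (Fin n)) :
    (κ.A j (κ.diffShift (l + 1) x)).1 z = (2 : 𝕜) ^ (j * n) *
      ∫ v, κ.toFun ((2 : ℝ) ^ j • (x - z) - ((2 : ℝ) ^ j * (2 ^ (l + 1))⁻¹) • v) *
        differenceKernel κ.toFun v := by
  set ψ := differenceKernel κ.toFun
  rw [A_apply]
  simp only [diffShift_apply, kernel, Nat.succ_ne_zero, if_false]
  have key := Measure.integral_comp_smul (volume : Measure (EuclideanSpace ℝ (Fin n)))
    (fun w => κ.toFun ((2 : ℝ) ^ j • (x - z) - w) *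
      ((2 : 𝕜) ^ ((l + 1) * n) * ψ (((2 : ℝ) ^ (l + 1) * (2 ^ j)⁻¹) • w)))
      ((2 : ℝ) ^ j * (2 ^ (l + 1))⁻¹)
  have hi : (2 : ℝ) ^ j ≠ 0 := by positivity
  have hl : (2 : ℝ) ^ (l + 1) ≠ 0 := by positivity
  have e1 : ∫ w, κ.toFun w * ((2 : 𝕜) ^ ((l + 1) * n) *
      ψ ((2 : ℝ) ^ (l + 1) • (x - (z + ((2 : ℝ) ^ j)⁻¹ • w))))
      = ∫ w, κ.toFun ((2 : ℝ) ^ j • (x - z) - w) *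
      ((2 : 𝕜) ^ ((l + 1) * n) * ψ (((2 : ℝ) ^ (l + 1) * (2 ^ j)⁻¹) • w)) := by
    rw [← integral_sub_left_eq_self (fun w => κ.toFun w * ((2 : 𝕜) ^ ((l + 1) * n) *
      ψ ((2 : ℝ) ^ (l + 1) • (x - (z + ((2 : ℝ) ^ j)⁻¹ • w))))) volume ((2 : ℝ) ^ j • (x - z))]
    congr 1; ext w; congr 3
    rw [mul_smul]
    congr 1
    rw [smul_sub, smul_smul, inv_mul_cancel₀ hi, one_smul]
    abel
  rw [e1]
  rw [eq_comm, abs_of_pos (by positivity), finrank_euclideanSpace, Fintype.card_fin,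
    inv_smul_eq_iff₀ (by positivity)] at key
  rw [key, ← integral_smul, ← integral_const_mul]
  congr 1; ext w
  rw [smul_smul, show (2 : ℝ) ^ (l + 1) * (2 ^ j)⁻¹ * (2 ^ j * (2 ^ (l + 1))⁻¹) = 1 by field_simp,
    one_smul, RCLike.real_smul_eq_coe_mul]
  push_cast
  have h2 : ((2 : 𝕜) ^ (l + 1)) ^ n ≠ 0 := pow_ne_zero _ (pow_ne_zero _ two_ne_zero)
  rw [mul_pow, inv_pow, pow_mul, pow_mul]
  field_simp

lemma contDiff_differenceKernel : ContDiff ℝ ∞ (differenceKernel κ.toFun) :=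
  κ.contDiff.sub (contDiff_const.mul (κ.contDiff.comp (contDiff_const_smul _)))

lemma hasCompactSupport_differenceKernel : HasCompactSupport (differenceKernel κ.toFun) := by
  have h1 : HasCompactSupport fun x => κ.toFun ((2 : ℝ)⁻¹ • x) :=
    κ.hasCompactSupport.comp_smul (by norm_num)
  exact κ.hasCompactSupport.sub h1.mul_left

/-- The kernels of `φ_l * Q_j` for `j < l`. -/
lemma exists_Q_diffShift_bound_of_moments (N : ℕ) {m : ℕ}
    (hm : VanishingMoments m (differenceKernel κ.toFun)) {a : ℝ} (ha : 0 ≤ a) : ∃ C, 0 ≤ C ∧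
    ∀ (j k : ℕ) (x : EuclideanSpace ℝ (Fin n)),
      DerivBound 0 (C * ((2 : ℝ)⁻¹ ^ (k * m) * 2 ^ (j * n)))
        (fun z => Real.exp (-(a * 2 ^ j * ‖x - z‖)))
        (κ.Q N j (κ.diffShift (j + k + 1) x)).1 := by
  obtain ⟨C, hC0, hC⟩ := κ.Q_bound_avg N (Real.exp_pos (a * (2 * κ.radius))).le
  obtain ⟨C₁, hC₁, h₁⟩ := κ.exists_moment_bound hm κ.contDiff_differenceKernel.continuous
    -- The rate is doubled because `A_{j-1}` occurs in `Q_j`: its kernel has scale `2^{-(j-1)}`,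
    -- whereas the weight has scale `2^{-j}`.
    κ.hasCompactSupport_differenceKernel (a := 2 * a) (by positivity)
  refine ⟨C * C₁, by positivity, fun j k x => ?_⟩
  have hA : ∀ i, i ≤ j → j ≤ i + 1 → DerivBound 0 (C₁ * ((2 : ℝ)⁻¹ ^ (k * m) * 2 ^ (j * n)))
      (fun z => Real.exp (-(a * 2 ^ j * ‖x - z‖))) (κ.A i (κ.diffShift (j + k + 1) x)).1 := by
    intro i hij hji z
    rw [norm_iteratedFDeriv_zero, A_diffShift_apply, norm_mul, norm_pow, RCLike.norm_ofNat]
    have hε : (2 : ℝ) ^ i * (2 ^ (j + k + 1))⁻¹ ≤ 2⁻¹ ^ k := by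
      rw [inv_pow, ← div_eq_mul_inv, div_le_iff₀ (by positivity), inv_mul_eq_div,
        le_div_iff₀ (by positivity), ← pow_add]
      exact pow_le_pow_right₀ (by norm_num) (by omega)
    have hk : (2 : ℝ)⁻¹ ^ k ≤ 1 := pow_le_one₀ (by norm_num) (by norm_num)
    have hb := h₁ _ ((2 : ℝ) ^ i • (x - z)) (by positivity) (hε.trans hk)
    have he : Real.exp (-(2 * a * ‖(2 : ℝ) ^ i • (x - z)‖)) ≤
        Real.exp (-(a * 2 ^ j * ‖x - z‖)) := by
      rw [Real.exp_le_exp, neg_le_neg_iff, norm_smul, Real.norm_of_nonneg (by positivity)]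
      have : (2 : ℝ) ^ j ≤ 2 * 2 ^ i := by
        rw [← pow_succ']; exact pow_le_pow_right₀ (by norm_num) hji
      calc a * 2 ^ j * ‖x - z‖ ≤ a * (2 * 2 ^ i) * ‖x - z‖ := by gcongr
        _ = _ := by ring
    calc _ ≤ (2 : ℝ) ^ (i * n) * (C₁ * ((2 : ℝ) ^ i * (2 ^ (j + k + 1))⁻¹) ^ m *
          Real.exp (-(2 * a * ‖(2 : ℝ) ^ i • (x - z)‖))) := by gcongr
      _ ≤ (2 : ℝ) ^ (j * n) * (C₁ * (2⁻¹ ^ k) ^ m * Real.exp (-(a * 2 ^ j * ‖x - z‖))) := by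
        gcongr
        norm_num
      _ = _ := by rw [← pow_mul]; ring
  have := hC j _ _ le_rfl (by positivity) _ (κ.slowlyVarying_expDecay ha le_rfl x)
    (κ.diffShift (j + k + 1) x) (hA j le_rfl (Nat.le_succ j)) (hA (j - 1) (Nat.sub_le _ _) (by omega))
  rwa [← mul_assoc C] at this

lemma enorm_setIntegral_le {G : Set (EuclideanSpace ℝ (Fin n))}
    {f g : EuclideanSpace ℝ (Fin n) → 𝕜} {K a : ℝ} (hK : 0 ≤ K) {l : ℕ}
    {x : EuclideanSpace ℝ (Fin n)}
    (h : DerivBound 0 K (fun z => Real.exp (-(a * 2 ^ l * ‖x - z‖))) g) :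
    ‖∫ y in G, f y * g y‖ₑ ≤ ENNReal.ofReal K * ∫⁻ z in G, ‖f z‖ₑ * expDecay a l x z := by
  refine (enorm_integral_le_lintegral_enorm _).trans ?_
  rw [← lintegral_const_mul' _ _ ENNReal.ofReal_ne_top]
  refine lintegral_mono fun z => ?_
  have := h z
  rw [norm_iteratedFDeriv_zero] at this
  change ‖f z * g z‖ₑ ≤ _
  rw [enorm_mul, mul_left_comm, expDecay, ← ENNReal.ofReal_mul hK]
  gcongr
  rw [← ofReal_norm]
  exact ENNReal.ofReal_le_ofReal this

lemma ofReal_pow_mul_two_pow (C : ℝ) (hC : 0 ≤ C) (i j : ℕ) :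
    ENNReal.ofReal (C * ((2 : ℝ)⁻¹ ^ i * 2 ^ j)) =
      ENNReal.ofReal C * ((2⁻¹ : ℝ≥0∞) ^ i * 2 ^ j) := by
  rw [ENNReal.ofReal_mul hC, ENNReal.ofReal_mul (by positivity),
    ENNReal.ofReal_pow (by norm_num), ENNReal.ofReal_pow (by norm_num),
    ENNReal.ofReal_inv_of_pos (by norm_num)]
  simp

/-- The reproducing formula started at level `l` expresses `φ_l * f` on `G` through the finer
`φ_{l+i} * f` on `G`, with kernels that decay geometrically in `i`. The constant comes from the
kernels alone, hence is the same for all functionals `F` of any order. -/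
lemma Absorbs.exists_selfControlled {κ : UnitKernel 𝕜 n} {G : Set (EuclideanSpace ℝ (Fin n))}
    (hG : κ.Absorbs G) (M a : ℕ) :
    ∃ C : ℝ≥0, ∀ (N : ℕ) (F : JetSpace 𝕜 n N →L[𝕜] 𝕜),
      SelfControlled G C M a fun l y => ‖κ.coeff F l y‖ₑ := by
  have ha : (0 : ℝ) ≤ a := Nat.cast_nonneg a
  obtain ⟨C₁, hC₁, h₁⟩ := κ.exists_Q_diffShift_bound M ha
  obtain ⟨C₂, hC₂, h₂⟩ := κ.A_geom_bound (M + 1) (Real.exp_pos (a * (2 * κ.radius))).le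
  obtain ⟨C₃, hC₃, h₃⟩ := κ.exists_dilate_bound 0 (a : ℝ)
  refine ⟨(C₁ + C₂ * C₃).toNNReal, fun N F l y hy => ?_⟩
  have hlim := (hG.tendsto_coeff F (Nat.le_add_left 1 M) l hy).enorm
  refine le_of_tendsto hlim (Filter.Eventually.of_forall fun m => ?_)
  have hcast : ((C₁ + C₂ * C₃).toNNReal : ℝ≥0∞) = ENNReal.ofReal (C₁ + C₂ * C₃) := rfl
  set T : ℕ → ℝ≥0∞ := fun i => (2⁻¹ : ℝ≥0∞) ^ (i * M) *
    expMean G (fun l y => ‖κ.coeff F l y‖ₑ) 1 a (l + i) l y with hT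
  have hterm : ∀ (i : ℕ) (g : EuclideanSpace ℝ (Fin n) → 𝕜) (D : ℝ), 0 ≤ D → D ≤ C₁ + C₂ * C₃ →
      DerivBound 0 (D * ((2 : ℝ)⁻¹ ^ (i * M) * 2 ^ (l * n)))
        (fun z => Real.exp (-(a * 2 ^ l * ‖y - z‖))) g →
      ‖∫ z in G, κ.coeff F (l + i) z * g z‖ₑ ≤ ENNReal.ofReal (C₁ + C₂ * C₃) * T i := by
    intro i g D hD hD' hg
    refine (enorm_setIntegral_le (by positivity) hg).trans ?_
    rw [ofReal_pow_mul_two_pow D hD]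
    simp only [hT, expMean, ENNReal.rpow_one, mul_assoc]
    gcongr
  refine (enorm_add_le _ _).trans ?_
  have hsum := (enorm_sum_le (Finset.range m) fun i => ∫ z in G, κ.coeff F (l + i + 1) z *
    (κ.Q (M + 1) (l + i + 1) (κ.diffShift l y)).1 z).trans
    (Finset.sum_le_sum fun i _ => hterm (i + 1) _ C₁ hC₁
      (le_add_of_nonneg_right (mul_nonneg hC₂ hC₃)) (h₁ l (i + 1) y))
  have h0 := hterm 0 _ (C₂ * C₃) (mul_nonneg hC₂ hC₃) (le_add_of_nonneg_left hC₁) (by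
    have := (h₂ l _ le_rfl).2 _ (κ.slowlyVarying_expDecay ha le_rfl y) 0 _ (κ.shift l y)
      (by positivity) (h₃ l y)
    simpa [mul_assoc] using this)
  rw [hcast]
  refine (add_le_add h0 hsum).trans ?_
  rw [add_comm, ← Finset.sum_range_succ' fun i => ENNReal.ofReal (C₁ + C₂ * C₃) * T i,
    ← Finset.mul_sum]
  gcongr
  exact ENNReal.sum_le_tsum _

end UnitKernel

/-! ### Norms of nonnegative functions -/

section LpTools

variable {α ι : Type*} {mα : MeasurableSpace α} {μ : Measure α} {u : ℝ≥0∞}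

lemma eLpNorm_rpow_toReal (hu0 : u ≠ 0) (hu : u ≠ ⊤) (f : α → ℝ≥0∞) :
    eLpNorm f u μ ^ u.toReal = ∫⁻ x, f x ^ u.toReal ∂μ := by
  rw [eLpNorm_eq_lintegral_rpow_enorm_toReal hu0 hu, ← ENNReal.rpow_mul,
    one_div_mul_cancel (ENNReal.toReal_pos hu0 hu).ne', ENNReal.rpow_one]
  simp

/-- Minkowski's inequality for finite sums and monotone convergence along the directed family of
finite subsets. -/
lemma eLpNorm_tsum_le [Countable ι] {f : ι → α → ℝ≥0∞} (hf : ∀ i, AEMeasurable (f i) μ)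
    (hu : 1 ≤ u) : eLpNorm (fun x => ∑' i, f i x) u μ ≤ ∑' i, eLpNorm (f i) u μ := by
  have hu0 : u ≠ 0 := (zero_lt_one.trans_le hu).ne'
  rcases eq_or_ne u ⊤ with rfl | hut
  · simp only [eLpNorm_exponent_top, eLpNormEssSup, enorm_eq_self]
    refine essSup_le_of_ae_le _ ?_
    filter_upwards [ae_all_iff.2 fun i => ENNReal.ae_le_essSup (μ := μ) (f i)] with x hx
    exact ENNReal.tsum_le_tsum hx
  · have hpos := ENNReal.toReal_pos hu0 hut
    rw [← ENNReal.rpow_le_rpow_iff hpos, eLpNorm_rpow_toReal hu0 hut]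
    have h1 : ∀ x, (∑' i, f i x) ^ u.toReal =
        ⨆ s : Finset ι, (∑ i ∈ s, f i x) ^ u.toReal := fun x => by
      rw [ENNReal.tsum_eq_iSup_sum]
      exact (ENNReal.orderIsoRpow u.toReal hpos).map_iSup _
    simp_rw [h1]
    rw [lintegral_iSup_directed
      (fun s => (Finset.aemeasurable_fun_sum s fun i _ => hf i).pow_const _)
      (directed_of_isDirected_le fun s s' hs x => by
        dsimp only
        gcongr)]
    refine iSup_le fun s => ?_
    rw [← eLpNorm_rpow_toReal hu0 hut (fun x => ∑ i ∈ s, f i x)]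
    refine ENNReal.rpow_le_rpow ?_ hpos.le
    have h2 := eLpNorm_sum_le (s := s) (f := f) (fun i _ => (hf i).aestronglyMeasurable) hu
    have h3 : (∑ i ∈ s, f i) = fun x => ∑ i ∈ s, f i x := by ext x; simp
    rw [h3] at h2
    exact h2.trans (ENNReal.sum_le_tsum s)

lemma eLpNorm_const_mul_le (c : ℝ≥0∞) {f : α → ℝ≥0∞} (hf : AEMeasurable f μ) :
    eLpNorm (fun x => c * f x) u μ ≤ c * eLpNorm f u μ :=
  eLpNorm_le_mul_eLpNorm_of_ae_le_mul'' u hf.aestronglyMeasurable (by simp)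

lemma eLpNorm_mono_ennreal {f g : α → ℝ≥0∞} (h : ∀ x, f x ≤ g x) :
    eLpNorm f u μ ≤ eLpNorm g u μ :=
  eLpNorm_mono_enorm_ae (Filter.Eventually.of_forall fun x => by simpa using h x)

/-- Passing to powers replaces the exponent `u` by `u / r ≥ 1`, where Minkowski's inequality is
available even if `u < 1`. -/
lemma eLpNorm_rpow {ε : Type*} [TopologicalSpace ε] [ContinuousENorm ε] (f : α → ε) {r : ℝ≥0∞}
    (hr0 : r ≠ 0) (hr : r ≠ ⊤) :
    eLpNorm (fun x => ‖f x‖ₑ ^ r.toReal) (u / r) μ = eLpNorm f u μ ^ r.toReal := by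
  rw [eLpNorm_enorm_rpow f (ENNReal.toReal_pos hr0 hr), ENNReal.ofReal_toReal hr,
    ENNReal.div_mul_cancel hr0 hr]

section Count

variable [MeasurableSpace ι] [MeasurableSingletonClass ι]

lemma eLpNorm_count_comp_le {κ : Type*} [MeasurableSpace κ] [MeasurableSingletonClass κ]
    {e : κ → ι} (he : Function.Injective e) (b : ι → ℝ≥0∞) :
    eLpNorm (fun k => b (e k)) u Measure.count ≤ eLpNorm b u Measure.count := by
  rcases eq_or_ne u 0 with rfl | hu0
  · simp
  rcases eq_or_ne u ⊤ with rfl | hut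
  · simp only [eLpNorm_exponent_top, eLpNormEssSup_count, enorm_eq_self]
    exact iSup_comp_le b e
  · rw [← ENNReal.rpow_le_rpow_iff (ENNReal.toReal_pos hu0 hut), eLpNorm_rpow_toReal hu0 hut,
      eLpNorm_rpow_toReal hu0 hut, lintegral_count, lintegral_count]
    exact ENNReal.tsum_comp_le_tsum_of_injective he fun i => b i ^ u.toReal

/-- The norm of a function in terms of the norms over the members of a countable partition. -/
lemma eLpNorm_eq_eLpNorm_count [Countable ι] (hu : u ≠ 0) {e : α → ι} (he : Measurable e)
    (f : α → ℝ≥0∞) :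
    eLpNorm f u μ = eLpNorm (fun i => eLpNorm f u (μ.restrict (e ⁻¹' {i}))) u Measure.count := by
  have hU : (⋃ i, e ⁻¹' {i}) = Set.univ := by
    rw [← Set.preimage_iUnion, Set.iUnion_of_singleton, Set.preimage_univ]
  rcases eq_or_ne u ⊤ with rfl | hut
  · simp only [eLpNorm_exponent_top, eLpNormEssSup_count, enorm_eq_self]
    refine le_antisymm ?_ (iSup_le fun i => eLpNormEssSup_mono_measure _
      Measure.restrict_le_self.absolutelyContinuous)
    simp only [eLpNormEssSup, enorm_eq_self]
    refine essSup_le_of_ae_le _ ?_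
    rw [← Measure.restrict_univ (μ := μ), ← hU]
    refine (ae_restrict_iUnion_iff _ _).2 fun i => ?_
    filter_upwards [ENNReal.ae_le_essSup (μ := μ.restrict (e ⁻¹' {i})) f] with x hx
    rw [hU, Measure.restrict_univ]
    exact hx.trans (le_iSup (fun i => essSup f (μ.restrict (e ⁻¹' {i}))) i)
  · refine ENNReal.rpow_left_injective (ENNReal.toReal_pos hu hut).ne' ?_
    dsimp only
    rw [eLpNorm_rpow_toReal hu hut, eLpNorm_rpow_toReal hu hut, lintegral_count]
    simp_rw [eLpNorm_rpow_toReal hu hut]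
    rw [← lintegral_iUnion (fun i => he (measurableSet_singleton i)) (fun i j hij =>
      Disjoint.preimage e (Set.disjoint_singleton.2 hij)), hU, Measure.restrict_univ]

/-- Schur's test for convolutions on a countable group. -/
lemma eLpNorm_count_conv_le [Countable ι] [AddCommGroup ι] (hu : 1 ≤ u) (c b : ι → ℝ≥0∞) :
    eLpNorm (fun m => ∑' m', c (m - m') * b m') u Measure.count ≤
      (∑' d, c d) * eLpNorm b u Measure.count := by
  have h1 : ∀ m, ∑' m', c (m - m') * b m' = ∑' d, c d * b (m - d) := fun m => by
    rw [← (Equiv.subLeft m).tsum_eq]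
    simp
  simp_rw [h1]
  have hm : ∀ g : ι → ℝ≥0∞, AEMeasurable g Measure.count := fun g =>
    (measurable_of_countable g).aemeasurable
  refine (eLpNorm_tsum_le (fun d => hm _) hu).trans ?_
  rw [← ENNReal.tsum_mul_right]
  refine ENNReal.tsum_le_tsum fun d => (eLpNorm_const_mul_le (c d) (hm _)).trans ?_
  exact mul_le_mul_right (eLpNorm_count_comp_le (sub_left_injective (b := d)) b) _

end Count

lemma lqNorm_eq_eLpNorm {q : ℝ≥0∞} (hq : q ≠ 0) (a : ℕ → ℝ≥0∞) :
    lqNorm q a = eLpNorm a q Measure.count := by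
  rw [lqNorm]
  split_ifs with h
  · simp [h]
  · rw [eLpNorm_eq_lintegral_rpow_enorm_toReal hq h, lintegral_count]
    simp

end LpTools

/-! ### Lattice sums and dyadic cubes -/

section Cubes

variable {n : ℕ}

/-- The `ℓ₁` norm on `ℤ^n`. -/
def latticeNorm (m : Fin n → ℤ) : ℕ := ∑ i, (m i).natAbs

lemma tsum_int_ne_top : ∑' z : ℤ, (2⁻¹ : ℝ≥0∞) ^ z.natAbs ≠ ⊤ := by
  have h1 : Summable fun z : ℤ => ((2 : ℝ)⁻¹) ^ z.natAbs := by
    have h2 : Summable fun k : ℕ => ((2 : ℝ)⁻¹) ^ k :=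
      summable_geometric_of_lt_one (by norm_num) (by norm_num)
    refine Summable.of_nat_of_neg ?_ ?_ <;> simpa using h2
  have h3 := h1.tsum_ofReal_ne_top
  refine ne_of_eq_of_ne (tsum_congr fun z => ?_) h3
  rw [ENNReal.ofReal_pow (by norm_num), ENNReal.ofReal_inv_of_pos (by norm_num)]
  simp

lemma tsum_half_pow_latticeNorm_ne_top :
    ∑' m : Fin n → ℤ, (2⁻¹ : ℝ≥0∞) ^ latticeNorm m ≠ ⊤ := by
  induction n with
  | zero => simp [latticeNorm, tsum_fintype]
  | succ n ih =>
    rw [← (Fin.consEquiv fun _ : Fin (n + 1) => ℤ).tsum_eq]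
    have h1 : ∀ c : ℤ × (Fin n → ℤ), (2⁻¹ : ℝ≥0∞) ^ latticeNorm
        (Fin.consEquiv (fun _ : Fin (n + 1) => ℤ) c) =
        (2⁻¹ : ℝ≥0∞) ^ c.1.natAbs * (2⁻¹ : ℝ≥0∞) ^ latticeNorm c.2 := fun c => by
      rw [← pow_add, latticeNorm, Fin.sum_univ_succ]
      simp [latticeNorm, Fin.consEquiv]
    simp_rw [h1]
    rw [ENNReal.tsum_prod (f := fun (a : ℤ) (b : Fin n → ℤ) =>
      (2⁻¹ : ℝ≥0∞) ^ a.natAbs * (2⁻¹ : ℝ≥0∞) ^ latticeNorm b)]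
    simp_rw [ENNReal.tsum_mul_left, ENNReal.tsum_mul_right]
    exact ENNReal.mul_ne_top tsum_int_ne_top ih

/-- The index of the (half-open) dyadic cube of rank `k` containing `x`. -/
def cubeIndex (k : ℕ) (x : EuclideanSpace ℝ (Fin n)) : Fin n → ℤ := fun i => ⌊(2 : ℝ) ^ k * x i⌋

lemma measurable_cubeIndex (k : ℕ) :
    Measurable (cubeIndex k : EuclideanSpace ℝ (Fin n) → Fin n → ℤ) := by
  refine measurable_pi_lambda _ fun i => Int.measurable_floor.comp ?_
  exact (measurable_const.mul (by fun_prop))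

lemma cubeIndex_preimage_subset (k : ℕ) (m : Fin n → ℤ) :
    cubeIndex k ⁻¹' {m} ⊆ (dyadicCube k m : Set (EuclideanSpace ℝ (Fin n))) := by
  rintro x hx i
  have h1 : ⌊(2 : ℝ) ^ k * x i⌋ = m i := congrFun hx i
  have h2 := Int.floor_le ((2 : ℝ) ^ k * x i)
  have h3 := (Int.lt_floor_add_one ((2 : ℝ) ^ k * x i)).le
  rw [h1] at h2 h3
  have h4 : (0 : ℝ) < 2 ^ k := by positivity
  rw [div_le_iff₀ h4, le_div_iff₀ h4, mul_comm (x i)]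
  exact ⟨h2, h3⟩

lemma natAbs_floor_sub_le (a b : ℝ) : (((⌊a⌋ - ⌊b⌋).natAbs : ℕ) : ℝ) ≤ |a - b| + 1 := by
  rw [Nat.cast_natAbs, Int.cast_abs, Int.cast_sub, abs_le]
  have h1 := Int.floor_le a
  have h2 := (Int.lt_floor_add_one a).le
  have h3 := Int.floor_le b
  have h4 := (Int.lt_floor_add_one b).le
  have h5 := neg_abs_le (a - b)
  have h6 := le_abs_self (a - b)
  constructor <;> linarith

lemma latticeNorm_cubeIndex_sub_le (k : ℕ) (x z : EuclideanSpace ℝ (Fin n)) :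
    (latticeNorm (cubeIndex k x - cubeIndex k z) : ℝ) ≤ n * (2 ^ k * ‖x - z‖) + n := by
  rw [latticeNorm]
  push_cast
  calc ∑ i, (((cubeIndex k x - cubeIndex k z) i).natAbs : ℝ)
      ≤ ∑ _i : Fin n, (2 ^ k * ‖x - z‖ + 1) := by
        refine Finset.sum_le_sum fun i _ => (natAbs_floor_sub_le _ _).trans ?_
        gcongr
        rw [← mul_sub, abs_mul, abs_of_pos (by positivity)]
        gcongr
        have := PiLp.norm_apply_le (x - z) i
        rwa [PiLp.sub_apply, Real.norm_eq_abs] at this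
    _ = _ := by
        rw [Finset.sum_const, Finset.card_univ, Fintype.card_fin, nsmul_eq_mul]; ring

/-- The lattice distance of the cubes is at most `n 2^k |x - z| + n`, and `exp(-1) ≤ 1/2`.
Continuous decay thus becomes geometric decay over the lattice. -/
lemma expDecay_le_half_pow (B k : ℕ) (x z : EuclideanSpace ℝ (Fin n)) :
    expDecay ((n : ℝ) * B) k x z ≤ ENNReal.ofReal (Real.exp (n * B)) *
      (2⁻¹ : ℝ≥0∞) ^ (B * latticeNorm (cubeIndex k x - cubeIndex k z)) := by
  set L := latticeNorm (cubeIndex k x - cubeIndex k z)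
  have h1 := latticeNorm_cubeIndex_sub_le k x z
  have h2 : Real.exp (-((n : ℝ) * B * 2 ^ k * ‖x - z‖)) ≤
      Real.exp (n * B) * (2 : ℝ)⁻¹ ^ (B * L) := by
    have h3 : Real.exp (-1) ≤ (2 : ℝ)⁻¹ := by
      rw [Real.exp_neg]
      gcongr
      have := Real.add_one_le_exp (1 : ℝ)
      linarith
    calc _ ≤ Real.exp (n * B + ((B * L : ℕ) : ℝ) * -1) := by
          refine Real.exp_le_exp.2 ?_
          have := mul_le_mul_of_nonneg_left h1 (Nat.cast_nonneg (α := ℝ) B)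
          push_cast
          linarith
      _ = Real.exp (n * B) * Real.exp (-1) ^ (B * L) := by
          rw [Real.exp_add, Real.exp_nat_mul (-1) (B * L)]
      _ ≤ _ := by gcongr
  refine (ENNReal.ofReal_le_ofReal h2).trans (le_of_eq ?_)
  rw [ENNReal.ofReal_mul (Real.exp_pos _).le, ENNReal.ofReal_pow (by norm_num),
    ENNReal.ofReal_inv_of_pos (by norm_num)]
  simp

variable (n) in
/-- Lebesgue measure, normalised so that the cubes of rank `k` have measure `1`. -/
def cubeMeasure (k : ℕ) : Measure (EuclideanSpace ℝ (Fin n)) := (2 : ℝ≥0∞) ^ (k * n) • volume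

lemma cubeMean_eq (r : ℝ≥0∞) (k : ℕ) (m : Fin n → ℤ) (g : EuclideanSpace ℝ (Fin n) → ℝ) :
    cubeMean r k m g = eLpNorm g r ((cubeMeasure n k).restrict (dyadicCube k m)) := by
  rw [cubeMean, cubeMeasure, Measure.restrict_smul]

lemma eLpNorm_cubeMeasure {ε : Type*} [TopologicalSpace ε] [ContinuousENorm ε] (k : ℕ)
    (f : EuclideanSpace ℝ (Fin n) → ε) (u : ℝ≥0∞) :
    eLpNorm f u (cubeMeasure n k) = ((2 : ℝ≥0∞) ^ (k * n)) ^ (1 / u).toReal * eLpNorm f u volume :=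
  eLpNorm_smul_measure_of_ne_zero (by simp) f u volume

lemma cubeMeasure_dyadicCube (k : ℕ) (m : Fin n → ℤ) :
    cubeMeasure n k (dyadicCube k m) = 1 := by
  have h1 : (dyadicCube k m : Set (EuclideanSpace ℝ (Fin n))) = WithLp.ofLp ⁻¹'
      Set.Icc (fun i => (m i : ℝ) / 2 ^ k) (fun i => ((m i : ℝ) + 1) / 2 ^ k) := by
    ext x
    simp only [dyadicCube, Set.mem_ofPred_eq, Set.mem_preimage, Set.mem_Icc, Pi.le_def]
    exact forall_and
  have h2 : ∀ i, ((m i : ℝ) + 1) / 2 ^ k - (m i : ℝ) / 2 ^ k = ((2 : ℝ) ^ k)⁻¹ := fun i => by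
    field_simp; ring
  rw [cubeMeasure, Measure.smul_apply, h1, (PiLp.volume_preserving_ofLp (Fin n)).measure_preimage
    measurableSet_Icc.nullMeasurableSet, Real.volume_Icc_pi]
  simp_rw [h2]
  rw [Finset.prod_const, Finset.card_univ, Fintype.card_fin,
    ENNReal.ofReal_inv_of_pos (by positivity), ENNReal.ofReal_pow (by norm_num)]
  simp only [ENNReal.ofReal_ofNat, smul_eq_mul]
  rw [pow_mul, ← mul_pow, ENNReal.mul_inv_cancel (by simp) (by simp), one_pow]

lemma cubeMeasure_restrict_le (k : ℕ) (m : Fin n → ℤ) :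
    (cubeMeasure n k).restrict (cubeIndex k ⁻¹' {m}) ≤
      (cubeMeasure n k).restrict (dyadicCube k m) :=
  Measure.restrict_mono (cubeIndex_preimage_subset k m) le_rfl

lemma cubeMeasure_restrict_univ_le (k : ℕ) (m : Fin n → ℤ) :
    (cubeMeasure n k).restrict (cubeIndex k ⁻¹' {m}) Set.univ ≤ 1 := by
  rw [Measure.restrict_apply_univ]
  exact (measure_mono (cubeIndex_preimage_subset k m)).trans (cubeMeasure_dyadicCube k m).le

lemma eLpNorm_le_of_exponent_le {α ε : Type*} {mα : MeasurableSpace α} [TopologicalSpace ε]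
    [ContinuousENorm ε] {μ : Measure α} (hμ : μ Set.univ ≤ 1) {p q : ℝ≥0∞} (hpq : p ≤ q)
    {f : α → ε} (hf : AEStronglyMeasurable f μ) : eLpNorm f p μ ≤ eLpNorm f q μ := by
  rcases eq_or_ne p 0 with rfl | hp
  · simp
  refine (eLpNorm_le_eLpNorm_mul_rpow_measure_univ hpq hf).trans (mul_le_of_le_one_right zero_le ?_)
  refine ENNReal.rpow_le_one hμ ?_
  rw [sub_nonneg]
  rcases eq_or_ne q ⊤ with rfl | hq
  · simp
  · have := ENNReal.toReal_mono hq hpq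
    exact one_div_le_one_div_of_le (ENNReal.toReal_pos hp (ne_top_of_le_ne_top hq hpq)) this

lemma lintegral_eq_tsum_cubes (k : ℕ) (f : EuclideanSpace ℝ (Fin n) → ℝ≥0∞)
    (μ : Measure (EuclideanSpace ℝ (Fin n))) :
    ∫⁻ z, f z ∂μ = ∑' m, ∫⁻ z in cubeIndex k ⁻¹' {m}, f z ∂μ := by
  have hU : (⋃ m, cubeIndex k ⁻¹' {m}) = (Set.univ : Set (EuclideanSpace ℝ (Fin n))) := by
    rw [← Set.preimage_iUnion, Set.iUnion_of_singleton, Set.preimage_univ]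
  rw [← lintegral_iUnion (fun m => measurable_cubeIndex k (measurableSet_singleton m))
    (fun i j hij => Disjoint.preimage _ (Set.disjoint_singleton.2 hij)), hU, Measure.restrict_univ]

/-- Exponentially weighted integrals are bounded by weighted sums over the cubes. -/
lemma lintegral_expDecay_le (B k : ℕ) (g : EuclideanSpace ℝ (Fin n) → ℝ≥0∞)
    (x : EuclideanSpace ℝ (Fin n)) :
    ∫⁻ z, g z * expDecay ((n : ℝ) * B) k x z ∂(cubeMeasure n k) ≤
      ENNReal.ofReal (Real.exp (n * B)) * ∑' m, (2⁻¹ : ℝ≥0∞) ^ (B * latticeNorm (cubeIndex k x - m)) *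
        ∫⁻ z in cubeIndex k ⁻¹' {m}, g z ∂(cubeMeasure n k) := by
  rw [lintegral_eq_tsum_cubes k, ← ENNReal.tsum_mul_left]
  refine ENNReal.tsum_le_tsum fun m => ?_
  rw [← mul_assoc, ← lintegral_const_mul' _ _ (ENNReal.mul_ne_top ENNReal.ofReal_ne_top
    (ENNReal.pow_ne_top (by simp)))]
  refine setLIntegral_mono' (measurable_cubeIndex k (measurableSet_singleton m)) fun z hz => ?_
  have hz' : cubeIndex k z = m := hz
  rw [mul_comm]
  have := expDecay_le_half_pow B k x z
  rw [hz'] at this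
  gcongr

/-- The integrals of the exponential weights are bounded uniformly in the scale. -/
lemma exists_lintegral_expDecay_le : ∃ C : ℝ≥0, ∀ (k : ℕ) (x : EuclideanSpace ℝ (Fin n)),
    2 ^ (k * n) * ∫⁻ z, expDecay n k x z ≤ C := by
  refine ⟨(ENNReal.ofReal (Real.exp n) *
    ∑' m : Fin n → ℤ, (2⁻¹ : ℝ≥0∞) ^ latticeNorm m).toNNReal, fun k x => ?_⟩
  rw [ENNReal.coe_toNNReal (ENNReal.mul_ne_top ENNReal.ofReal_ne_top
    tsum_half_pow_latticeNorm_ne_top)]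
  have h1 := lintegral_expDecay_le 1 k (fun _ => 1) x
  simp only [Nat.cast_one, mul_one, one_mul, lintegral_const] at h1
  rw [cubeMeasure, lintegral_smul_measure, smul_eq_mul] at h1
  refine h1.trans (mul_le_mul_right ?_ _)
  rw [← (Equiv.subLeft (cubeIndex k x)).tsum_eq]
  refine ENNReal.tsum_le_tsum fun m => ?_
  simp only [Equiv.subLeft_apply, sub_sub_cancel]
  exact mul_le_of_le_one_right zero_le (cubeMeasure_restrict_univ_le k _)

end Cubes

/-! ### Weighted estimates -/

section Lattice

variable {n : ℕ}

lemma abs_le_latticeNorm (m : Fin n → ℤ) (i : Fin n) : |m i| ≤ latticeNorm m := by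
  rw [Int.abs_eq_natAbs]
  exact_mod_cast Finset.single_le_sum (f := fun i => (m i).natAbs) (fun _ _ => Nat.zero_le _)
    (Finset.mem_univ i)

lemma latticeNorm_add_le (m m' : Fin n → ℤ) :
    latticeNorm (m + m') ≤ latticeNorm m + latticeNorm m' := by
  rw [latticeNorm, latticeNorm, latticeNorm, ← Finset.sum_add_distrib]
  exact Finset.sum_le_sum fun i _ => Int.natAbs_add_le _ _

lemma latticeNorm_neg (m : Fin n → ℤ) : latticeNorm (-m) = latticeNorm m := by
  simp [latticeNorm]

/-- Walking from `m'` towards `m` with a simultaneous unit step in every coordinate reaches `m` in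
`K` steps, as the distance is measured in the maximum norm. -/
lemma le_pow_mul_of_neighbours {w : (Fin n → ℤ) → ℝ≥0∞} {c : ℝ≥0∞}
    (h : ∀ m m' : Fin n → ℤ, (∀ i, |m i - m' i| ≤ 1) → w m ≤ c * w m') (K : ℕ)
    (m m' : Fin n → ℤ) (hm : ∀ i, |m i - m' i| ≤ K) : w m ≤ c ^ K * w m' := by
  induction K generalizing m' with
  | zero =>
    have : m = m' := funext fun i => by
      have := hm i
      rw [Nat.cast_zero, abs_nonpos_iff] at this
      omega
    simp [this]
  | succ K ih =>
    have h1 := ih (fun i => m' i + (m i - m' i).sign) fun i => by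
      have := hm i
      push_cast at this
      rw [abs_le] at this ⊢
      rcases lt_trichotomy (m i - m' i) 0 with h | h | h
      · rw [Int.sign_eq_neg_one_of_neg h]; omega
      · rw [h, Int.sign_zero]; omega
      · rw [Int.sign_eq_one_of_pos h]; omega
    have h2 := h (fun i => m' i + (m i - m' i).sign) m' fun i => by
      rw [add_sub_cancel_left, abs_le]
      rcases lt_trichotomy (m i - m' i) 0 with h | h | h
      · rw [Int.sign_eq_neg_one_of_neg h]; omega
      · rw [h, Int.sign_zero]; omega
      · rw [Int.sign_eq_one_of_pos h]; omega
    calc w m ≤ c ^ K * (c * w m') := h1.trans (by gcongr)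
      _ = c ^ (K + 1) * w m' := by rw [pow_succ]; ring

end Lattice

/-! ### Weighted estimates for exponentially weighted means. -/

namespace WeightClass

variable {𝕜 : Type*} [RCLike 𝕜] {n : ℕ} {p σ₁ σ₂ : ℝ≥0∞} {α₁ α₂ α₃ : ℝ}
  {t : ℕ → EuclideanSpace ℝ (Fin n) → ℝ}

lemma cubeMean_eq_mul_cubeNorm (k : ℕ) (m : Fin n → ℤ) :
    cubeMean p k m (t k) = ((2 : ℝ≥0∞) ^ (k * n)) ^ (1 / p).toReal * cubeNorm p t k m :=
  eLpNorm_smul_measure_of_ne_zero (by simp) _ _ _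

lemma two_pow_rpow_ne_zero (k : ℕ) (s : ℝ) : ((2 : ℝ≥0∞) ^ k) ^ s ≠ 0 :=
  (ENNReal.rpow_pos (pos_iff_ne_zero.2 (by simp)) (by simp)).ne'

lemma two_pow_rpow_ne_top (k : ℕ) {s : ℝ} (hs : 0 ≤ s) : ((2 : ℝ≥0∞) ^ k) ^ s ≠ ⊤ :=
  ENNReal.rpow_ne_top_of_nonneg hs (by simp)

variable (ht : WeightClass p σ₁ σ₂ α₁ α₂ α₃ t)
include ht

lemma cubeMean_ne_zero (k : ℕ) (m : Fin n → ℤ) : cubeMean p k m (t k) ≠ 0 := by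
  rw [cubeMean_eq_mul_cubeNorm]
  exact mul_ne_zero (two_pow_rpow_ne_zero _ _) (ht.neighbour k m m (by simp)).1.ne'

lemma cubeMean_ne_top (k : ℕ) (m : Fin n → ℤ) : cubeMean p k m (t k) ≠ ⊤ := by
  rw [cubeMean_eq_mul_cubeNorm]
  refine ENNReal.mul_ne_top (two_pow_rpow_ne_top _ ENNReal.toReal_nonneg) ?_
  have hc : IsCompact (dyadicCube k m : Set (EuclideanSpace ℝ (Fin n))) := by
    have h1 : (dyadicCube k m : Set (EuclideanSpace ℝ (Fin n))) =
        (EuclideanSpace.equiv (Fin n) ℝ).symm '' Set.Icc (fun i => (m i : ℝ) / 2 ^ k)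
          (fun i => ((m i : ℝ) + 1) / 2 ^ k) := by
      rw [ContinuousLinearEquiv.image_symm_eq_preimage]
      ext x
      simp only [dyadicCube, Set.mem_ofPred_eq, Set.mem_preimage, Set.mem_Icc, Pi.le_def]
      exact forall_and
    rw [h1]
    exact isCompact_Icc.image (EuclideanSpace.equiv (Fin n) ℝ).symm.continuous
  exact (ht.admissible.memLp k _ hc).2.ne

lemma cubeMean_le {B : ℕ} (hB : α₃ ≤ B) (k : ℕ) (m m' : Fin n → ℤ) :
    cubeMean p k m (t k) ≤ 2 ^ (B * latticeNorm (m - m')) * cubeMean p k m' (t k) := by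
  have h1 : ∀ m m' : Fin n → ℤ, (∀ i, |m i - m' i| ≤ 1) →
      cubeMean p k m (t k) ≤ 2 ^ B * cubeMean p k m' (t k) := fun m m' h => by
    rw [cubeMean_eq_mul_cubeNorm, cubeMean_eq_mul_cubeNorm, mul_left_comm]
    refine mul_le_mul_right ((ht.neighbour k m m' h).2.trans (mul_le_mul_left ?_ _)) _
    have : ENNReal.ofReal (2 ^ α₃) ≤ ENNReal.ofReal (2 ^ (B : ℝ)) :=
      ENNReal.ofReal_le_ofReal (Real.rpow_le_rpow_of_exponent_le (by norm_num) hB)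
    refine this.trans (le_of_eq ?_)
    rw [Real.rpow_natCast, ENNReal.ofReal_pow (by norm_num), ENNReal.ofReal_ofNat]
  rw [pow_mul]
  exact le_pow_mul_of_neighbours h1 _ m m' fun i => abs_le_latticeNorm (m - m') i

lemma aestronglyMeasurable (k : ℕ) : AEStronglyMeasurable (t k) volume :=
  (ht.admissible.aemeasurable k).aestronglyMeasurable

omit ht in
lemma absolutelyContinuous_cubeMeasure (k : ℕ) (s : Set (EuclideanSpace ℝ (Fin n))) :
    (cubeMeasure n k).restrict s ≪ volume :=
  Measure.restrict_le_self.absolutelyContinuous.trans Measure.smul_absolutelyContinuous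

/-- Hölder's inequality on a dyadic cube. -/
lemma exists_lintegral_cube_le {r : ℝ≥0∞} (hr0 : r ≠ 0) (hr1 : r ≤ 1)
    (hr : r ≤ (p⁻¹ + σ₁⁻¹)⁻¹) : ∃ C : ℝ≥0, ∀ k j : ℕ, k ≤ j → ∀ (m : Fin n → ℤ)
      (h : EuclideanSpace ℝ (Fin n) → 𝕜), AEStronglyMeasurable h volume →
      ∫⁻ z in cubeIndex k ⁻¹' {m}, ‖h z‖ₑ ^ r.toReal ∂(cubeMeasure n k) ≤
        (C * ENNReal.ofReal (2 ^ (α₁ * ((k : ℝ) - j))) * (cubeMean p k m (t k))⁻¹ *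
          eLpNorm (fun x => t j x • h x) p
            ((cubeMeasure n k).restrict (cubeIndex k ⁻¹' {m}))) ^ r.toReal := by
  obtain ⟨C₁, hC₁, hlow⟩ := ht.lower
  have hrt : r ≠ ⊤ := ne_top_of_le_ne_top ENNReal.one_ne_top hr1
  refine ⟨C₁.toNNReal, fun k j hkj m h hh => ?_⟩
  set ν := (cubeMeasure n k).restrict (cubeIndex k ⁻¹' {m})
  have hac : ν ≪ volume := absolutelyContinuous_cubeMeasure k _
  have e1 : ∫⁻ z, ‖h z‖ₑ ^ r.toReal ∂ν = eLpNorm h r ν ^ r.toReal := by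
    rw [eLpNorm_eq_lintegral_rpow_enorm_toReal hr0 hrt, ← ENNReal.rpow_mul,
      one_div_mul_cancel (ENNReal.toReal_pos hr0 hrt).ne', ENNReal.rpow_one]
  rw [e1]
  refine ENNReal.rpow_le_rpow ?_ ENNReal.toReal_nonneg
  refine (eLpNorm_le_of_exponent_le (cubeMeasure_restrict_univ_le k m) hr
    (hh.mono_ac hac)).trans ?_
  have htj := (ht.aestronglyMeasurable j).mono_ac hac
  -- Inserting `t_j^{-1} t_j` splits `h` for Hölder's inequality with exponents `σ₁` and `p`.
  have e2 : h =ᵐ[ν] (fun x => (t j x)⁻¹) • fun x => t j x • h x := by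
    filter_upwards [hac.ae_le (ht.admissible.pos j)] with x hx
    simp [smul_smul, inv_mul_cancel₀ hx.ne']
  have : ENNReal.HolderTriple σ₁ p (p⁻¹ + σ₁⁻¹)⁻¹ := ⟨by rw [inv_inv, add_comm]⟩
  rw [eLpNorm_congr_ae e2]
  refine (eLpNorm_smul_le_mul_eLpNorm (p := σ₁) (q := p) (htj.smul (hh.mono_ac hac))
    htj.aemeasurable.inv.aestronglyMeasurable).trans (mul_le_mul_left ?_ _)
  have e3 : eLpNorm (fun x => (t j x)⁻¹) σ₁ ν ≤ cubeMean σ₁ k m fun x => (t j x)⁻¹ := by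
    rw [cubeMean_eq]
    exact eLpNorm_mono_measure _ (cubeMeasure_restrict_le k m)
  refine e3.trans ?_
  rw [← div_eq_mul_inv, ENNReal.le_div_iff_mul_le (Or.inl (ht.cubeMean_ne_zero k m))
    (Or.inl (ht.cubeMean_ne_top k m)), mul_comm]
  refine (hlow k j hkj m).trans (le_of_eq ?_)
  rw [ENNReal.ofReal_mul hC₁.le]
  rfl

/-- The normalised cube has measure one, so `p ≤ σ₂` bounds the `L_p` mean by the `L_{σ₂}` mean,
which the second weight condition controls. -/
lemma exists_eLpNorm_cube_le (hσ : p ≤ σ₂) : ∃ C : ℝ≥0, ∀ k j : ℕ, k ≤ j → ∀ m : Fin n → ℤ,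
    eLpNorm (t j) p ((cubeMeasure n k).restrict (cubeIndex k ⁻¹' {m})) ≤
      C * ENNReal.ofReal (2 ^ (α₂ * ((j : ℝ) - k))) * cubeMean p k m (t k) := by
  obtain ⟨C₂, hC₂, hup⟩ := ht.upper
  refine ⟨C₂.toNNReal, fun k j hkj m => ?_⟩
  have hac := absolutelyContinuous_cubeMeasure k (cubeIndex k ⁻¹' {m})
  refine (eLpNorm_le_of_exponent_le (cubeMeasure_restrict_univ_le k m) hσ
    ((ht.aestronglyMeasurable j).mono_ac hac)).trans ?_
  have e3 : eLpNorm (t j) σ₂ ((cubeMeasure n k).restrict (cubeIndex k ⁻¹' {m})) ≤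
      cubeMean σ₂ k m (t j) := by
    rw [cubeMean_eq]
    exact eLpNorm_mono_measure _ (cubeMeasure_restrict_le k m)
  refine e3.trans ?_
  have h1 := hup k j hkj m
  rw [mul_comm, ← div_eq_mul_inv, ENNReal.div_le_iff (ht.cubeMean_ne_zero k m)
    (ht.cubeMean_ne_top k m), ENNReal.ofReal_mul hC₂.le] at h1
  exact h1

set_option maxHeartbeats 1000000 in
/-- The weighted norm of exponentially weighted means. -/
lemma exists_eLpNorm_expDecay_le {r : ℝ≥0∞} (hr0 : r ≠ 0) (hr1 : r ≤ 1)
    (hr : r ≤ (p⁻¹ + σ₁⁻¹)⁻¹) (hσ : p ≤ σ₂) {B : ℕ} (hB : α₃ ≤ B) :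
    ∃ C : ℝ≥0, ∀ l j k : ℕ, l ≤ j → l ≤ k → ∀ (h : EuclideanSpace ℝ (Fin n) → 𝕜),
      AEStronglyMeasurable h volume →
      eLpNorm (fun x => ‖t k x‖ₑ ^ r.toReal * (2 ^ (l * n) *
        ∫⁻ z, ‖h z‖ₑ ^ r.toReal * expDecay ((n : ℝ) * (B + 1 : ℕ)) l x z)) (p / r) volume ≤
      C * (ENNReal.ofReal (2 ^ (α₁ * ((l : ℝ) - j))) *
        ENNReal.ofReal (2 ^ (α₂ * ((k : ℝ) - l)))) ^ r.toReal *
        eLpNorm (fun x => t j x • h x) p volume ^ r.toReal := by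
  obtain ⟨C₁, h₁⟩ := ht.exists_lintegral_cube_le (𝕜 := 𝕜) hr0 hr1 hr
  obtain ⟨C₂, h₂⟩ := ht.exists_eLpNorm_cube_le hσ
  have hrt : r ≠ ⊤ := ne_top_of_le_ne_top ENNReal.one_ne_top hr1
  set s := r.toReal with hs
  have hs0 : 0 ≤ s := ENNReal.toReal_nonneg
  have hs1 : s ≤ 1 := by
    have := ENNReal.toReal_mono ENNReal.one_ne_top hr1
    simpa using this
  have hrp : r ≤ p := hr.trans (by
    rw [ENNReal.inv_le_iff_inv_le]; exact le_self_add)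
  have hu : 1 ≤ p / r := by
    rw [ENNReal.le_div_iff_mul_le (Or.inl hr0) (Or.inl hrt), one_mul]; exact hrp
  have hu0 : p / r ≠ 0 := (zero_lt_one.trans_le hu).ne'
  set Λ : ℝ≥0∞ := ∑' m : Fin n → ℤ, (2⁻¹ : ℝ≥0∞) ^ latticeNorm m
  set e : ℝ≥0∞ := ENNReal.ofReal (Real.exp (n * (B + 1 : ℕ)))
  have hfin : e * ((C₁ * C₂ : ℝ≥0∞) ^ s * Λ) ≠ ⊤ :=
    ENNReal.mul_ne_top ENNReal.ofReal_ne_top (ENNReal.mul_ne_top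
      (ENNReal.rpow_ne_top_of_nonneg hs0 (ENNReal.mul_ne_top ENNReal.coe_ne_top
        ENNReal.coe_ne_top)) tsum_half_pow_latticeNorm_ne_top)
  refine ⟨(e * ((C₁ * C₂ : ℝ≥0∞) ^ s * Λ)).toNNReal, fun l j k hlj hlk h hh => ?_⟩
  rw [ENNReal.coe_toNNReal hfin]
  set d₁ := ENNReal.ofReal (2 ^ (α₁ * ((l : ℝ) - j)))
  set d₂ := ENNReal.ofReal (2 ^ (α₂ * ((k : ℝ) - l)))
  set w : (Fin n → ℤ) → ℝ≥0∞ := fun m => cubeMean p l m (t l) with hw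
  set ν : (Fin n → ℤ) → Measure (EuclideanSpace ℝ (Fin n)) := fun m =>
    (cubeMeasure n l).restrict (cubeIndex l ⁻¹' {m}) with hν
  set g : EuclideanSpace ℝ (Fin n) → ℝ≥0∞ := fun x => ‖t j x • h x‖ₑ ^ s with hg
  set T : EuclideanSpace ℝ (Fin n) → ℝ≥0∞ := fun x => ‖t k x‖ₑ ^ s * (2 ^ (l * n) *
    ∫⁻ z, ‖h z‖ₑ ^ s * expDecay ((n : ℝ) * (B + 1 : ℕ)) l x z) with hT
  have hgp : ∀ μ : Measure (EuclideanSpace ℝ (Fin n)),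
      eLpNorm (fun x => t j x • h x) p μ ^ s = eLpNorm g (p / r) μ := fun μ =>
    (eLpNorm_rpow _ hr0 hrt).symm
  -- The weights of the cubes `m` and `m'` differ at most by `2^{B|m-m'|}`. Of the decay with
  -- exponent `B + 1` a summable factor `2^{-|m-m'|}` survives.
  have hterm : ∀ m m', (2⁻¹ : ℝ≥0∞) ^ ((B + 1) * latticeNorm (m - m')) *
      (∫⁻ z, ‖h z‖ₑ ^ s ∂(ν m')) * ((C₂ : ℝ≥0∞) * d₂ * w m) ^ s ≤
      ((C₁ : ℝ≥0∞) * C₂ * (d₁ * d₂)) ^ s *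
        ((2⁻¹ : ℝ≥0∞) ^ latticeNorm (m - m') * eLpNorm g (p / r) (ν m')) := by
    intro m m'
    rw [← hgp]
    set β := eLpNorm (fun x => t j x • h x) p (ν m')
    set L := latticeNorm (m - m')
    have hww : (w m')⁻¹ * w m ≤ 2 ^ (B * L) := by
      rw [mul_comm, ← div_eq_mul_inv, ENNReal.div_le_iff (ht.cubeMean_ne_zero l m')
        (ht.cubeMean_ne_top l m')]
      exact ht.cubeMean_le hB l m m'
    have hpow : ((2 : ℝ≥0∞) ^ (B * L)) ^ s ≤ 2 ^ (B * L) := by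
      calc ((2 : ℝ≥0∞) ^ (B * L)) ^ s ≤ ((2 : ℝ≥0∞) ^ (B * L)) ^ (1 : ℝ) :=
            ENNReal.rpow_le_rpow_of_exponent_le (one_le_pow₀ (by norm_num)) hs1
        _ = _ := ENNReal.rpow_one _
    calc _ ≤ (2⁻¹ : ℝ≥0∞) ^ ((B + 1) * L) * ((C₁ : ℝ≥0∞) * d₁ * (w m')⁻¹ * β) ^ s *
          ((C₂ : ℝ≥0∞) * d₂ * w m) ^ s := by
          gcongr
          exact h₁ l j hlj m' h hh
      _ = (2⁻¹ : ℝ≥0∞) ^ ((B + 1) * L) * (((C₁ : ℝ≥0∞) * C₂ * (d₁ * d₂)) ^ s *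
          ((w m')⁻¹ * w m) ^ s * β ^ s) := by
          rw [mul_assoc, ← ENNReal.mul_rpow_of_nonneg _ _ hs0, ← ENNReal.mul_rpow_of_nonneg _ _ hs0,
            ← ENNReal.mul_rpow_of_nonneg _ _ hs0]
          ring_nf
      _ ≤ (2⁻¹ : ℝ≥0∞) ^ ((B + 1) * L) * (((C₁ : ℝ≥0∞) * C₂ * (d₁ * d₂)) ^ s * 2 ^ (B * L) * β ^ s) := by
          gcongr
          exact (ENNReal.rpow_le_rpow hww hs0).trans hpow
      _ = ((2⁻¹ : ℝ≥0∞) ^ (B * L) * 2 ^ (B * L)) * (((C₁ : ℝ≥0∞) * C₂ * (d₁ * d₂)) ^ s *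
          ((2⁻¹ : ℝ≥0∞) ^ L * β ^ s)) := by rw [add_mul, one_mul, pow_add]; ring
      _ = _ := by rw [← mul_pow, ENNReal.inv_mul_cancel (by simp) (by simp), one_pow, one_mul]
  -- On one cube of rank `l` the mean is bounded by a constant `S`, so only the norm of `t_k` over
  -- the cube remains.
  have hcube : ∀ m, eLpNorm T (p / r) (ν m) ≤ e * ((C₁ : ℝ≥0∞) * C₂ * (d₁ * d₂)) ^ s *
      ∑' m', (2⁻¹ : ℝ≥0∞) ^ latticeNorm (m - m') * eLpNorm g (p / r) (ν m') := by
    intro m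
    set S := e * ∑' m', (2⁻¹ : ℝ≥0∞) ^ ((B + 1) * latticeNorm (m - m')) *
      ∫⁻ z, ‖h z‖ₑ ^ s ∂(ν m')
    have htk := (ht.aestronglyMeasurable k).mono_ac (absolutelyContinuous_cubeMeasure l
      (cubeIndex l ⁻¹' {m}))
    have a1 : eLpNorm T (p / r) (ν m) ≤ S * eLpNorm (fun x => ‖t k x‖ₑ ^ s) (p / r) (ν m) := by
      refine eLpNorm_le_mul_eLpNorm_of_ae_le_mul'' _
        (htk.enorm.pow_const s).aestronglyMeasurable ?_
      refine ae_restrict_of_forall_mem (measurable_cubeIndex l (measurableSet_singleton m))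
        fun x hx => ?_
      have hx' : cubeIndex l x = m := hx
      simp only [enorm_eq_self, hT]
      rw [mul_comm]
      refine mul_le_mul_left ?_ _
      have := lintegral_expDecay_le (B + 1) l (fun z => ‖h z‖ₑ ^ s) x
      rw [hx'] at this
      refine le_trans (le_of_eq ?_) this
      rw [cubeMeasure, lintegral_smul_measure, smul_eq_mul]
    have a2 : eLpNorm (fun x => ‖t k x‖ₑ ^ s) (p / r) (ν m) ≤ ((C₂ : ℝ≥0∞) * d₂ * w m) ^ s := by
      rw [eLpNorm_rpow _ hr0 hrt]
      exact ENNReal.rpow_le_rpow (h₂ l k hlk m) hs0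
    calc _ ≤ S * ((C₂ : ℝ≥0∞) * d₂ * w m) ^ s := a1.trans (by gcongr)
      _ = e * ∑' m', (2⁻¹ : ℝ≥0∞) ^ ((B + 1) * latticeNorm (m - m')) *
          (∫⁻ z, ‖h z‖ₑ ^ s ∂(ν m')) * ((C₂ : ℝ≥0∞) * d₂ * w m) ^ s := by
          rw [ENNReal.tsum_mul_right, mul_assoc]
      _ ≤ e * ∑' m', ((C₁ : ℝ≥0∞) * C₂ * (d₁ * d₂)) ^ s *
        ((2⁻¹ : ℝ≥0∞) ^ latticeNorm (m - m') * eLpNorm g (p / r) (ν m')) := by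
          exact mul_le_mul_right (ENNReal.tsum_le_tsum (hterm m)) _
      _ = _ := by rw [ENNReal.tsum_mul_left]; ring
  have hV : eLpNorm T (p / r) (cubeMeasure n l) ≤
      e * ((C₁ : ℝ≥0∞) * C₂ * (d₁ * d₂)) ^ s * (Λ * eLpNorm g (p / r) (cubeMeasure n l)) := by
    rw [eLpNorm_eq_eLpNorm_count hu0 (measurable_cubeIndex l) T,
      eLpNorm_eq_eLpNorm_count hu0 (measurable_cubeIndex l) g]
    refine (eLpNorm_mono_ennreal hcube).trans ?_
    refine (eLpNorm_const_mul_le _ (measurable_of_countable _).aemeasurable).trans ?_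
    exact mul_le_mul_right (eLpNorm_count_conv_le hu (fun d => (2⁻¹ : ℝ≥0∞) ^ latticeNorm d)
      fun m => eLpNorm g (p / r) (ν m)) _
  rw [hgp]
  rw [eLpNorm_cubeMeasure, eLpNorm_cubeMeasure] at hV
  -- The normalisation of the measure contributes the same factor on both sides and cancels.
  rw [← ENNReal.mul_le_mul_iff_right (two_pow_rpow_ne_zero (l * n) (1 / (p / r)).toReal)
    (two_pow_rpow_ne_top _ ENNReal.toReal_nonneg)]
  refine hV.trans (le_of_eq ?_)
  rw [ENNReal.mul_rpow_of_nonneg _ _ hs0]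
  ring

/-- Pointwise growth of exponentially weighted means. -/
lemma exists_expDecay_growth {r : ℝ≥0∞} (hr0 : r ≠ 0) (hr1 : r ≤ 1)
    (hr : r ≤ (p⁻¹ + σ₁⁻¹)⁻¹) {B : ℕ} (hB : α₃ ≤ B) :
    ∃ (C : ℝ≥0) (A : ℕ), ∀ (j : ℕ) (h : EuclideanSpace ℝ (Fin n) → 𝕜),
      AEStronglyMeasurable h volume → ∀ x : EuclideanSpace ℝ (Fin n),
      ∫⁻ z, ‖h z‖ₑ ^ r.toReal * expDecay ((n : ℝ) * (B + 1 : ℕ)) 0 x z ≤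
      C * 2 ^ (j * A) * ENNReal.ofReal (Real.exp (A * ‖x‖)) *
        eLpNorm (fun x => t j x • h x) p volume ^ r.toReal := by
  obtain ⟨C₁, h₁⟩ := ht.exists_lintegral_cube_le (𝕜 := 𝕜) hr0 hr1 hr
  have hrt : r ≠ ⊤ := ne_top_of_le_ne_top ENNReal.one_ne_top hr1
  set s := r.toReal with hs
  have hs0 : 0 ≤ s := ENNReal.toReal_nonneg
  have hs1 : s ≤ 1 := by
    have := ENNReal.toReal_mono ENNReal.one_ne_top hr1
    simpa using this
  set Λ : ℝ≥0∞ := ∑' m : Fin n → ℤ, (2⁻¹ : ℝ≥0∞) ^ latticeNorm m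
  set e : ℝ≥0∞ := ENNReal.ofReal (Real.exp (n * (B + 1 : ℕ)))
  set w : (Fin n → ℤ) → ℝ≥0∞ := fun m => cubeMean p 0 m (t 0) with hw
  obtain ⟨A₁, hA₁⟩ := exists_nat_ge |α₁|
  set D := e * (((C₁ : ℝ≥0∞) * (w 0)⁻¹) ^ s * (2 ^ (B * n) * Λ))
  have hD : D ≠ ⊤ :=
    ENNReal.mul_ne_top ENNReal.ofReal_ne_top (ENNReal.mul_ne_top
      (ENNReal.rpow_ne_top_of_nonneg hs0 (ENNReal.mul_ne_top ENNReal.coe_ne_top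
        (ENNReal.inv_ne_top.2 (ht.cubeMean_ne_zero 0 0))))
      (ENNReal.mul_ne_top (by simp) tsum_half_pow_latticeNorm_ne_top))
  refine ⟨D.toNNReal, A₁ + B * n, fun j h hh x => ?_⟩
  rw [ENNReal.coe_toNNReal hD]
  set b := eLpNorm (fun x => t j x • h x) p volume
  set L₀ := latticeNorm (cubeIndex 0 x)
  have hd : ENNReal.ofReal (2 ^ (α₁ * (((0 : ℕ) : ℝ) - j))) ^ s ≤ 2 ^ (j * A₁) := by
    have h2 : ENNReal.ofReal (2 ^ (α₁ * (((0 : ℕ) : ℝ) - j))) ≤ 2 ^ (j * A₁) := by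
      calc _ ≤ ENNReal.ofReal (2 ^ ((j * A₁ : ℕ) : ℝ)) := by
            refine ENNReal.ofReal_le_ofReal (Real.rpow_le_rpow_of_exponent_le (by norm_num) ?_)
            push_cast
            have := neg_abs_le α₁
            nlinarith [Nat.cast_nonneg (α := ℝ) j]
        _ = _ := by rw [Real.rpow_natCast, ENNReal.ofReal_pow (by norm_num), ENNReal.ofReal_ofNat]
    calc _ ≤ ((2 : ℝ≥0∞) ^ (j * A₁)) ^ s := ENNReal.rpow_le_rpow h2 hs0
      _ ≤ ((2 : ℝ≥0∞) ^ (j * A₁)) ^ (1 : ℝ) :=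
          ENNReal.rpow_le_rpow_of_exponent_le (one_le_pow₀ (by norm_num)) hs1
      _ = _ := ENNReal.rpow_one _
  have hexp : (2 : ℝ≥0∞) ^ (B * L₀) ≤
      2 ^ (B * n) * ENNReal.ofReal (Real.exp ((B * n : ℕ) * ‖x‖)) := by
    have h1 := latticeNorm_cubeIndex_sub_le 0 x 0
    have h0 : cubeIndex 0 (0 : EuclideanSpace ℝ (Fin n)) = 0 := by
      ext i; simp [cubeIndex]
    rw [h0, sub_zero, sub_zero, pow_zero, one_mul] at h1
    calc (2 : ℝ≥0∞) ^ (B * L₀) = ENNReal.ofReal (2 ^ ((B * L₀ : ℕ) : ℝ)) := by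
          rw [Real.rpow_natCast, ENNReal.ofReal_pow (by norm_num), ENNReal.ofReal_ofNat]
      _ ≤ ENNReal.ofReal (2 ^ ((B * n : ℕ) : ℝ) * Real.exp ((B * n : ℕ) * ‖x‖)) := by
          refine ENNReal.ofReal_le_ofReal ?_
          have h2 : (2 : ℝ) ^ ((B * n : ℕ) * ‖x‖) ≤ Real.exp ((B * n : ℕ) * ‖x‖) := by
            rw [← Real.exp_one_rpow]
            refine Real.rpow_le_rpow (by norm_num) ?_ (by positivity)
            have := Real.add_one_le_exp (1 : ℝ)
            linarith
          refine le_trans ?_ (mul_le_mul_of_nonneg_left h2 (by positivity))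
          rw [← Real.rpow_add (by norm_num)]
          refine Real.rpow_le_rpow_of_exponent_le (by norm_num) ?_
          have := mul_le_mul_of_nonneg_left h1 (Nat.cast_nonneg (α := ℝ) B)
          push_cast
          linarith
      _ = _ := by
          rw [ENNReal.ofReal_mul (by positivity), Real.rpow_natCast,
            ENNReal.ofReal_pow (by norm_num), ENNReal.ofReal_ofNat]
  have hterm : ∀ m, (2⁻¹ : ℝ≥0∞) ^ ((B + 1) * latticeNorm (cubeIndex 0 x - m)) *
      ∫⁻ z in cubeIndex 0 ⁻¹' {m}, ‖h z‖ₑ ^ s ∂(cubeMeasure n 0) ≤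
      ((C₁ : ℝ≥0∞) * (w 0)⁻¹) ^ s * 2 ^ (j * A₁) * b ^ s * 2 ^ (B * L₀) *
        (2⁻¹ : ℝ≥0∞) ^ latticeNorm (cubeIndex 0 x - m) := by
    intro m
    set L := latticeNorm (cubeIndex 0 x - m)
    -- All cubes are compared with the cube at the origin. The path through the cube of `x` costs
    -- `2^{B L₀}`, which becomes the exponential growth in `|x|`, and `2^{B L}`, which the decay
    -- absorbs.
    have hww : (w m)⁻¹ ≤ (w 0)⁻¹ * 2 ^ (B * (L₀ + L)) := by
      have e1 := ht.cubeMean_le hB 0 0 m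
      have e2 : latticeNorm (0 - m) ≤ L₀ + L := by
        have : (0 - m) = -cubeIndex 0 x + (cubeIndex 0 x - m) := by abel
        rw [this]
        refine (latticeNorm_add_le _ _).trans ?_
        rw [latticeNorm_neg]
      have e3 : w 0 ≤ 2 ^ (B * (L₀ + L)) * w m := e1.trans (mul_le_mul_left
        (pow_le_pow_right₀ (by norm_num) (Nat.mul_le_mul_left B e2)) _)
      rw [mul_comm, ← div_eq_mul_inv, ENNReal.le_div_iff_mul_le
        (Or.inl (ht.cubeMean_ne_zero 0 0)) (Or.inl (ht.cubeMean_ne_top 0 0)), mul_comm,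
        ← div_eq_mul_inv, ENNReal.div_le_iff (ht.cubeMean_ne_zero 0 m)
        (ht.cubeMean_ne_top 0 m)]
      exact e3
    have hpow : ((2 : ℝ≥0∞) ^ (B * (L₀ + L))) ^ s ≤ 2 ^ (B * (L₀ + L)) := by
      calc ((2 : ℝ≥0∞) ^ (B * (L₀ + L))) ^ s ≤ ((2 : ℝ≥0∞) ^ (B * (L₀ + L))) ^ (1 : ℝ) :=
            ENNReal.rpow_le_rpow_of_exponent_le (one_le_pow₀ (by norm_num)) hs1
        _ = _ := ENNReal.rpow_one _
    have hβ : eLpNorm (fun x => t j x • h x) p ((cubeMeasure n 0).restrict (cubeIndex 0 ⁻¹' {m}))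
        ≤ b := by
      have : cubeMeasure n 0 = volume := by simp [cubeMeasure]
      rw [this]
      exact eLpNorm_mono_measure _ Measure.restrict_le_self
    calc _ ≤ (2⁻¹ : ℝ≥0∞) ^ ((B + 1) * L) * ((C₁ : ℝ≥0∞) * ENNReal.ofReal (2 ^ (α₁ * (((0 : ℕ) : ℝ) - j))) *
          ((w 0)⁻¹ * 2 ^ (B * (L₀ + L))) * b) ^ s := by
          gcongr
          refine (h₁ 0 j (Nat.zero_le j) m h hh).trans (ENNReal.rpow_le_rpow ?_ hs0)
          gcongr
      _ = (2⁻¹ : ℝ≥0∞) ^ ((B + 1) * L) * (((C₁ : ℝ≥0∞) * (w 0)⁻¹) ^ s *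
          ENNReal.ofReal (2 ^ (α₁ * (((0 : ℕ) : ℝ) - j))) ^ s *
          (2 ^ (B * (L₀ + L))) ^ s * b ^ s) := by
          rw [← ENNReal.mul_rpow_of_nonneg _ _ hs0, ← ENNReal.mul_rpow_of_nonneg _ _ hs0,
            ← ENNReal.mul_rpow_of_nonneg _ _ hs0]
          ring_nf
      _ ≤ (2⁻¹ : ℝ≥0∞) ^ ((B + 1) * L) * (((C₁ : ℝ≥0∞) * (w 0)⁻¹) ^ s * 2 ^ (j * A₁) *
          2 ^ (B * (L₀ + L)) * b ^ s) := by gcongr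
      _ = ((2⁻¹ : ℝ≥0∞) ^ (B * L) * 2 ^ (B * L)) * (((C₁ : ℝ≥0∞) * (w 0)⁻¹) ^ s * 2 ^ (j * A₁) * b ^ s *
          2 ^ (B * L₀) * (2⁻¹ : ℝ≥0∞) ^ L) := by rw [add_mul, one_mul, pow_add, mul_add, pow_add]; ring
      _ = _ := by rw [← mul_pow, ENNReal.inv_mul_cancel (by simp) (by simp), one_pow, one_mul]
  have h3 := lintegral_expDecay_le (B + 1) 0 (fun z => ‖h z‖ₑ ^ s) x
  have e0 : cubeMeasure n 0 = volume := by simp [cubeMeasure]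
  have h4 : ∑' m, (2⁻¹ : ℝ≥0∞) ^ latticeNorm (cubeIndex 0 x - m) = Λ := by
    rw [← (Equiv.subLeft (cubeIndex 0 x)).tsum_eq]
    simp [Λ]
  calc _ ≤ e * ∑' m, (2⁻¹ : ℝ≥0∞) ^ ((B + 1) * latticeNorm (cubeIndex 0 x - m)) *
      ∫⁻ z in cubeIndex 0 ⁻¹' {m}, ‖h z‖ₑ ^ s ∂(cubeMeasure n 0) := by rw [e0] at h3 ⊢; exact h3
    _ ≤ e * ∑' m, ((C₁ : ℝ≥0∞) * (w 0)⁻¹) ^ s * 2 ^ (j * A₁) * b ^ s * 2 ^ (B * L₀) *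
        (2⁻¹ : ℝ≥0∞) ^ latticeNorm (cubeIndex 0 x - m) :=
        mul_le_mul_right (ENNReal.tsum_le_tsum hterm) _
    _ = e * (((C₁ : ℝ≥0∞) * (w 0)⁻¹) ^ s * 2 ^ (j * A₁) * b ^ s * 2 ^ (B * L₀) * Λ) := by
        rw [ENNReal.tsum_mul_left, h4]
    _ ≤ e * (((C₁ : ℝ≥0∞) * (w 0)⁻¹) ^ s * 2 ^ (j * (A₁ + B * n)) * b ^ s *
        (2 ^ (B * n) * ENNReal.ofReal (Real.exp ((A₁ + B * n : ℕ) * ‖x‖))) * Λ) := by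
        gcongr
        · norm_num
        · exact Nat.le_add_right _ _
        · refine hexp.trans ?_
          gcongr
          exact Nat.le_add_left _ _
    _ = _ := by ring

end WeightClass

/-! ### The extension operator -/

section Extension

variable {𝕜 : Type*} [RCLike 𝕜] {n : ℕ}

lemma Se.derivBound_seSeminorm (θ : Se 𝕜 n) {N i : ℕ} (hi : i ≤ N) :
    DerivBound i (seSeminorm 𝕜 n N θ) (fun y => Real.exp (-(N * ‖0 - y‖))) θ.1 := by
  intro y
  have h1 : expWeight N θ.1 y ≤ seSeminorm 𝕜 n N θ := le_ciSup (θ.2.2 N) y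
  change _ ≤ _ * Real.exp (-(N * ‖0 - y‖))
  rw [zero_sub, norm_neg, Real.exp_neg, ← div_eq_mul_inv, le_div_iff₀ (Real.exp_pos _), mul_comm]
  refine le_trans ?_ h1
  unfold expWeight
  gcongr
  exact Finset.single_le_sum (f := fun i => ‖iteratedFDeriv ℝ i θ.1 y‖)
    (fun _ _ => norm_nonneg _) (Finset.mem_range.2 (Nat.lt_succ_of_le hi))

lemma withSeminorms_seSeminorm : WithSeminorms (seSeminorm 𝕜 n) := ⟨rfl⟩

lemma integrable_exp_neg_norm :
    Integrable fun y : EuclideanSpace ℝ (Fin n) => Real.exp (-(n * ‖y‖)) := by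
  obtain ⟨C, hC⟩ := exists_lintegral_expDecay_le (n := n)
  refine ⟨by fun_prop, ?_⟩
  have h1 := hC 0 0
  rw [zero_mul, pow_zero, one_mul] at h1
  refine (lt_of_le_of_lt ?_ (ENNReal.coe_lt_top (r := C)))
  refine le_trans (le_of_eq (lintegral_congr fun y => ?_)) h1
  rw [expDecay, Real.enorm_of_nonneg (Real.exp_pos _).le, pow_zero, mul_one, zero_sub, norm_neg]

namespace UnitKernel

variable {κ : UnitKernel 𝕜 n} {N : ℕ} {F : JetSpace 𝕜 n N →L[𝕜] 𝕜}
  {G : Set (EuclideanSpace ℝ (Fin n))}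

variable (κ F G) in
/-- The convolutions grow at most exponentially on `G`, with rate `A`. -/
def GrowthOn (A : ℕ) : Prop :=
  ∃ C : ℝ, 0 ≤ C ∧ ∀ j, ∀ y ∈ G, ‖κ.coeff F j y‖ ≤ C * (2 : ℝ) ^ (j * A) * Real.exp (A * ‖y‖)

variable {A R : ℕ}

/-- `Q_j` gains `2^{-jR}` and keeps the decay `exp(-R|y|)` of `θ`. Since `R ≥ A + n + 1`, the growth
of rate `A` is compensated, with `2^{-j}` left to sum over `j` and `exp(-n|y|)` left to integrate.
-/
lemma GrowthOn.exists_bound (h : κ.GrowthOn F G A) (hR : A + n + 1 ≤ R) : ∃ C : ℝ, 0 ≤ C ∧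
    ∀ (θ : Se 𝕜 n) (j : ℕ), ∀ y ∈ G, ‖κ.coeff F j y * (κ.Q (R + 1) j θ).1 y‖ ≤
      C * seSeminorm 𝕜 n R θ * (2 : ℝ)⁻¹ ^ j * Real.exp (-(n * ‖y‖)) := by
  obtain ⟨C₁, hC₁, h₁⟩ := h
  obtain ⟨C₂, hC₂, h₂⟩ := κ.Q_bound (R + 1) (Real.exp_pos (R * (2 * κ.radius))).le
  refine ⟨C₁ * C₂, by positivity, fun θ j y hy => ?_⟩
  set K := seSeminorm 𝕜 n R θ
  have hK : 0 ≤ K := apply_nonneg _ _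
  have hρ : 2 * ((2 : ℝ) ^ j)⁻¹ * κ.radius ≤ 2 * κ.radius := by
    have h2 := κ.radius_nonneg
    have : ((2 : ℝ) ^ j)⁻¹ ≤ 1 := inv_le_one_of_one_le₀ (one_le_two_pow_real j)
    gcongr
    linarith
  have h3 := h₂ j _ K hρ hK _ (slowlyVarying_exp (Nat.cast_nonneg R) 0 (2 * κ.radius)) θ
    (θ.derivBound_seSeminorm (Nat.zero_le R)) (θ.derivBound_seSeminorm le_rfl) y
  rw [norm_iteratedFDeriv_zero, Nat.add_sub_cancel, zero_sub, norm_neg] at h3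
  rw [norm_mul]
  have e1 : (2 : ℝ) ^ (j * A) * ((2 : ℝ) ^ j)⁻¹ ^ R ≤ 2⁻¹ ^ j := by
    have h4 : ((2 : ℝ) ^ j)⁻¹ ^ R ≤ ((2 : ℝ) ^ j)⁻¹ ^ (A + 1) :=
      pow_le_pow_of_le_one (by positivity) (inv_le_one_of_one_le₀ (one_le_two_pow_real j))
        (by omega)
    calc _ ≤ (2 : ℝ) ^ (j * A) * ((2 : ℝ) ^ j)⁻¹ ^ (A + 1) := by gcongr
      _ = 2⁻¹ ^ j := by rw [pow_mul, pow_succ, inv_pow, inv_pow]; field_simp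
  have e2 : Real.exp (A * ‖y‖) * Real.exp (-(R * ‖y‖)) ≤ Real.exp (-(n * ‖y‖)) := by
    rw [← Real.exp_add, Real.exp_le_exp]
    have : (A : ℝ) + n + 1 ≤ R := by exact_mod_cast hR
    nlinarith [norm_nonneg y]
  calc _ ≤ C₁ * (2 : ℝ) ^ (j * A) * Real.exp (A * ‖y‖) *
        (C₂ * (((2 : ℝ) ^ j)⁻¹ ^ R * K) * Real.exp (-(R * ‖y‖))) :=
        mul_le_mul (h₁ j y hy) h3 (norm_nonneg _) (by positivity)
    _ = C₁ * C₂ * K * ((2 : ℝ) ^ (j * A) * ((2 : ℝ) ^ j)⁻¹ ^ R) *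
        (Real.exp (A * ‖y‖) * Real.exp (-(R * ‖y‖))) := by ring
    _ ≤ _ := by gcongr

lemma GrowthOn.integrableOn (h : κ.GrowthOn F G A) (hG : MeasurableSet G) (hR : A + n + 1 ≤ R)
    (θ : Se 𝕜 n) (j : ℕ) :
    IntegrableOn (fun y => κ.coeff F j y * (κ.Q (R + 1) j θ).1 y) G := by
  obtain ⟨C, hC, hb⟩ := h.exists_bound hR
  refine Integrable.mono' (integrable_exp_neg_norm.integrableOn.const_mul
    (C * seSeminorm 𝕜 n R θ * (2 : ℝ)⁻¹ ^ j)) ?_ (ae_restrict_of_forall_mem hG (hb θ j))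
  exact ((κ.continuous_coeff F j).mul (κ.Q (R + 1) j θ).contDiff.continuous).aestronglyMeasurable

lemma GrowthOn.exists_norm_setIntegral_le (h : κ.GrowthOn F G A) (hG : MeasurableSet G)
    (hR : A + n + 1 ≤ R) : ∃ C : ℝ, 0 ≤ C ∧ ∀ (θ : Se 𝕜 n) (j : ℕ),
      ‖∫ y in G, κ.coeff F j y * (κ.Q (R + 1) j θ).1 y‖ ≤
        C * seSeminorm 𝕜 n R θ * (2 : ℝ)⁻¹ ^ j := by
  obtain ⟨C, hC, hb⟩ := h.exists_bound hR
  have hI : 0 ≤ ∫ y in G, Real.exp (-(n * ‖y‖)) := integral_nonneg fun _ => (Real.exp_pos _).le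
  refine ⟨C * ∫ y in G, Real.exp (-(n * ‖y‖)), by positivity, fun θ j => ?_⟩
  refine (norm_integral_le_of_norm_le (integrable_exp_neg_norm.integrableOn.const_mul
    (C * seSeminorm 𝕜 n R θ * (2 : ℝ)⁻¹ ^ j)) (ae_restrict_of_forall_mem hG (hb θ j))).trans
    (le_of_eq ?_)
  rw [integral_const_mul]
  ring

lemma GrowthOn.summable (h : κ.GrowthOn F G A) (hG : MeasurableSet G) (hR : A + n + 1 ≤ R)
    (θ : Se 𝕜 n) : Summable fun j => ∫ y in G, κ.coeff F j y * (κ.Q (R + 1) j θ).1 y := by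
  obtain ⟨C, hC, hb⟩ := h.exists_norm_setIntegral_le hG hR
  refine Summable.of_norm_bounded ?_ (hb θ)
  exact (summable_geometric_of_lt_one (by norm_num) (by norm_num)).mul_left _

/-- The extension operator `f ↦ ∑_j Q_j^* (1_G (φ_j * f))`, as a linear form. -/
def GrowthOn.extendLinear (h : κ.GrowthOn F G A) (hG : MeasurableSet G) (hR : A + n + 1 ≤ R) :
    Se 𝕜 n →ₗ[𝕜] 𝕜 where
  toFun θ := ∑' j, ∫ y in G, κ.coeff F j y * (κ.Q (R + 1) j θ).1 y
  map_add' θ η := by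
    rw [← (h.summable hG hR θ).tsum_add (h.summable hG hR η)]
    refine tsum_congr fun j => ?_
    rw [← integral_add (h.integrableOn hG hR θ j) (h.integrableOn hG hR η j), map_add]
    congr 1; ext y
    exact mul_add _ _ _
  map_smul' c θ := by
    rw [RingHom.id_apply, smul_eq_mul, ← tsum_mul_left]
    refine tsum_congr fun j => ?_
    rw [← integral_const_mul, map_smul]
    congr 1; ext y
    exact mul_left_comm _ _ _

/-- The extension operator `f ↦ ∑_j Q_j^* (1_G (φ_j * f))`. -/
def GrowthOn.extend (h : κ.GrowthOn F G A) (hG : MeasurableSet G) (hR : A + n + 1 ≤ R) :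
    SeDual 𝕜 n where
  toLinearMap := h.extendLinear hG hR
  cont := by
    obtain ⟨C, hC, hb⟩ := h.exists_norm_setIntegral_le hG hR
    refine withSeminorms_seSeminorm.continuous_normedSpace_rng 𝕜 (h.extendLinear hG hR)
      ⟨{R}, (2 * C).toNNReal, fun θ => ?_⟩
    have h1 : HasSum (fun j => C * seSeminorm 𝕜 n R θ * (2 : ℝ)⁻¹ ^ j)
        (C * seSeminorm 𝕜 n R θ * 2) := by
      have := hasSum_geometric_of_lt_one (r := (2 : ℝ)⁻¹) (by norm_num) (by norm_num)
      rw [show (1 - (2 : ℝ)⁻¹)⁻¹ = 2 by norm_num] at this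
      exact this.mul_left _
    have h2 : ‖h.extendLinear hG hR θ‖ ≤ C * seSeminorm 𝕜 n R θ * 2 :=
      tsum_of_norm_bounded h1 (hb θ)
    simp only [Finset.sup_singleton]
    change ‖h.extendLinear hG hR θ‖ ≤ ((2 * C).toNNReal : ℝ) * seSeminorm 𝕜 n R θ
    rw [Real.coe_toNNReal _ (by positivity)]
    linarith

lemma GrowthOn.extend_apply (h : κ.GrowthOn F G A) (hG : MeasurableSet G) (hR : A + n + 1 ≤ R)
    (θ : Se 𝕜 n) : h.extend hG hR θ = ∑' j, ∫ y in G, κ.coeff F j y * (κ.Q (R + 1) j θ).1 y :=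
  rfl

/-- The extension operator does not change the functional on test functions on `G`. -/
lemma GrowthOn.extend_eq (h : κ.GrowthOn F G A) (hG : MeasurableSet G) (hR : A + n + 1 ≤ R)
    (habs : κ.Absorbs G) {θ : Se 𝕜 n} (hθ : IsTestOn G θ.1) :
    h.extend hG hR θ = F (jet N θ) :=
  tendsto_nhds_unique (h.summable hG hR θ).hasSum.tendsto_sum_nat
    (habs.tendsto_sum F (Nat.le_add_left 1 R) hθ)

/-- Convolutions as values at dilated kernels. -/
lemma conv_kernel_eq {G : Opens (EuclideanSpace ℝ (Fin n))} (habs : κ.Absorbs G)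
    {f : 𝓓(G, 𝕜) → 𝕜} {L : Se 𝕜 n → 𝕜} (hf : ∀ θ, f θ = L (testToSe G θ)) (k : ℕ)
    {x : EuclideanSpace ℝ (Fin n)} (hx : x ∈ G) :
    conv f (kernel κ.toFun k) x = L (κ.diffShift k x) := by
  have e : (κ.diffShift k x).1 = fun y => kernel κ.toFun k (x - y) :=
    funext fun y => κ.diffShift_apply k x y
  have h1 : IsTestOn (G : Set (EuclideanSpace ℝ (Fin n))) fun y => kernel κ.toFun k (x - y) := by
    rw [← e]; exact habs.diffShift k hx
  rw [conv, dif_pos h1, hf]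
  congr 1
  exact Subtype.ext e.symm

end UnitKernel

end Extension

/-! ### Pointwise estimates for the extension -/

section Pointwise

variable {𝕜 : Type*} [RCLike 𝕜] {n : ℕ}

lemma tsum_rpow_le {ι : Type*} {s : ℝ} (hs0 : 0 < s) (hs1 : s ≤ 1) (f : ι → ℝ≥0∞) :
    (∑' i, f i) ^ s ≤ ∑' i, f i ^ s := by
  classical
  rw [ENNReal.tsum_eq_iSup_sum]
  refine ((ENNReal.orderIsoRpow s hs0).map_iSup _).le.trans (iSup_le fun S => ?_)
  refine le_trans ?_ (ENNReal.sum_le_tsum S)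
  change (∑ i ∈ S, f i) ^ s ≤ _
  induction S using Finset.induction_on with
  | empty => simp [hs0]
  | insert a S ha ih =>
    rw [Finset.sum_insert ha, Finset.sum_insert ha]
    exact (ENNReal.rpow_add_le_add_rpow _ _ hs0.le hs1).trans (by gcongr)

variable {G : Set (EuclideanSpace ℝ (Fin n))} {f : ℕ → EuclideanSpace ℝ (Fin n) → ℝ≥0∞} {s : ℝ}

lemma expDecay_mul_expMean_le {b : ℝ} (hb : 0 ≤ b) (i j d : ℕ)
    (x z : EuclideanSpace ℝ (Fin n)) :
    expDecay b j x z * expMean G f s b i (j + d) z ≤ 2 ^ (d * n) * expMean G f s b i j x := by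
  have hint : expDecay b j x z * ∫⁻ y in G, f i y ^ s * expDecay b (j + d) z y ≤
      ∫⁻ y in G, f i y ^ s * expDecay b j x y := by
    rw [← lintegral_const_mul' _ _ (expDecay_ne_top _ _ _ _)]
    refine lintegral_mono fun y => ?_
    rw [mul_left_comm]
    exact mul_le_mul_right (expDecay_mul_le hb (Nat.le_add_right j d) x z y) _
  unfold expMean
  calc _ = 2 ^ ((j + d) * n) * (expDecay b j x z *
        ∫⁻ y in G, f i y ^ s * expDecay b (j + d) z y) := by ring
    _ ≤ 2 ^ ((j + d) * n) * ∫⁻ y in G, f i y ^ s * expDecay b j x y := by gcongr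
    _ = _ := by rw [add_mul, pow_add]; ring

/-- Powers of means are bounded by means of powers. -/
lemma exists_expMean_rpow_le (hG : MeasurableSet G) (hs0 : 0 < s) {b : ℝ} (hb : 0 ≤ b) :
    ∃ C₀ : ℝ≥0, ∀ (f : ℕ → EuclideanSpace ℝ (Fin n) → ℝ≥0∞) (N : ℕ) (C : ℝ≥0),
      (∀ j, ∀ x ∈ G, f j x ^ s ≤ C * ∑' i, (2⁻¹ : ℝ≥0∞) ^ (i * N) * expMean G f s b (j + i) j x) →
      ∀ (j d : ℕ) (x : EuclideanSpace ℝ (Fin n)), expMean G f 1 (b / s + n) (j + d) j x ^ s ≤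
        C₀ ^ s * C * ∑' i, (2⁻¹ : ℝ≥0∞) ^ (i * N) *
          (2 ^ (d * n) * expMean G f s b (j + d + i) j x) := by
  obtain ⟨C₀, hC₀⟩ := exists_lintegral_expDecay_le (n := n)
  refine ⟨C₀, fun f N C hf j d x => ?_⟩
  set Y : ℝ≥0∞ := C * ∑' i, (2⁻¹ : ℝ≥0∞) ^ (i * N) *
    (2 ^ (d * n) * expMean G f s b (j + d + i) j x) with hY
  -- The part `b / s` of the rate makes the pointwise bound uniform in `z`; the remaining rate `n`
  -- makes the weight integrable. Recentring from scale `j + d` to scale `j` costs `2^{dn}`.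
  have hpt : ∀ z ∈ G, f (j + d) z * expDecay (b / s) j x z ≤ Y ^ s⁻¹ := by
    intro z hz
    rw [ENNReal.le_rpow_inv_iff hs0, ENNReal.mul_rpow_of_nonneg _ _ hs0.le, expDecay_rpow _ hs0.le,
      mul_div_cancel₀ _ hs0.ne']
    calc _ ≤ (C * ∑' i, (2⁻¹ : ℝ≥0∞) ^ (i * N) * expMean G f s b (j + d + i) (j + d) z) *
          expDecay b j x z := by gcongr; exact hf _ z hz
      _ = C * ∑' i, (2⁻¹ : ℝ≥0∞) ^ (i * N) *
          (expDecay b j x z * expMean G f s b (j + d + i) (j + d) z) := by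
          rw [mul_assoc, ← ENNReal.tsum_mul_right]
          congr 1
          refine tsum_congr fun i => ?_
          ring
      _ ≤ Y := by
          refine mul_le_mul_right (ENNReal.tsum_le_tsum fun i => mul_le_mul_right ?_ _) _
          exact expDecay_mul_expMean_le hb _ j d x z
  have hadd : ∀ z, expDecay (b / s + n) j x z = expDecay (b / s) j x z * expDecay n j x z := by
    intro z
    rw [expDecay, expDecay, expDecay, ← ENNReal.ofReal_mul (Real.exp_pos _).le, ← Real.exp_add]
    ring_nf
  have hmean : expMean G f 1 (b / s + n) (j + d) j x ≤ C₀ * Y ^ s⁻¹ := by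
    unfold expMean
    calc _ ≤ 2 ^ (j * n) * ∫⁻ z in G, Y ^ s⁻¹ * expDecay n j x z := by
          refine mul_le_mul_right (setLIntegral_mono' hG fun z hz => ?_) _
          rw [ENNReal.rpow_one, hadd, ← mul_assoc]
          exact mul_le_mul_left (hpt z hz) _
      _ = (2 ^ (j * n) * ∫⁻ z in G, expDecay n j x z) * Y ^ s⁻¹ := by
          rw [lintegral_const_mul _ (measurable_expDecay _ _ _)]; ring
      _ ≤ _ := by
          gcongr
          exact (mul_le_mul_right (setLIntegral_le_lintegral _ _) _).trans (hC₀ j x)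
  calc _ ≤ (C₀ * Y ^ s⁻¹) ^ s := by gcongr
    _ = C₀ ^ s * Y := by
        rw [ENNReal.mul_rpow_of_nonneg _ _ hs0.le, ← ENNReal.rpow_mul, inv_mul_cancel₀ hs0.ne',
          ENNReal.rpow_one]
    _ = _ := by rw [hY]; ring

namespace UnitKernel

variable {κ : UnitKernel 𝕜 n}

/-- The estimate of Peetre type for the convolutions of a distribution on `G`. -/
lemma Absorbs.exists_rpow_le (habs : κ.Absorbs G) (hG : MeasurableSet G) (hs0 : 0 < s)
    (hs1 : s ≤ 1) (M : ℕ) (b : ℝ) : ∃ C : ℝ≥0, ∀ (N : ℕ) (F : JetSpace 𝕜 n N →L[𝕜] 𝕜) (j : ℕ),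
      ∀ x ∈ G, ‖κ.coeff F j x‖ₑ ^ s ≤ C * ∑' i, (2⁻¹ : ℝ≥0∞) ^ (i * M) *
        expMean G (fun l y => ‖κ.coeff F l y‖ₑ) s b (j + i) j x := by
  choose C hC using fun N a => habs.exists_selfControlled N a
  obtain ⟨C', hC'⟩ := exists_rpow_le_tsum_expMean hG C hs0 hs1 M b
  refine ⟨C', fun N F j x hx => hC' (fun l y => ‖κ.coeff F l y‖ₑ)
    (fun M a => hC M a N F) ?_ j x hx⟩
  obtain ⟨D, hD0, hD⟩ := κ.exists_coeff_growth F
  refine ⟨D.toNNReal, n + N, fun l y _ => ?_⟩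
  have h1 : ‖κ.coeff F l y‖ ≤ D * (2 : ℝ) ^ (l * (n + N)) * Real.exp ((n + N : ℕ) * ‖y‖) := by
    refine (hD l y).trans ?_
    gcongr
    exact Nat.le_add_left N n
  rw [← ofReal_norm]
  refine (ENNReal.ofReal_le_ofReal h1).trans (le_of_eq ?_)
  rw [ENNReal.ofReal_mul (by positivity), ENNReal.ofReal_mul hD0, ENNReal.ofReal_pow (by norm_num),
    ENNReal.ofReal_ofNat]
  rfl

/-- In both sums the index `d` measures the distance to level `k`; the levels below are counted
downwards from `k - 1`. -/
lemma tsum_eq_tsum_add_tsum (u : ℕ → ℝ≥0∞) (k : ℕ) :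
    ∑' j, u j = ∑' d, u (k + d) + ∑' d, if d < k then u (k - 1 - d) else 0 := by
  have h1 : ∑ i ∈ Finset.range k, u i + ∑' d, u (d + k) = ∑' j, u j :=
    ENNReal.summable.sum_add_tsum_nat_add' (f := u) (k := k)
  rw [← h1, add_comm]
  congr 1
  · exact tsum_congr fun d => by rw [add_comm]
  · rw [← Finset.sum_range_reflect u k, tsum_eq_sum (s := Finset.range k)]
    · exact Finset.sum_congr rfl fun d hd => (if_pos (Finset.mem_range.1 hd)).symm
    · exact fun d hd => if_neg fun h => hd (Finset.mem_range.2 h)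

/-- The convolutions of the extension are bounded by weighted means. -/
lemma exists_extend_le (κ : UnitKernel 𝕜 n) (hG : MeasurableSet G) {m : ℕ}
    (hm : VanishingMoments m (differenceKernel κ.toFun)) (R : ℕ) {a : ℝ} (ha : 0 ≤ a) :
    ∃ C : ℝ≥0, ∀ (N : ℕ) (F : JetSpace 𝕜 n N →L[𝕜] 𝕜) (A : ℕ) (h : κ.GrowthOn F G A)
      (hR : A + n + 1 ≤ R) (k : ℕ) (x : EuclideanSpace ℝ (Fin n)),
      ‖h.extend hG hR (κ.diffShift k x)‖ₑ ≤ C * (∑' d, (2⁻¹ : ℝ≥0∞) ^ (d * R) *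
        expMean G (fun l y => ‖κ.coeff F l y‖ₑ) 1 a (k + d) k x +
        ∑' d, if d < k then (2⁻¹ : ℝ≥0∞) ^ (d * m) *
          expMean G (fun l y => ‖κ.coeff F l y‖ₑ) 1 a (k - 1 - d) (k - 1 - d) x else 0) := by
  obtain ⟨C₁, hC₁, h₁⟩ := κ.exists_Q_diffShift_bound R ha
  obtain ⟨C₂, hC₂, h₂⟩ := κ.exists_Q_diffShift_bound_of_moments (R + 1) hm ha
  refine ⟨(C₁ + C₂).toNNReal, fun N F A h hR k x => ?_⟩
  have hterm : ∀ (i l e : ℕ) (g : EuclideanSpace ℝ (Fin n) → 𝕜) (D : ℝ), 0 ≤ D → D ≤ C₁ + C₂ →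
      DerivBound 0 (D * ((2 : ℝ)⁻¹ ^ e * 2 ^ (l * n)))
        (fun z => Real.exp (-(a * 2 ^ l * ‖x - z‖))) g →
      ‖∫ z in G, κ.coeff F i z * g z‖ₑ ≤ ((C₁ + C₂).toNNReal : ℝ≥0∞) *
        ((2⁻¹ : ℝ≥0∞) ^ e * expMean G (fun l y => ‖κ.coeff F l y‖ₑ) 1 a i l x) := by
    intro i l e g D hD hD' hg
    refine (enorm_setIntegral_le (by positivity) hg).trans ?_
    rw [ofReal_pow_mul_two_pow D hD]
    simp only [expMean, ENNReal.rpow_one, mul_assoc]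
    gcongr
    exact ENNReal.ofReal_le_ofReal hD'
  have hfirst : ‖h.extend hG hR (κ.diffShift k x)‖ₑ ≤
      ∑' j, ‖∫ y in G, κ.coeff F j y * (κ.Q (R + 1) j (κ.diffShift k x)).1 y‖ₑ := by
    rw [h.extend_apply hG hR]
    exact enorm_tsum_le_tsum_enorm
  refine hfirst.trans ?_
  rw [tsum_eq_tsum_add_tsum _ k, mul_add, ← ENNReal.tsum_mul_left, ← ENNReal.tsum_mul_left]
  refine add_le_add (ENNReal.tsum_le_tsum fun d => ?_) (ENNReal.tsum_le_tsum fun d => ?_)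
  -- For levels `j ≥ k` the derivative gain of `Q_j` is used, at scale `2^{-k}`. For `j < k` the
  -- moments of `φ` are used, at the coarser scale `2^{-j}`.
  · exact hterm _ _ _ _ C₁ hC₁ (le_add_of_nonneg_right hC₂) (h₁ k d x)
  · split_ifs with hd
    · refine hterm _ _ _ _ C₂ hC₂ (le_add_of_nonneg_left hC₁) ?_
      have h3 := h₂ (k - 1 - d) d x
      rwa [show k - 1 - d + d + 1 = k by omega] at h3
    · exact zero_le

end UnitKernel

end Pointwise

/-! ### Norm estimates for the extension -/

section Sequences

lemma eLpNorm_tsum_tsum_le {α : Type*} {mα : MeasurableSpace α} {μ : Measure α} {u : ℝ≥0∞}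
    (hu : 1 ≤ u) (c : ℕ → ℕ → ℝ≥0∞) {V : ℕ → ℕ → α → ℝ≥0∞} (hV : ∀ d i, AEMeasurable (V d i) μ) :
    eLpNorm (fun x => ∑' d, ∑' i, c d i * V d i x) u μ ≤
      ∑' d, ∑' i, c d i * eLpNorm (V d i) u μ := by
  refine (eLpNorm_tsum_le (fun d => AEMeasurable.tsum fun i => (hV d i).const_mul _)
    hu).trans (ENNReal.tsum_le_tsum fun d => ?_)
  refine (eLpNorm_tsum_le (fun i => (hV d i).const_mul _) hu).trans
    (ENNReal.tsum_le_tsum fun i => ?_)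
  exact eLpNorm_const_mul_le _ (hV d i)

lemma eLpNorm_count_ite_le (u : ℝ≥0∞) (b : ℕ → ℝ≥0∞) (d i : ℕ) :
    eLpNorm (fun k => if d < k then b (k - 1 - d + i) else 0) u Measure.count ≤
      eLpNorm b u Measure.count := by
  rcases eq_or_ne u 0 with rfl | hu0
  · simp
  rcases eq_or_ne u ⊤ with rfl | hut
  · simp only [eLpNorm_exponent_top, eLpNormEssSup_count, enorm_eq_self]
    refine iSup_le fun k => ?_
    split_ifs
    · exact le_iSup b _
    · exact zero_le
  · have hpos := ENNReal.toReal_pos hu0 hut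
    rw [← ENNReal.rpow_le_rpow_iff hpos, eLpNorm_rpow_toReal hu0 hut,
      eLpNorm_rpow_toReal hu0 hut, lintegral_count, lintegral_count,
      ← ENNReal.summable.sum_add_tsum_nat_add' (k := d + 1)]
    rw [Finset.sum_eq_zero, zero_add]
    · refine le_trans (le_of_eq (tsum_congr fun k => ?_))
        (ENNReal.tsum_comp_le_tsum_of_injective (add_left_injective i) fun k => b k ^ u.toReal)
      rw [if_pos (by omega), show k + (d + 1) - 1 - d = k by omega]
    · intro k hk
      rw [if_neg (by have := Finset.mem_range.1 hk; omega), ENNReal.zero_rpow_of_pos hpos]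

/-- Sums over shifts, with geometrically decreasing coefficients, are bounded in `ℓ_u`. -/
lemma eLpNorm_count_shifts_le {u : ℝ≥0∞} (hu : 1 ≤ u) {ρ : ℝ≥0∞} (C : ℝ≥0∞) {β b : ℕ → ℝ≥0∞}
    (h : ∀ k, β k ≤ C * (∑' d, ∑' i, (2⁻¹ : ℝ≥0∞) ^ d * 2⁻¹ ^ i * b (k + d + i) +
      ∑' d, ∑' i, ρ ^ d * 2⁻¹ ^ i * if d < k then b (k - 1 - d + i) else 0)) :
    eLpNorm β u Measure.count ≤ C * (4 + 2 * (1 - ρ)⁻¹) * eLpNorm b u Measure.count := by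
  have hm : ∀ g : ℕ → ℝ≥0∞, AEMeasurable g Measure.count := fun g =>
    (measurable_of_countable g).aemeasurable
  -- Hence the constants: `4 = 2 * 2` for the fine levels, and `2 (1 - ρ)⁻¹` for the coarse ones.
  have hgeo : ∑' i : ℕ, (2⁻¹ : ℝ≥0∞) ^ i = 2 := by
    rw [ENNReal.tsum_geometric, ENNReal.one_sub_inv_two, inv_inv]
  refine (eLpNorm_mono_ennreal h).trans ((eLpNorm_const_mul_le C (hm _)).trans ?_)
  rw [mul_assoc, add_mul]
  refine mul_le_mul_right ?_ _
  have hadd := eLpNorm_add_le (μ := Measure.count) (p := u)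
    (f := fun k => ∑' d, ∑' i, (2⁻¹ : ℝ≥0∞) ^ d * 2⁻¹ ^ i * b (k + d + i))
    (g := fun k => ∑' d, ∑' i, ρ ^ d * (2⁻¹ : ℝ≥0∞) ^ i * if d < k then b (k - 1 - d + i) else 0)
    (hm _).aestronglyMeasurable (hm _).aestronglyMeasurable hu
  refine hadd.trans (add_le_add ?_ ?_)
  · refine (eLpNorm_tsum_tsum_le hu (fun d i => (2⁻¹ : ℝ≥0∞) ^ d * 2⁻¹ ^ i)
      (V := fun d i k => b (k + d + i)) fun d i => hm _).trans ?_
    calc _ ≤ ∑' d : ℕ, ∑' i : ℕ, (2⁻¹ : ℝ≥0∞) ^ d * 2⁻¹ ^ i * eLpNorm b u Measure.count := by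
          refine ENNReal.tsum_le_tsum fun d => ENNReal.tsum_le_tsum fun i => mul_le_mul_right ?_ _
          refine eLpNorm_count_comp_le (e := fun k => k + d + i) (fun k k' hk => ?_) b
          simpa [add_assoc] using hk
      _ = _ := by
          simp_rw [ENNReal.tsum_mul_right, ENNReal.tsum_mul_left, ENNReal.tsum_mul_right, hgeo]
          norm_num
  · refine (eLpNorm_tsum_tsum_le hu (fun d i => ρ ^ d * (2⁻¹ : ℝ≥0∞) ^ i)
      (V := fun d i k => if d < k then b (k - 1 - d + i) else 0) fun d i => hm _).trans ?_
    calc _ ≤ ∑' d : ℕ, ∑' i : ℕ, ρ ^ d * (2⁻¹ : ℝ≥0∞) ^ i * eLpNorm b u Measure.count :=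
          ENNReal.tsum_le_tsum fun d => ENNReal.tsum_le_tsum fun i =>
            mul_le_mul_right (eLpNorm_count_ite_le u b d i) _
      _ = _ := by
          simp_rw [ENNReal.tsum_mul_right, ENNReal.tsum_mul_left, ENNReal.tsum_mul_right, hgeo,
            ENNReal.tsum_geometric]
          ring

end Sequences

/-! ### Powers of the convolutions of the extension. -/

namespace UnitKernel

variable {𝕜 : Type*} [RCLike 𝕜] {n : ℕ} {κ : UnitKernel 𝕜 n} {G : Set (EuclideanSpace ℝ (Fin n))}
  {s : ℝ}

/-- Powers of the convolutions of the extension are bounded by means of powers. -/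
lemma Absorbs.exists_extend_rpow_le (habs : κ.Absorbs G) (hG : MeasurableSet G) {m : ℕ}
    (hm : VanishingMoments m (differenceKernel κ.toFun)) (hs0 : 0 < s) (hs1 : s ≤ 1) {b : ℝ}
    (hb : 0 ≤ b) (M R : ℕ) :
    ∃ C : ℝ≥0, ∀ (N : ℕ) (F : JetSpace 𝕜 n N →L[𝕜] 𝕜) (A : ℕ) (h : κ.GrowthOn F G A)
      (hR : A + n + 1 ≤ R) (k : ℕ) (x : EuclideanSpace ℝ (Fin n)),
      ‖h.extend hG hR (κ.diffShift k x)‖ₑ ^ s ≤ C *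
        (∑' d, ∑' i, ((2⁻¹ : ℝ≥0∞) ^ (d * R)) ^ s * 2 ^ (d * n) * 2⁻¹ ^ (i * M) *
          expMean G (fun l y => ‖κ.coeff F l y‖ₑ) s b (k + d + i) k x +
        ∑' d, ∑' i, ((2⁻¹ : ℝ≥0∞) ^ (d * m)) ^ s * 2⁻¹ ^ (i * M) * if d < k then
          expMean G (fun l y => ‖κ.coeff F l y‖ₑ) s b (k - 1 - d + i) (k - 1 - d) x else 0) := by
  obtain ⟨C₁, h₁⟩ := κ.exists_extend_le hG hm R (a := b / s + n) (by positivity)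
  obtain ⟨C₂, h₂⟩ := exists_expMean_rpow_le (n := n) hG hs0 hb
  obtain ⟨C₃, h₃⟩ := habs.exists_rpow_le hG hs0 hs1 M b
  have hfin : (C₁ : ℝ≥0∞) ^ s * ((C₂ : ℝ≥0∞) ^ s * C₃) ≠ ⊤ :=
    ENNReal.mul_ne_top (ENNReal.rpow_ne_top_of_nonneg hs0.le ENNReal.coe_ne_top)
      (ENNReal.mul_ne_top (ENNReal.rpow_ne_top_of_nonneg hs0.le ENNReal.coe_ne_top)
        ENNReal.coe_ne_top)
  refine ⟨((C₁ : ℝ≥0∞) ^ s * ((C₂ : ℝ≥0∞) ^ s * C₃)).toNNReal, fun N F A h hR k x => ?_⟩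
  rw [ENNReal.coe_toNNReal hfin]
  set f : ℕ → EuclideanSpace ℝ (Fin n) → ℝ≥0∞ := fun l y => ‖κ.coeff F l y‖ₑ
  have h4 := h₂ f M C₃ (h₃ N F)
  refine (ENNReal.rpow_le_rpow (h₁ N F A h hR k x) hs0.le).trans ?_
  rw [ENNReal.mul_rpow_of_nonneg _ _ hs0.le, mul_assoc]
  refine mul_le_mul_right ((ENNReal.rpow_add_le_add_rpow _ _ hs0.le hs1).trans ?_) _
  rw [mul_add]
  refine add_le_add ?_ ?_
  · refine (tsum_rpow_le hs0 hs1 _).trans ?_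
    rw [← ENNReal.tsum_mul_left]
    refine ENNReal.tsum_le_tsum fun d => ?_
    rw [ENNReal.mul_rpow_of_nonneg _ _ hs0.le]
    refine (mul_le_mul_right (h4 k d x) _).trans (le_of_eq ?_)
    rw [mul_left_comm, ← ENNReal.tsum_mul_left]
    congr 1
    refine tsum_congr fun i => ?_
    ring
  · refine (tsum_rpow_le hs0 hs1 _).trans ?_
    rw [← ENNReal.tsum_mul_left]
    refine ENNReal.tsum_le_tsum fun d => ?_
    split_ifs with hd
    · rw [ENNReal.mul_rpow_of_nonneg _ _ hs0.le]
      -- Here the mean is already taken at the scale of its level, so there is no recentring loss.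
      have h5 := h4 (k - 1 - d) 0 x
      simp only [add_zero, zero_mul, pow_zero, one_mul] at h5
      refine (mul_le_mul_right h5 _).trans (le_of_eq ?_)
      rw [mul_left_comm, ← ENNReal.tsum_mul_left]
      congr 1
      refine tsum_congr fun i => ?_
      ring
    · rw [ENNReal.zero_rpow_of_pos hs0]
      exact zero_le

lemma expMean_eq_lintegral_indicator (hG : MeasurableSet G) (hs0 : 0 < s)
    (g : ℕ → EuclideanSpace ℝ (Fin n) → 𝕜) (b : ℝ) (i j : ℕ) (x : EuclideanSpace ℝ (Fin n)) :
    expMean G (fun l y => ‖g l y‖ₑ) s b i j x =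
      2 ^ (j * n) * ∫⁻ z, ‖G.indicator (g i) z‖ₑ ^ s * expDecay b j x z := by
  rw [expMean, ← lintegral_indicator hG]
  congr 1
  refine lintegral_congr fun z => ?_
  by_cases hz : z ∈ G
  · simp [hz]
  · simp [hz, hs0]

lemma measurable_expMean {f : ℕ → EuclideanSpace ℝ (Fin n) → ℝ≥0∞} (hf : ∀ i, Measurable (f i))
    (b : ℝ) (i j : ℕ) : Measurable (expMean G f s b i j) := by
  unfold expMean
  refine Measurable.const_mul ?_ _
  refine Measurable.lintegral_prod_right' (f := fun q : EuclideanSpace ℝ (Fin n) ×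
    EuclideanSpace ℝ (Fin n) => f i q.2 ^ s * expDecay b j q.1 q.2) ?_
  refine (((hf i).comp measurable_snd).pow_const s).mul ?_
  unfold expDecay
  fun_prop

end UnitKernel

/-! ### Uniform growth of the convolutions on `G`. -/

namespace WeightClass

variable {𝕜 : Type*} [RCLike 𝕜] {n : ℕ} {p σ₁ σ₂ : ℝ≥0∞} {α₁ α₂ α₃ : ℝ}
  {t : ℕ → EuclideanSpace ℝ (Fin n) → ℝ} (ht : WeightClass p σ₁ σ₂ α₁ α₂ α₃ t)
  {κ : UnitKernel 𝕜 n} {G : Set (EuclideanSpace ℝ (Fin n))}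
include ht

/-- Distributions with bounded weighted norms grow at most exponentially on `G`. -/
lemma exists_growthOn (habs : κ.Absorbs G) (hG : MeasurableSet G) {r : ℝ≥0∞} (hr0 : r ≠ 0)
    (hr1 : r ≤ 1) (hr : r ≤ (p⁻¹ + σ₁⁻¹)⁻¹) :
    ∃ A : ℕ, ∀ (N : ℕ) (F : JetSpace 𝕜 n N →L[𝕜] 𝕜) (K : ℝ≥0),
      (∀ j, eLpNorm (fun x => t j x • G.indicator (κ.coeff F j) x) p volume ≤ K) →
      κ.GrowthOn F G A := by
  obtain ⟨B, hB⟩ := exists_nat_ge α₃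
  have hrt : r ≠ ⊤ := ne_top_of_le_ne_top ENNReal.one_ne_top hr1
  obtain ⟨C₁, A', h₁⟩ := ht.exists_expDecay_growth (𝕜 := 𝕜) hr0 hr1 hr hB
  set s := r.toReal
  have hs0 : 0 < s := ENNReal.toReal_pos hr0 hrt
  have hs1 : s ≤ 1 := by
    have := ENNReal.toReal_mono ENNReal.one_ne_top hr1
    simpa using this
  -- The level `j + i` contributes growth `2^{(j+i)A'}`; decay of order `A' + 1` leaves the summable
  -- `2^{-i}`. Neither `A'` nor the constants depend on the functional.
  obtain ⟨C₂, h₂⟩ := habs.exists_rpow_le hG hs0 hs1 (A' + 1) ((n : ℝ) * (B + 1 : ℕ))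
  obtain ⟨A, hA⟩ := exists_nat_ge (((n + A' : ℕ) : ℝ) / s)
  rw [div_le_iff₀ hs0] at hA
  refine ⟨A, fun N F K hK => ?_⟩
  set D : ℝ≥0 := C₂ * (C₁ * K ^ s * 2)
  have hD : (D : ℝ≥0∞) = C₂ * (C₁ * (K : ℝ≥0∞) ^ s * 2) := by
    simp only [D, ENNReal.coe_mul, ENNReal.coe_rpow_of_nonneg _ hs0.le, ENNReal.coe_ofNat]
  have hmeas : ∀ j, AEStronglyMeasurable (G.indicator (κ.coeff F j)) volume := fun j =>
    (κ.continuous_coeff F j).aestronglyMeasurable.indicator hG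
  have hpow : ∀ j, ∀ y ∈ G, ‖κ.coeff F j y‖ₑ ^ s ≤
      D * 2 ^ (j * (n + A')) * ENNReal.ofReal (Real.exp (A' * ‖y‖)) := by
    intro j y hy
    refine (h₂ N F j y hy).trans ?_
    have hi : ∀ i, (2⁻¹ : ℝ≥0∞) ^ (i * (A' + 1)) * expMean G (fun l y => ‖κ.coeff F l y‖ₑ) s
        ((n : ℝ) * (B + 1 : ℕ)) (j + i) j y ≤ C₁ * (K : ℝ≥0∞) ^ s * 2 ^ (j * (n + A')) *
          ENNReal.ofReal (Real.exp (A' * ‖y‖)) * 2⁻¹ ^ i := by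
      intro i
      rw [UnitKernel.expMean_eq_lintegral_indicator hG hs0 (κ.coeff F)]
      calc _ ≤ (2⁻¹ : ℝ≥0∞) ^ (i * (A' + 1)) * (2 ^ (j * n) * (C₁ * 2 ^ ((j + i) * A') *
            ENNReal.ofReal (Real.exp (A' * ‖y‖)) * (K : ℝ≥0∞) ^ s)) := by
            refine mul_le_mul_right (mul_le_mul_right ?_ _) _
            refine le_trans (lintegral_mono fun z => mul_le_mul_right
              (expDecay_mono le_rfl (by positivity) (Nat.zero_le j) y z) _)
              ((h₁ (j + i) _ (hmeas _) y).trans ?_)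
            gcongr
            exact hK (j + i)
        _ = C₁ * (K : ℝ≥0∞) ^ s * 2 ^ (j * (n + A')) * ENNReal.ofReal (Real.exp (A' * ‖y‖)) *
            2⁻¹ ^ i * ((2⁻¹ : ℝ≥0∞) ^ (i * A') * 2 ^ (i * A')) := by
            rw [mul_add i, mul_one, pow_add, add_mul j, pow_add, mul_add j, pow_add]; ring
        _ = _ := by rw [← mul_pow, ENNReal.inv_mul_cancel (by simp) (by simp), one_pow, mul_one]
    refine (mul_le_mul_right (ENNReal.tsum_le_tsum hi) _).trans (le_of_eq ?_)
    rw [ENNReal.tsum_mul_left, ENNReal.tsum_geometric, ENNReal.one_sub_inv_two, inv_inv, hD]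
    ring
  refine ⟨(D : ℝ) ^ s⁻¹, by positivity, fun j y hy => ?_⟩
  have h3 := hpow j y hy
  have h4 : (D : ℝ≥0∞) * 2 ^ (j * (n + A')) * ENNReal.ofReal (Real.exp (A' * ‖y‖)) =
      ENNReal.ofReal ((D : ℝ) * 2 ^ (j * (n + A')) * Real.exp (A' * ‖y‖)) := by
    rw [ENNReal.ofReal_mul (by positivity), ENNReal.ofReal_mul (by positivity),
      ENNReal.ofReal_pow (by norm_num), ENNReal.ofReal_ofNat, ENNReal.ofReal_coe_nnreal]
  rw [h4, ← ofReal_norm, ENNReal.ofReal_rpow_of_nonneg (norm_nonneg _) hs0.le,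
    ENNReal.ofReal_le_ofReal_iff (by positivity),
    ← Real.le_rpow_inv_iff_of_pos (norm_nonneg _) (by positivity) hs0] at h3
  refine h3.trans ?_
  rw [Real.mul_rpow (by positivity) (by positivity), Real.mul_rpow (by positivity) (by positivity),
    ← Real.exp_mul, ← Real.rpow_natCast, ← Real.rpow_mul (by norm_num)]
  have hn : ((n + A' : ℕ) : ℝ) * s⁻¹ ≤ A := by
    rw [← div_eq_mul_inv, div_le_iff₀ hs0]; exact hA
  have hA' : (A' : ℝ) * s⁻¹ ≤ A := by
    refine le_trans ?_ hn
    gcongr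
    exact Nat.le_add_left _ _
  have hpow2 : (2 : ℝ) ^ (((j * (n + A') : ℕ) : ℝ) * s⁻¹) ≤ 2 ^ (j * A) := by
    rw [← Real.rpow_natCast 2 (j * A)]
    refine Real.rpow_le_rpow_of_exponent_le (by norm_num) ?_
    rw [Nat.cast_mul, Nat.cast_mul, mul_assoc]
    exact mul_le_mul_of_nonneg_left hn (Nat.cast_nonneg j)
  have hexp : (A' : ℝ) * ‖y‖ * s⁻¹ ≤ A * ‖y‖ := by
    rw [mul_right_comm]
    exact mul_le_mul_of_nonneg_right hA' (norm_nonneg y)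
  exact mul_le_mul (mul_le_mul_of_nonneg_left hpow2 (by positivity)) (Real.exp_le_exp.2 hexp)
    (Real.exp_pos _).le (by positivity)

end WeightClass

/-! ### Boundedness of the extension operator -/

section Coefficients

variable {s : ℝ} {n : ℕ}

lemma ofReal_two_rpow_le {α x : ℝ} {A i : ℕ} (hA : |α| ≤ A) (hx : |x| ≤ i) :
    ENNReal.ofReal (2 ^ (α * x)) ≤ 2 ^ (A * i) := by
  rw [← ENNReal.ofReal_ofNat, ← ENNReal.ofReal_pow (by norm_num), ← Real.rpow_natCast]
  refine ENNReal.ofReal_le_ofReal (Real.rpow_le_rpow_of_exponent_le (by norm_num) ?_)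
  refine (le_abs_self _).trans ?_
  rw [abs_mul, Nat.cast_mul]
  exact mul_le_mul hA hx (abs_nonneg _) (Nat.cast_nonneg _)

lemma rpow_le_self_of_one_le {x : ℝ≥0∞} (hx : 1 ≤ x) (hs1 : s ≤ 1) : x ^ s ≤ x :=
  (ENNReal.rpow_le_rpow_of_exponent_le hx hs1).trans_eq (ENNReal.rpow_one x)

lemma half_pow_mul_two_pow (i A : ℕ) :
    (2⁻¹ : ℝ≥0∞) ^ (i * (A + 1)) * 2 ^ (A * i) = 2⁻¹ ^ i := by
  rw [mul_add, mul_one, pow_add, mul_right_comm, mul_comm A i, ← mul_pow,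
    ENNReal.inv_mul_cancel (by simp) (by simp), one_pow, one_mul]

/-- Fine levels: a large `R` beats both the recentring loss `2^{dn}` and the weight loss of exponent
`A`, with `2^{-d} 2^{-i}` to spare. -/
lemma coefficient_le_of_ge (hs0 : 0 < s) (hs1 : s ≤ 1) {A R : ℕ} {X : ℝ≥0∞}
    (hR : ((A + 1 + n : ℕ) : ℝ) ≤ R * s) {d i : ℕ} (hX : X ≤ 2 ^ (A * (d + i))) :
    ((2⁻¹ : ℝ≥0∞) ^ (d * R)) ^ s * 2 ^ (d * n) * 2⁻¹ ^ (i * (A + 1)) * X ^ s ≤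
      2⁻¹ ^ d * 2⁻¹ ^ i := by
  have hX' : X ^ s ≤ 2 ^ (A * d) * 2 ^ (A * i) := by
    rw [← pow_add, ← mul_add]
    exact (ENNReal.rpow_le_rpow hX hs0.le).trans
      (rpow_le_self_of_one_le (one_le_pow₀ (by norm_num)) hs1)
  calc _ ≤ (2⁻¹ : ℝ≥0∞) ^ (d * (A + 1)) * 2⁻¹ ^ (i * (A + 1)) * (2 ^ (A * d) * 2 ^ (A * i)) := by
        gcongr
        exact half_rpow_mul_le hR
    _ = ((2⁻¹ : ℝ≥0∞) ^ (d * (A + 1)) * 2 ^ (A * d)) * (2⁻¹ ^ (i * (A + 1)) * 2 ^ (A * i)) := by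
        ring
    _ = _ := by rw [half_pow_mul_two_pow, half_pow_mul_two_pow]

/-- Coarse levels: the moments give `2^{-dms}` against the weight growth `2^{α(d+1)s}`. Their ratio
`2^{(α-m)s}` is the quotient of a geometric series, convergent exactly when `α < m`. -/
lemma coefficient_le_of_lt (hs0 : 0 < s) (hs1 : s ≤ 1) {A m : ℕ} {α : ℝ} {X : ℝ≥0∞}
    {d i : ℕ} (hX : X ≤ 2 ^ (A * i)) :
    ((2⁻¹ : ℝ≥0∞) ^ (d * m)) ^ s * 2⁻¹ ^ (i * (A + 1)) *
      (X * ENNReal.ofReal (2 ^ (α * ((d : ℝ) + 1)))) ^ s ≤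
      ENNReal.ofReal (2 ^ (α * s)) * (ENNReal.ofReal (2 ^ ((α - m) * s)) ^ d * 2⁻¹ ^ i) := by
  have hX' : X ^ s ≤ 2 ^ (A * i) := (ENNReal.rpow_le_rpow hX hs0.le).trans
      (rpow_le_self_of_one_le (one_le_pow₀ (by norm_num)) hs1)
  have h2 : ((2⁻¹ : ℝ≥0∞) ^ (d * m)) ^ s * (ENNReal.ofReal (2 ^ (α * ((d : ℝ) + 1)))) ^ s =
      ENNReal.ofReal (2 ^ (α * s)) * ENNReal.ofReal (2 ^ ((α - m) * s)) ^ d := by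
    have e : (2⁻¹ : ℝ≥0∞) = ENNReal.ofReal 2⁻¹ := by
      rw [ENNReal.ofReal_inv_of_pos (by norm_num), ENNReal.ofReal_ofNat]
    rw [e, ← ENNReal.ofReal_pow (by norm_num), ← ENNReal.ofReal_pow (by positivity),
      ENNReal.ofReal_rpow_of_nonneg (by positivity) hs0.le,
      ENNReal.ofReal_rpow_of_nonneg (by positivity) hs0.le,
      ← ENNReal.ofReal_mul (by positivity), ← ENNReal.ofReal_mul (by positivity)]
    congr 1
    rw [← Real.rpow_mul (by norm_num), ← Real.rpow_natCast, ← Real.rpow_natCast,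
      ← Real.rpow_mul (by norm_num), ← Real.rpow_mul (by norm_num), Real.inv_rpow (by norm_num),
      ← Real.rpow_neg (by norm_num), ← Real.rpow_add (by norm_num), ← Real.rpow_add (by norm_num)]
    congr 1
    push_cast
    ring
  rw [ENNReal.mul_rpow_of_nonneg _ _ hs0.le]
  calc _ ≤ ((2⁻¹ : ℝ≥0∞) ^ (d * m)) ^ s * 2⁻¹ ^ (i * (A + 1)) *
        (2 ^ (A * i) * ENNReal.ofReal (2 ^ (α * ((d : ℝ) + 1))) ^ s) := by gcongr
    _ = (((2⁻¹ : ℝ≥0∞) ^ (d * m)) ^ s * ENNReal.ofReal (2 ^ (α * ((d : ℝ) + 1))) ^ s) *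
        (2⁻¹ ^ (i * (A + 1)) * 2 ^ (A * i)) := by ring
    _ = _ := by rw [h2, half_pow_mul_two_pow, mul_assoc]

lemma ofReal_two_rpow_lt_one {x : ℝ} (hx : x < 0) : ENNReal.ofReal (2 ^ x) < 1 := by
  rw [ENNReal.ofReal_lt_one]
  exact Real.rpow_lt_one_of_one_lt_of_neg (by norm_num) hx

end Coefficients

namespace WeightClass

variable {𝕜 : Type*} [RCLike 𝕜] {n : ℕ} {p σ₁ σ₂ : ℝ≥0∞} {α₁ α₂ α₃ : ℝ}
  {t : ℕ → EuclideanSpace ℝ (Fin n) → ℝ} (ht : WeightClass p σ₁ σ₂ α₁ α₂ α₃ t)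
  {κ : UnitKernel 𝕜 n} {G : Set (EuclideanSpace ℝ (Fin n))}
include ht

/-- The weighted norms of the extension are bounded by sums over shifts. -/
lemma exists_extend_eLpNorm_le (habs : κ.Absorbs G) (hG : MeasurableSet G) {m : ℕ}
    (hm : VanishingMoments m (differenceKernel κ.toFun)) (hα₂ : α₂ < m) (hσ : p ≤ σ₂) {r : ℝ≥0∞}
    (hr0 : r ≠ 0) (hr1 : r ≤ 1) (hr : r ≤ (p⁻¹ + σ₁⁻¹)⁻¹) (A : ℕ) :
    ∃ (R : ℕ) (hR : A + n + 1 ≤ R) (C : ℝ≥0) (ρ : ℝ≥0∞), ρ < 1 ∧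
      ∀ (N : ℕ) (F : JetSpace 𝕜 n N →L[𝕜] 𝕜) (h : κ.GrowthOn F G A) (k : ℕ),
        eLpNorm (fun x => t k x • h.extend hG hR (κ.diffShift k x)) p volume ^ r.toReal ≤
          C * (∑' d, ∑' i, (2⁻¹ : ℝ≥0∞) ^ d * 2⁻¹ ^ i *
            eLpNorm (fun x => t (k + d + i) x • G.indicator (κ.coeff F (k + d + i)) x) p
              volume ^ r.toReal +
          ∑' d, ∑' i, ρ ^ d * (2⁻¹ : ℝ≥0∞) ^ i * if d < k then
            eLpNorm (fun x => t (k - 1 - d + i) x • G.indicator (κ.coeff F (k - 1 - d + i)) x) p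
              volume ^ r.toReal else 0) := by
  obtain ⟨B, hB⟩ := exists_nat_ge α₃
  obtain ⟨A₁, hA₁⟩ := exists_nat_ge |α₁|
  have hrt : r ≠ ⊤ := ne_top_of_le_ne_top ENNReal.one_ne_top hr1
  have hrp : 1 ≤ p / r := by
    rw [ENNReal.le_div_iff_mul_le (Or.inl hr0) (Or.inl hrt), one_mul]
    exact hr.trans (by rw [ENNReal.inv_le_iff_inv_le]; exact le_self_add)
  obtain ⟨C₁, h₁⟩ := ht.exists_eLpNorm_expDecay_le (𝕜 := 𝕜) hr0 hr1 hr hσ hB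
  set s := r.toReal
  have hs0 : 0 < s := ENNReal.toReal_pos hr0 hrt
  have hs1 : s ≤ 1 := by
    have := ENNReal.toReal_mono ENNReal.one_ne_top hr1
    simpa using this
  set b : ℝ := (n : ℝ) * (B + 1 : ℕ)
  -- `R` has two tasks: to make the extension converge for growth rate `A`, and to absorb the losses
  -- from `α₁` and recentring after the power `s`.
  obtain ⟨R₁, hR₁⟩ := exists_nat_ge (((A₁ + 1 + n : ℕ) : ℝ) / s)
  rw [div_le_iff₀ hs0] at hR₁
  set R := max (A + n + 1) R₁
  have hR : A + n + 1 ≤ R := le_max_left _ _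
  have hRs : ((A₁ + 1 + n : ℕ) : ℝ) ≤ R * s := hR₁.trans
    (mul_le_mul_of_nonneg_right (Nat.cast_le.2 (le_max_right _ _)) hs0.le)
  obtain ⟨C₂, h₂⟩ := habs.exists_extend_rpow_le hG hm hs0 hs1 (b := b) (by positivity) (A₁ + 1) R
  set D : ℝ≥0∞ := ENNReal.ofReal (2 ^ (α₂ * s))
  have hD : C₂ * (C₁ * (1 + D)) ≠ ⊤ := by finiteness
  refine ⟨R, hR, (C₂ * (C₁ * (1 + D))).toNNReal,
    ENNReal.ofReal (2 ^ ((α₂ - m) * s)),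
    ofReal_two_rpow_lt_one (mul_neg_of_neg_of_pos (by linarith) hs0), fun N F h k => ?_⟩
  rw [ENNReal.coe_toNNReal hD]
  set β : ℕ → ℝ≥0∞ := fun j =>
    eLpNorm (fun x => t j x • G.indicator (κ.coeff F j) x) p volume ^ s
  set E := expMean G (fun l y => ‖κ.coeff F l y‖ₑ) s b
  have hE : ∀ i l, Measurable (E i l) :=
    UnitKernel.measurable_expMean (fun i => (κ.continuous_coeff F i).measurable.enorm) b
  have htm : AEMeasurable (fun x => ‖t k x‖ₑ ^ s) volume :=
    (ht.aestronglyMeasurable k).enorm.pow_const s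
  have hV : ∀ i l, AEMeasurable (fun x => ‖t k x‖ₑ ^ s * E i l x) volume := fun i l =>
    htm.mul (hE i l).aemeasurable
  have hmean : ∀ l j, l ≤ j → l ≤ k →
      eLpNorm (fun x => ‖t k x‖ₑ ^ s * E j l x) (p / r) volume ≤
        C₁ * (ENNReal.ofReal (2 ^ (α₁ * ((l : ℝ) - j))) *
          ENNReal.ofReal (2 ^ (α₂ * ((k : ℝ) - l)))) ^ s * β j := by
    -- The mean lives at scale `l`: the weight is lowered from level `k` to `l` at the cost of `α₂`
    -- and raised from `l` to `j` at the cost of `α₁`.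
    intro l j hlj hlk
    have h3 := h₁ l j k hlj hlk (G.indicator (κ.coeff F j))
      ((κ.continuous_coeff F j).aestronglyMeasurable.indicator hG)
    simp_rw [E, UnitKernel.expMean_eq_lintegral_indicator hG hs0 (κ.coeff F)]
    exact h3
  have hpt : ∀ x, ‖t k x • h.extend hG hR (κ.diffShift k x)‖ₑ ^ s ≤ C₂ *
      (∑' d, ∑' i, ((2⁻¹ : ℝ≥0∞) ^ (d * R)) ^ s * 2 ^ (d * n) * 2⁻¹ ^ (i * (A₁ + 1)) *
        (‖t k x‖ₑ ^ s * E (k + d + i) k x) +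
      ∑' d, ∑' i, ((2⁻¹ : ℝ≥0∞) ^ (d * m)) ^ s * 2⁻¹ ^ (i * (A₁ + 1)) *
        if d < k then ‖t k x‖ₑ ^ s * E (k - 1 - d + i) (k - 1 - d) x else 0) := by
    intro x
    rw [enorm_smul, ENNReal.mul_rpow_of_nonneg _ _ hs0.le]
    refine (mul_le_mul_right (h₂ N F A h hR k x) _).trans (le_of_eq ?_)
    rw [mul_left_comm, mul_add]
    simp_rw [← ENNReal.tsum_mul_left]
    congr 2
    · refine tsum_congr fun d => tsum_congr fun i => ?_
      rw [mul_left_comm]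
    · refine tsum_congr fun d => tsum_congr fun i => ?_
      split_ifs
      · rw [mul_left_comm]
      · simp
  have hite : ∀ d i, AEMeasurable (fun x => if d < k then
      ‖t k x‖ₑ ^ s * E (k - 1 - d + i) (k - 1 - d) x else 0) volume := by
    intro d i
    split_ifs
    · exact hV _ _
    · exact aemeasurable_const
  have hm1 : AEMeasurable (fun x => ∑' d, ∑' i, ((2⁻¹ : ℝ≥0∞) ^ (d * R)) ^ s * 2 ^ (d * n) *
      2⁻¹ ^ (i * (A₁ + 1)) * (‖t k x‖ₑ ^ s * E (k + d + i) k x)) volume :=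
    AEMeasurable.tsum fun d => AEMeasurable.tsum fun i => (hV _ _).const_mul _
  have hm2 : AEMeasurable (fun x => ∑' d, ∑' i, ((2⁻¹ : ℝ≥0∞) ^ (d * m)) ^ s *
      2⁻¹ ^ (i * (A₁ + 1)) *
      if d < k then ‖t k x‖ₑ ^ s * E (k - 1 - d + i) (k - 1 - d) x else 0) volume :=
    AEMeasurable.tsum fun d => AEMeasurable.tsum fun i => (hite d i).const_mul _
  rw [← eLpNorm_rpow _ hr0 hrt]
  refine (eLpNorm_mono_ennreal hpt).trans ((eLpNorm_const_mul_le _ (hm1.add hm2)).trans ?_)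
  rw [mul_assoc]
  refine mul_le_mul_right ?_ _
  refine (eLpNorm_add_le hm1.aestronglyMeasurable hm2.aestronglyMeasurable hrp).trans ?_
  rw [mul_add]
  refine add_le_add ?_ ?_
  · refine (eLpNorm_tsum_tsum_le hrp _ fun d i => hV (k + d + i) k).trans ?_
    simp_rw [← ENNReal.tsum_mul_left]
    refine ENNReal.tsum_le_tsum fun d => ENNReal.tsum_le_tsum fun i => ?_
    refine (mul_le_mul_right (hmean k (k + d + i) (by omega) le_rfl) _).trans ?_
    have hX : ENNReal.ofReal (2 ^ (α₁ * ((k : ℝ) - (k + d + i : ℕ)))) *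
        ENNReal.ofReal (2 ^ (α₂ * ((k : ℝ) - k))) ≤ 2 ^ (A₁ * (d + i)) := by
      rw [sub_self, mul_zero, Real.rpow_zero, ENNReal.ofReal_one, mul_one]
      refine ofReal_two_rpow_le hA₁ (le_of_eq ?_)
      push_cast
      rw [show (k : ℝ) - (k + d + i) = -(d + i) by ring, abs_neg, abs_of_nonneg (by positivity)]
    calc _ = C₁ * ((((2⁻¹ : ℝ≥0∞) ^ (d * R)) ^ s * 2 ^ (d * n) * 2⁻¹ ^ (i * (A₁ + 1)) *
          (ENNReal.ofReal (2 ^ (α₁ * ((k : ℝ) - (k + d + i : ℕ)))) *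
            ENNReal.ofReal (2 ^ (α₂ * ((k : ℝ) - k)))) ^ s) * β (k + d + i)) := by ring
      _ ≤ C₁ * (1 + D) * (2⁻¹ ^ d * 2⁻¹ ^ i * β (k + d + i)) := by
          refine mul_le_mul' ?_ (mul_le_mul_left (coefficient_le_of_ge hs0 hs1 hRs hX) _)
          exact le_mul_of_one_le_right zero_le le_self_add
  · refine (eLpNorm_tsum_tsum_le hrp _ hite).trans ?_
    simp_rw [← ENNReal.tsum_mul_left]
    refine ENNReal.tsum_le_tsum fun d => ENNReal.tsum_le_tsum fun i => ?_
    split_ifs with hd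
    · refine (mul_le_mul_right (hmean (k - 1 - d) (k - 1 - d + i) (by omega) (by omega)) _).trans ?_
      have hX : ENNReal.ofReal (2 ^ (α₁ * (((k - 1 - d : ℕ) : ℝ) - (k - 1 - d + i : ℕ)))) ≤
          2 ^ (A₁ * i) := by
        refine ofReal_two_rpow_le hA₁ (le_of_eq ?_)
        push_cast
        rw [sub_add_cancel_left, abs_neg, Nat.abs_cast]
      have hk : (k : ℝ) - (k - 1 - d : ℕ) = (d : ℝ) + 1 := by
        rw [sub_eq_iff_eq_add]
        exact_mod_cast (show k = d + 1 + (k - 1 - d) by omega)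
      rw [hk]
      calc _ = C₁ * ((((2⁻¹ : ℝ≥0∞) ^ (d * m)) ^ s * 2⁻¹ ^ (i * (A₁ + 1)) *
            (ENNReal.ofReal (2 ^ (α₁ * (((k - 1 - d : ℕ) : ℝ) - (k - 1 - d + i : ℕ)))) *
              ENNReal.ofReal (2 ^ (α₂ * ((d : ℝ) + 1)))) ^ s) * β (k - 1 - d + i)) := by ring
        _ ≤ C₁ * (D * (ENNReal.ofReal (2 ^ ((α₂ - m) * s)) ^ d * 2⁻¹ ^ i) *
            β (k - 1 - d + i)) := by
            exact mul_le_mul_right (mul_le_mul_left (coefficient_le_of_lt hs0 hs1 hX) _) _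
        _ = C₁ * D * (ENNReal.ofReal (2 ^ ((α₂ - m) * s)) ^ d * 2⁻¹ ^ i *
            β (k - 1 - d + i)) := by ring
        _ ≤ _ := by
            gcongr
            exact le_add_self
    · simp

/-- The extension operator is bounded. -/
lemma exists_extend_lqNorm_le (habs : κ.Absorbs G) (hG : MeasurableSet G) {m : ℕ}
    (hm : VanishingMoments m (differenceKernel κ.toFun)) (hα₂ : α₂ < m) (hσ : p ≤ σ₂)
    {q r : ℝ≥0∞} (hr0 : r ≠ 0) (hr1 : r ≤ 1) (hr : r ≤ (p⁻¹ + σ₁⁻¹)⁻¹) (hrq : r ≤ q) (A : ℕ) :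
    ∃ (R : ℕ) (hR : A + n + 1 ≤ R) (C : ℝ≥0),
      ∀ (N : ℕ) (F : JetSpace 𝕜 n N →L[𝕜] 𝕜) (h : κ.GrowthOn F G A),
        lqNorm q (fun k =>
          eLpNorm (fun x => t k x • h.extend hG hR (κ.diffShift k x)) p volume) ≤
        C * lqNorm q fun j => eLpNorm (fun x => t j x • G.indicator (κ.coeff F j) x) p volume := by
  have hrt : r ≠ ⊤ := ne_top_of_le_ne_top ENNReal.one_ne_top hr1
  have hq0 : q ≠ 0 := fun hq => hr0 (by simpa [hq] using hrq)
  have hu : 1 ≤ q / r := by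
    rw [ENNReal.le_div_iff_mul_le (Or.inl hr0) (Or.inl hrt), one_mul]
    exact hrq
  obtain ⟨R, hR, C, ρ, hρ, h₁⟩ := ht.exists_extend_eLpNorm_le habs hG hm hα₂ hσ hr0 hr1 hr A
  have hs0 : 0 < r.toReal := ENNReal.toReal_pos hr0 hrt
  have hρ' : (1 - ρ)⁻¹ ≠ ⊤ := ENNReal.inv_ne_top.2 (tsub_pos_of_lt hρ).ne'
  have hfin : ((C : ℝ≥0∞) * (4 + 2 * (1 - ρ)⁻¹)) ^ r.toReal⁻¹ ≠ ⊤ := by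
    refine ENNReal.rpow_ne_top_of_nonneg (by positivity) ?_
    finiteness
  refine ⟨R, hR, (((C : ℝ≥0∞) * (4 + 2 * (1 - ρ)⁻¹)) ^ r.toReal⁻¹).toNNReal, fun N F h => ?_⟩
  rw [ENNReal.coe_toNNReal hfin, ← ENNReal.rpow_le_rpow_iff hs0,
    ENNReal.mul_rpow_of_nonneg _ _ hs0.le, ← ENNReal.rpow_mul, inv_mul_cancel₀ hs0.ne',
    ENNReal.rpow_one, lqNorm_eq_eLpNorm hq0, lqNorm_eq_eLpNorm hq0, ← eLpNorm_rpow _ hr0 hrt,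
    ← eLpNorm_rpow _ hr0 hrt]
  simp only [enorm_eq_self]
  exact eLpNorm_count_shifts_le hu C (h₁ N F h)

end WeightClass

/-! ### The intrinsic characterisation -/

section Intrinsic

lemma lqNorm_mono (q : ℝ≥0∞) {a b : ℕ → ℝ≥0∞} (h : ∀ k, a k ≤ b k) : lqNorm q a ≤ lqNorm q b := by
  unfold lqNorm
  split_ifs
  · exact iSup_mono h
  · gcongr with k
    exact h k

lemma le_lqNorm {q : ℝ≥0∞} (hq : q ≠ 0) (a : ℕ → ℝ≥0∞) (k : ℕ) : a k ≤ lqNorm q a := by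
  unfold lqNorm
  split_ifs with h
  · exact le_iSup a k
  · have hpos := ENNReal.toReal_pos hq h
    rw [one_div, ENNReal.le_rpow_inv_iff hpos]
    exact ENNReal.le_tsum k

variable {𝕜 : Type*} [RCLike 𝕜] {n : ℕ} {κ : UnitKernel 𝕜 n} {G : Opens (EuclideanSpace ℝ (Fin n))}
  {p q : ℝ≥0∞} {t : ℕ → EuclideanSpace ℝ (Fin n) → ℝ}

lemma besovNorm_eq (g : SeDual 𝕜 n) : besovNorm p q t κ.toFun g =
    lqNorm q fun k => eLpNorm (fun x => t k x • g (κ.diffShift k x)) p volume := by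
  have habs : κ.Absorbs ((⊤ : Opens (EuclideanSpace ℝ (Fin n))) : Set _) := by
    rw [Opens.coe_top]; exact κ.absorbs_univ
  unfold besovNorm
  congr 1; ext k
  congr 1; ext x
  rw [UnitKernel.conv_kernel_eq habs (f := restrictTo ⊤ g) (L := g) (fun _ => rfl) k (Opens.mem_top x)]

lemma intrinsicNorm_eq (habs : κ.Absorbs G) {f : 𝓓(G, 𝕜) →L[𝕜] 𝕜} {L : Se 𝕜 n → 𝕜}
    (hL : ∀ θ, f θ = L (testToSe G θ)) : intrinsicNorm p q t κ.toFun G f =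
      lqNorm q fun k => eLpNorm (fun x => t k x • L (κ.diffShift k x)) p
        (volume.restrict (G : Set (EuclideanSpace ℝ (Fin n)))) := by
  unfold intrinsicNorm
  congr 1; ext k
  refine eLpNorm_congr_ae (ae_restrict_of_forall_mem G.isOpen.measurableSet fun x hx => ?_)
  simp only
  rw [UnitKernel.conv_kernel_eq habs hL k hx]

/-- At points of `G` the kernels `φ_k(x - ·)` are test functions on `G`, so the convolutions of any
extension agree there with those of `f`. -/
lemma intrinsicNorm_le_traceNorm (habs : κ.Absorbs G) (f : 𝓓(G, 𝕜) →L[𝕜] 𝕜) :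
    intrinsicNorm p q t κ.toFun G f ≤ traceNorm p q t κ.toFun G f := by
  refine le_iInf₂ fun g hg => ?_
  rw [besovNorm_eq, intrinsicNorm_eq habs (L := g) fun θ => (congrFun hg θ).symm]
  exact lqNorm_mono q fun k => eLpNorm_mono_measure _ Measure.restrict_le_self

/-- The trace quasi-norm is bounded by the intrinsic one. -/
lemma WeightClass.exists_traceNorm_le {σ₁ σ₂ : ℝ≥0∞} {α₁ α₂ α₃ : ℝ}
    (ht : WeightClass p σ₁ σ₂ α₁ α₂ α₃ t) (hp : p ≠ 0) (hσ₁ : σ₁ ≠ 0) (hq : q ≠ 0)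
    (habs : κ.Absorbs G) (hσ : p ≤ σ₂)
    (hL : (α₂ : EReal) < momentOrder (differenceKernel κ.toFun) + 1) :
    ∃ C : ℝ≥0, ∀ f : 𝓓(G, 𝕜) →L[𝕜] 𝕜, IsExpGrowth G f →
      traceNorm p q t κ.toFun G f ≤ (C + 1 : ℝ≥0) * intrinsicNorm p q t κ.toFun G f := by
  obtain ⟨m, hα₂, hm⟩ := exists_vanishingMoments hL
  have hG : MeasurableSet (G : Set (EuclideanSpace ℝ (Fin n))) := G.isOpen.measurableSet
  -- A positive exponent below `1`, `q` and the Hölder exponent of `p` and `σ₁`, hence also below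
  -- `p`.
  set r : ℝ≥0∞ := (p⁻¹ + σ₁⁻¹ + q⁻¹ + 1)⁻¹
  have hr0 : r ≠ 0 := by
    simp only [r, ne_eq, ENNReal.inv_eq_zero, ENNReal.add_eq_top, ENNReal.inv_eq_top]
    simp [hp, hσ₁, hq]
  have hr1 : r ≤ 1 := by
    rw [ENNReal.inv_le_one]; exact le_add_self
  have hr : r ≤ (p⁻¹ + σ₁⁻¹)⁻¹ := by
    rw [ENNReal.inv_le_inv, add_assoc]; exact le_self_add
  have hrq : r ≤ q := by
    rw [ENNReal.inv_le_iff_inv_le, add_assoc, add_left_comm]; exact le_self_add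
  -- The rate `A`, then `R` and `C`, are fixed before `f`; this is what makes the constant uniform.
  obtain ⟨A, hA⟩ := ht.exists_growthOn habs hG hr0 hr1 hr
  obtain ⟨R, hR, C, hC⟩ := ht.exists_extend_lqNorm_le habs hG hm hα₂ hσ hr0 hr1 hr hrq A
  refine ⟨C, fun f hf => ?_⟩
  obtain ⟨N, F, hF⟩ := hf.exists_extension
  have hI : intrinsicNorm p q t κ.toFun G f = lqNorm q fun j =>
      eLpNorm (fun x => t j x • (G : Set (EuclideanSpace ℝ (Fin n))).indicator (κ.coeff F j) x)
        p volume := by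
    rw [intrinsicNorm_eq habs (L := fun θ => F (jet N θ)) fun θ => (hF θ).symm]
    congr 1; ext k
    rw [← eLpNorm_indicator_eq_eLpNorm_restrict hG]
    congr 1; ext x
    rw [Set.indicator_smul_apply]
    rfl
  -- The constant `C + 1` is nonzero, so an infinite intrinsic norm makes the right side infinite.
  -- Otherwise each single level is bounded and the growth estimate applies.
  rcases eq_or_ne (intrinsicNorm p q t κ.toFun G f) ⊤ with htop | htop
  · rw [htop, ENNReal.mul_top (by simp)]
    exact le_top
  have hgrow : κ.GrowthOn F G A := by
    refine hA N F (intrinsicNorm p q t κ.toFun G f).toNNReal fun j => ?_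
    rw [ENNReal.coe_toNNReal htop, hI]
    exact le_lqNorm hq _ j
  have hres : restrictTo G (hgrow.extend hG hR) = f := by
    ext θ
    rw [← hF θ]
    exact hgrow.extend_eq hG hR habs (θ := testToSe G θ)
      ⟨θ.contDiff, θ.hasCompactSupport, θ.tsupport_subset⟩
  refine (iInf₂_le (hgrow.extend hG hR) hres).trans ?_
  rw [besovNorm_eq]
  refine (hC N F hgrow).trans ?_
  rw [hI]
  gcongr
  exact le_self_add

end Intrinsic

/-! ### The cone condition for special Lipschitz domains. -/

section Cone

variable {d : ℕ} {M : ℝ≥0}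

/-- Moving by `-s z ∈ K` raises the last coordinate by more than `M` times the horizontal
displacement, while the graph rises by at most that much. -/
lemma sub_smul_mem_epigraph {ϖ : EuclideanSpace ℝ (Fin d) → ℝ} (hϖ : LipschitzWith M ϖ)
    {x z : EuclideanSpace ℝ (Fin (d + 1))} (hx : x ∈ epigraph ϖ) (hz : -z ∈ cone d M) {s : ℝ}
    (hs : 0 < s) : x - s • z ∈ epigraph ϖ := by
  change ϖ (firstCoords (x - s • z)) < x (Fin.last d) - s * z (Fin.last d)
  change ϖ (firstCoords x) < x (Fin.last d) at hx
  change M * ‖firstCoords (-z)‖ < -z (Fin.last d) at hz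
  have h1 : firstCoords (x - s • z) - firstCoords x = s • firstCoords (-z) := by
    ext i
    simp [firstCoords]
  have h2 : ϖ (firstCoords (x - s • z)) - ϖ (firstCoords x) ≤ M * (s * ‖firstCoords (-z)‖) := by
    have h3 := hϖ.dist_le_mul (firstCoords (x - s • z)) (firstCoords x)
    rw [Real.dist_eq, dist_eq_norm, h1, norm_smul, Real.norm_of_nonneg hs.le] at h3
    exact (le_abs_self _).trans h3
  have h4 : s * (M * ‖firstCoords (-z)‖) < s * -z (Fin.last d) := mul_lt_mul_of_pos_left hz hs
  linarith

variable {𝕜 : Type*} [RCLike 𝕜]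

/-- Test functions with integral one as unit kernels. -/
lemma IsTestOn.exists_unitKernel {n : ℕ} {Ω : Set (EuclideanSpace ℝ (Fin n))}
    {φ₀ : EuclideanSpace ℝ (Fin n) → 𝕜} (h : IsTestOn Ω φ₀) (hint : ∫ x, φ₀ x = 1) :
    ∃ κ : UnitKernel 𝕜 n, κ.toFun = φ₀ := by
  obtain ⟨ρ, hρ⟩ := h.hasCompactSupport.isCompact.isBounded.exists_norm_le
  refine ⟨⟨φ₀, h.contDiff, h.hasCompactSupport, hint, max ρ 0, le_max_right _ _, fun z hz => ?_⟩,
    rfl⟩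
  exact (hρ z (subset_tsupport φ₀ hz)).trans (le_max_left _ _)

end Cone

end

end VarBesov

theorem theorem3p2 {𝕜 : Type*} [RCLike 𝕜] (d : ℕ)
    (p q σ₁ σ₂ : ℝ≥0∞) (hp : 0 < p) (hq : 0 < q) (hσ₁ : 0 < σ₁) (hσ₂ : 0 < σ₂)
    (α₁ α₂ α₃ : ℝ) (hα₃ : 0 ≤ α₃)
    (t : ℕ → EuclideanSpace ℝ (Fin (d + 1)) → ℝ)
    (ht : VarBesov.WeightClass p σ₁ σ₂ α₁ α₂ α₃ t)
    (M : ℝ≥0) (hM : 1 ≤ M)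
    (ϖ : EuclideanSpace ℝ (Fin d) → ℝ) (hϖ : LipschitzWith M ϖ)
    (G : TopologicalSpace.Opens (EuclideanSpace ℝ (Fin (d + 1))))
    (hG : (G : Set (EuclideanSpace ℝ (Fin (d + 1)))) = VarBesov.epigraph ϖ)
    (φ₀ : EuclideanSpace ℝ (Fin (d + 1)) → 𝕜)
    (hφ₀ : VarBesov.IsTestOn {x | -x ∈ VarBesov.cone d M} φ₀)
    (hφ₀_int : ∫ x, φ₀ x = 1)
    (hσ : p ≤ σ₂)
    (hL : (α₂ : EReal) < VarBesov.momentOrder (VarBesov.differenceKernel φ₀) + 1) :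
    ∃ C : ℝ≥0, 0 < C ∧ ∀ f : 𝓓(G, 𝕜) →L[𝕜] 𝕜, VarBesov.IsExpGrowth G f →
      VarBesov.traceNorm p q t φ₀ G f ≤ C * VarBesov.intrinsicNorm p q t φ₀ G f ∧
      VarBesov.intrinsicNorm p q t φ₀ G f ≤ C * VarBesov.traceNorm p q t φ₀ G f := by
  obtain ⟨κ, rfl⟩ := hφ₀.exists_unitKernel hφ₀_int
  have habs : κ.Absorbs G := by
    intro x hx z hz s hs
    rw [hG] at hx ⊢
    exact VarBesov.sub_smul_mem_epigraph hϖ hx (hφ₀.tsupport_subset hz) hs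
  obtain ⟨C, hC⟩ := ht.exists_traceNorm_le hp.ne' hσ₁.ne' hq.ne' habs hσ hL
  -- Adding `1` makes the constant positive and at least `1`, which the second inequality, true with
  -- constant `1`, requires.
  refine ⟨C + 1, by positivity, fun f hf => ⟨hC f hf, ?_⟩⟩
  refine (VarBesov.intrinsicNorm_le_traceNorm habs f).trans ?_
  refine le_mul_of_one_le_left zero_le ?_
  exact_mod_cast (le_add_self : (1 : ℝ≥0) ≤ C + 1)
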